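/- Notation. Let $N\ge 3$, $\mathbf e(z)=e^{2\pi i z}$, $q=\mathbf e(\tau)$ and $q^a=\mathbf e(a\tau)$. Matrix indices lie in $\{1,\dots,N\}$ and are read modulo $N$ (so $u_{N+1}=u_1$, $v_0=v_N$, etc.). Put $\vartheta(z)=\sum_{j\in\mathbb Z}q^{\frac12(j+\frac12)^2}\mathbf e((j+\tfrac12)(z+\tfrac12))$, $\phi(u,z)=\frac{\vartheta(u+z)\vartheta'(0)}{\vartheta(u)\vartheta(z)}$, $E_2(z,\tau)=\sum_{n\in\mathbb Z}\sum_{k\in\mathbb Z}(z+n\tau+k)^{-2}$, and let $(T_{mn})_{ij}=\mathbf e(\tfrac{mn}{2N})\mathbf e(\tfrac{im}N)$ if $j-i\equiv n \bmod N$ and $0$ otherwise. The elliptic top. For an $N\times N$ complex matrix $S$ let $s_{mn}=\frac1N\sum_{i,j}S_{ij}(T_{-m,n})_{ij}$ and, summing over $0\le m,n<N$ with $(m,n)\ne(0,0)$, $$L^{rot}(z)=\sum s_{mn}\,\mathbf e(-\tfrac{nz}N)\,\phi(-\tfrac{m+n\tau}N,z)\,T_{mn},\qquad M^{rot}(z)=\sum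 s_{mn}\,\mathbf e(-\tfrac{nz}N)\,\partial_u\phi(u,z)|_{u=-\frac{m+n\tau}N}\,T_{mn},$$ $$H^{rot}=-\tfrac12\operatorname{Tr}S\,J(S),\qquad J(S)=\sum E_2(\tfrac{m+n\tau}N,\tau)\,s_{mn}T_{mn},\qquad \{S_{ij},S_{kl}\}=N(S_{kj}\delta_{il}-S_{il}\delta_{kj}).$$ Scale $S_{ij}=\tilde S_{ij}q^{-\mathfrak g(i,j)}$, where $\mathfrak g(i,j)=\frac{1-\delta_{ij}}{2N}$ (periodic case) or $\mathfrak g(i,j)=\frac{1-\delta_{ij}-\frac12\delta_{i1}\delta_{jN}}{2N}$ (nonperiodic case), and put $z=\tilde z+\tau/2$. Let $w=1$ in the periodic case and $w=0$ in the nonperiodic case. Claim. In each of the two cases the following holds. (1) Limit. For fixed $\tilde S,\tilde z$, as $\operatorname{Im}\tau\to+\infty$, $L^{rot}\to\tilde L$, $M^{rot}\to\tilde M$, $H^{rot}\to\tilde H$, and the Poisson bracket written in the coordinates $\tilde S_{ij}$ converges (on any two functions, at any point where they are complex differentiable) to the bracket whose only nonzero values on coordinates are $\{\tilde S_{ii},\tilde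 S_{jk}\}=N(\tilde S_{ji}\delta_{ik}-\tilde S_{ik}\delta_{ij})$ and their opposites. Here, with $\epsilon_{ij}=w$ for $(i,j)=(1,N)$, $\epsilon_{ij}=1$ otherwise, and $\tilde\delta(n)=1$ if $N\mid n$, $\tilde\delta(n)=0$ otherwise, $$\tilde L_{ij}=\tfrac{2\pi i}N\,\delta_{ij}\sum_{m=1}^N\sum_{k=1}^{N-1}\tilde S_{mm}\frac{\mathbf e(k(i-m)/N)}{\mathbf e(-k/N)-1}+2\pi i\,\tilde S_{i+1,i+2}\,\mathbf e(-\tfrac{\tilde z}N)\,\tilde\delta(j-i-1)-2\pi i\,\epsilon_{ij}\,\tilde S_{i,i-1}\,\mathbf e(\tfrac{\tilde z}N)\,\tilde\delta(j-i+1),$$ $$\tilde M_{ij}=-\tfrac{\pi^2}N\delta_{ij}\sum_{m=1}^{N-1}\sum_{k=1}^N\frac{\mathbf e(m(i-k)/N)}{\sin^2(\pi m/N)}\tilde S_{kk}+4\pi^2\,\tilde S_{i+1,i+2}\,\mathbf e(-\tfrac{\tilde z}N)\,\tilde\delta(j-i-1),$$ $$\tilde H=-\tfrac{\pi^2}N\sum_{m,n=1}^N\sum_{k=1}^{N-1}\tilde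 S_{mm}\tilde S_{nn}\frac{\mathbf e(k(n-m)/N)}{1-\cos(2\pi k/N)}+4\pi^2\Big(w\,\tilde S_{12}\tilde S_{1N}+\sum_{i=2}^N\tilde S_{i,i+1}\tilde S_{i,i-1}\Big)$$ (outside exponents and prefactors of the form $2\pi i$, $i$ is an index). (2) Poisson algebra. The limiting bracket makes the entire functions of $\tilde S$ a Poisson algebra. The trace $\sum_i\tilde S_{ii}$ and all products $\tilde S_{i_1i_2}\tilde S_{i_2i_3}\cdots\tilde S_{i_ki_1}$ with distinct $i_1,\dots,i_k$ and $2\le k\le N$ are Casimir functions. (3) Lax equation. $\tilde H=\frac12\operatorname{Tr}\tilde L^2$ and $\{\tilde H,\tilde L\}=N[\tilde L,\tilde M]$; hence $\frac{d}{dt}\tilde L=N[\tilde L,\tilde M]$ along every solution of $\frac{d}{dt}\tilde S_{ij}=\{\tilde H,\tilde S_{ij}\}$. For $i\neq j$, $$\{\tilde H,\tilde S_{ij}\}=4\pi^2\tilde S_{ij}\sum_{m=1}^N\sum_{k=1}^{N-1}\tilde S_{mm}\sin\tfrac{\pi k(j-i)}N\,\sin\tfrac{\pi k(i+j-2m)}N\,\Big(1-\cos\tfrac{2\pi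 k}N\Big)^{-1}.$$ (4) Bosonization. Let $M\ne0$, $d$ and $c_{ij}$ be complex constants; put $d'=MN$ in the periodic case and $d'=d$ in the nonperiodic case. Define a map $B:(u,v)\mapsto\tilde S$ by $$\tilde S_{ii}=\tfrac N{2\pi i}(v_{i-1}-v_i),\quad \tilde S_{i,i+1}=MN\,\mathbf e(u_i),\quad \tilde S_{i+1,i}=MN\,\mathbf e(-u_i)\ (i\ne N),\quad \tilde S_{1,N}=d'\,\mathbf e(-u_N),$$ $$\tilde S_{i,i+k}=c_{i,i+k}\,\mathbf e(u_i+\dots+u_{i+k-1})\quad(2\le k\le N-2).$$ It is a Poisson map for the canonical bracket $\{v_i,u_j\}=\delta_{ij}$ on $\mathbb C^{2N}$. It is also a Poisson map on the centre-of-mass phase space $\mathcal R^T=\{(u,v)\in\mathbb C^{2N}:\sum u_i=\sum v_i=0\}$ with the symplectic form $\sum dv_i\wedge du_i$. On $\mathcal R^T$ the map $B$ is a holomorphic immersion. Its image is exactly the level set of Casimir functions $$\sum_i\tilde S_{ii}=0,\quad \prod_i\tilde S_{i,i+1}=(MN)^N,\quad \tilde S_{i,i+1}\tilde S_{i+1,i}=(MN)^2\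 (i\neq N),\quad \tilde S_{N,1}\tilde S_{1,N}=MNd',$$ $$\Big(\prod_{j=1}^k\tilde S_{i+j-1,i+j}\Big)\tilde S_{i+k,i}=(MN)^kc_{i+k,i}\quad(2\le k\le N-2),$$ its tangent spaces are the spans of the Hamiltonian vectors (so that the level set is a symplectic leaf), and $B(u,v)=B(u',v')$ if and only if $v=v'$ and $u-u'\in\mathbb Z^N$. (5) Toda chain. On $\mathcal R^T$, $\tilde H\circ B=N^2H^{T}$ with $$H^{T}=\tfrac12\sum_{i=1}^Nv_i^2+4\pi^2M^2\Big(\sum_{i=1}^{N-1}\mathbf e(u_{i+1}-u_i)+w\,\mathbf e(u_1-u_N)\Big),$$ which is the Hamiltonian $H^{PT}$ of the periodic Toda chain if $w=1$ and $H^{AT}$ of the nonperiodic one if $w=0$. For a differentiable curve $x(t)$ in $\mathcal R^T$, $B(x(t))$ satisfies the limiting equations of motion if and only if $x(t)$ satisfies Hamilton's equations with Hamiltonian $N^2H^T$. (6) Standard Lax form. With $g=\operatorname{diag}\big(\mathbf e(\tfrac{j\tilde z}N)\prod_{k<j}\mathbf e(-u_k)\big)_{j=1}^N$, after the substitution $\tilde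 S=B(u,v)$ on $\mathcal R^T$, the matrix $g^{-1}\tilde Lg$ has diagonal entries $Nv_j$, entries $2\pi i\,MN\,\mathbf e(u_{j+1}-u_j)$ at $(j,j+1)$ and $-2\pi i\,MN$ at $(j+1,j)$ for $1\le j<N$, the corner entries $2\pi i\,MN\,\mathbf e(u_1-u_N-\tilde z)$ at $(N,1)$ and $-2\pi i\,w\,MN\,\mathbf e(\tilde z)$ at $(1,N)$, and zeros elsewhere. Along the flow of $N^2H^T$ the matrix $g^{-1}\tilde Mg+\frac1Ng^{-1}\dot g$ equals the matrix with entries $4\pi^2MN\,\mathbf e(u_{j+1}-u_j)$ at $(j,j+1)$ for $1\le j<N$, $4\pi^2MN\,\mathbf e(u_1-u_N-\tilde z)$ at $(N,1)$ and zeros elsewhere, plus the scalar matrix $2\pi i\big(\sum_k k\,v_k\big)\mathbf 1$ (which commutes with everything and does not affect the Lax equation). -/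

import Mathlib

open Complex Filter Topology

namespace EllipticTop

/-! ### Elliptic functions -/

/-- `e(z) = exp(2πiz)`.  With `q = e(τ)`, the power `q ^ a` is always read as `e(a τ)`. -/
noncomputable def e (z : ℂ) : ℂ := exp (2 * Real.pi * I * z)

/-- The odd theta function with characteristics `[1/2, 1/2]`. -/
noncomputable def vartheta (z τ : ℂ) : ℂ :=
  ∑' j : ℤ, e (((j : ℂ) + 1 / 2) ^ 2 / 2 * τ) * e (((j : ℂ) + 1 / 2) * (z + 1 / 2))

/-- The Kronecker function `ϕ(u,z) = ϑ(u+z) ϑ'(0) / (ϑ(u) ϑ(z))`. -/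
noncomputable def phi (u z τ : ℂ) : ℂ :=
  vartheta (u + z) τ * deriv (fun w => vartheta w τ) 0 / (vartheta u τ * vartheta z τ)

/-- The second Eisenstein function (rows are summed first; both sums converge absolutely). -/
noncomputable def E2 (z τ : ℂ) : ℂ := ∑' n : ℤ, ∑' k : ℤ, 1 / (z + n * τ + k) ^ 2

/-! ### The elliptic `SL(N, ℂ)` top -/

/-- The space of matrices `S`, with the entries `S i j` as coordinates.  The index `i : Fin N`
stands for the label `i + 1 ∈ {1, …, N}`, and addition of indices is cyclic modulo `N`. -/
abbrev Phase (N : ℕ) : Type := Fin N → Fin N → ℂ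

/-- The sin-algebra basis matrices `T_{mn}`. -/
noncomputable def T (N : ℕ) (m n : ℤ) : Matrix (Fin N) (Fin N) ℂ :=
  Matrix.of fun i j =>
    if (N : ℤ) ∣ ((j : ℕ) : ℤ) - ((i : ℕ) : ℤ) - n then
      e ((m : ℂ) * n / (2 * N)) * e ((((i : ℕ) : ℂ) + 1) * m / N)
    else 0

/-- The coordinate `s_{mn}` of `S` in the sin-algebra basis. -/
noncomputable def sinCoord {N : ℕ} (S : Phase N) (m n : ℤ) : ℂ :=
  1 / (N : ℂ) * ∑ i, ∑ j, S i j * T N (-m) n i j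

/-- `∑ s_{mn} a(m,n) T_{mn}` over `0 ≤ m, n < N` with `(m,n) ≠ (0,0)`. -/
noncomputable def sinSum {N : ℕ} (S : Phase N) (a : ℕ → ℕ → ℂ) : Matrix (Fin N) (Fin N) ℂ :=
  ∑ p ∈ (Finset.range N ×ˢ Finset.range N).erase (0, 0),
    (sinCoord S p.1 p.2 * a p.1 p.2) • T N p.1 p.2

/-- The first Lax matrix of the elliptic top. -/
noncomputable def topL {N : ℕ} (S : Phase N) (z τ : ℂ) : Matrix (Fin N) (Fin N) ℂ :=
  sinSum S fun m n => e (-(n * z / N)) * phi (-((m + n * τ) / N)) z τ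

/-- The second Lax matrix of the elliptic top. -/
noncomputable def topM {N : ℕ} (S : Phase N) (z τ : ℂ) : Matrix (Fin N) (Fin N) ℂ :=
  sinSum S fun m n => e (-(n * z / N)) * deriv (fun u => phi u z τ) (-((m + n * τ) / N))

/-- The operator `J` of the elliptic top. -/
noncomputable def topJ {N : ℕ} (S : Phase N) (τ : ℂ) : Matrix (Fin N) (Fin N) ℂ :=
  sinSum S fun m n => E2 ((m + n * τ) / N) τ

/-- The Hamiltonian `-½ Tr (S J(S))` of the elliptic top. -/
noncomputable def topH {N : ℕ} (S : Phase N) (τ : ℂ) : ℂ :=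
  -(1 / 2) * (Matrix.of S * topJ S τ).trace

/-! ### Poisson brackets on the space of matrices -/

/-- The coordinate function `S ↦ S i j`. -/
def coord {N : ℕ} (i j : Fin N) (S : Phase N) : ℂ := S i j

/-- The partial derivative `∂F/∂S_{ij}`. -/
noncomputable def pd {N : ℕ} (F : Phase N → ℂ) (S : Phase N) (i j : Fin N) : ℂ :=
  fderiv ℂ F S (Pi.single i (Pi.single j 1))

/-- The bracket of functions with `{S_{ij}, S_{kl}} = P S i j k l`. -/
noncomputable def bracketOf {N : ℕ} (P : Phase N → Fin N → Fin N → Fin N → Fin N → ℂ)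
    (F G : Phase N → ℂ) (S : Phase N) : ℂ :=
  ∑ i, ∑ j, ∑ k, ∑ l, pd F S i j * pd G S k l * P S i j k l

/-- The linear brackets `{S_{ij}, S_{kl}} = N (S_{kj} δ_{il} - S_{il} δ_{kj})` of the top. -/
noncomputable def topTensor {N : ℕ} (S : Phase N) (i j k l : Fin N) : ℂ :=
  N * ((if i = l then S k j else 0) - (if k = j then S i l else 0))

/-- The brackets of the limiting system: the only nonzero ones are
`{S_{ii}, S_{jk}} = N (S_{ji} δ_{ik} - S_{ik} δ_{ij})` and their opposites. -/
noncomputable def limTensor {N : ℕ} (S : Phase N) (i j k l : Fin N) : ℂ :=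
  if i = j then N * ((if i = l then S k i else 0) - (if i = k then S i l else 0))
  else if k = l then -(N * ((if k = j then S i k else 0) - (if k = i then S k j else 0)))
  else 0

/-- The Poisson bracket of the limiting system. -/
noncomputable abbrev limBracket {N : ℕ} (F G : Phase N → ℂ) (S : Phase N) : ℂ :=
  bracketOf limTensor F G S

/-- A binary operation on functions makes the algebra of entire functions a Poisson algebra. -/
structure IsPoisson {N : ℕ}
    (br : (Phase N → ℂ) → (Phase N → ℂ) → Phase N → ℂ) : Prop where
  smooth : ∀ F G, ContDiff ℂ (⊤ : ℕ∞) F → ContDiff ℂ (⊤ : ℕ∞) G → ContDiff ℂ (⊤ : ℕ∞) (br F G)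
  add : ∀ F G K, ContDiff ℂ (⊤ : ℕ∞) F → ContDiff ℂ (⊤ : ℕ∞) G → ContDiff ℂ (⊤ : ℕ∞) K →
    br (F + G) K = br F K + br G K
  smul : ∀ (a : ℂ) F G, ContDiff ℂ (⊤ : ℕ∞) F → ContDiff ℂ (⊤ : ℕ∞) G →
    br (a • F) G = a • br F G
  skew : ∀ F G, ContDiff ℂ (⊤ : ℕ∞) F → ContDiff ℂ (⊤ : ℕ∞) G → br F G = -br G F
  leibniz : ∀ F G K, ContDiff ℂ (⊤ : ℕ∞) F → ContDiff ℂ (⊤ : ℕ∞) G → ContDiff ℂ (⊤ : ℕ∞) K →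
    br F (G * K) = br F G * K + G * br F K
  jacobi : ∀ F G K, ContDiff ℂ (⊤ : ℕ∞) F → ContDiff ℂ (⊤ : ℕ∞) G → ContDiff ℂ (⊤ : ℕ∞) K →
    br F (br G K) + br G (br K F) + br K (br F G) = 0

/-! ### The two scalings -/

/-- The two chains, each with its own scaling of the coordinates. -/
inductive Chain where
  | periodic
  | nonperiodic

/-- The factor of the terms that close the chain up. -/
def Chain.wrap : Chain → ℂ
  | .periodic => 1
  | .nonperiodic => 0

/-- The exponents `𝔤(i,j)`: `(1 - δ_{ij}) / (2N)` for the periodic chain and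
`(1 - δ_{ij} - ½ δ_{i1} δ_{jN}) / (2N)` for the nonperiodic one. -/
noncomputable def Chain.expo {N : ℕ} (K : Chain) (i j : Fin N) : ℂ :=
  match K with
  | .periodic => (1 - if i = j then 1 else 0) / (2 * N)
  | .nonperiodic =>
    (1 - (if i = j then 1 else 0) - (if (i : ℕ) = 0 ∧ (j : ℕ) + 1 = N then 1 / 2 else 0)) / (2 * N)

/-- The original coordinates `S_{ij} = S̃_{ij} q^{-𝔤(i,j)}` in terms of the scaled ones. -/
noncomputable def unscale {N : ℕ} (K : Chain) (τ : ℂ) (S : Phase N) : Phase N :=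
  fun i j => S i j * e (-(K.expo i j) * τ)

/-- The scaled coordinates `S̃_{ij} = S_{ij} q^{𝔤(i,j)}` in terms of the original ones. -/
noncomputable def scale {N : ℕ} (K : Chain) (τ : ℂ) (S : Phase N) : Phase N :=
  fun i j => S i j * e (K.expo i j * τ)

/-- The Poisson bracket of the top, written in the scaled coordinates. -/
noncomputable def scaledBracket {N : ℕ} (K : Chain) (τ : ℂ) (F G : Phase N → ℂ)
    (S : Phase N) : ℂ :=
  bracketOf topTensor (F ∘ scale K τ) (G ∘ scale K τ) (unscale K τ S)

/-! ### The limiting system -/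

section Limit

variable {N : ℕ} [NeZero N]

/-- The first limiting Lax matrix. -/
noncomputable def limL (K : Chain) (S : Phase N) (z : ℂ) : Matrix (Fin N) (Fin N) ℂ :=
  Matrix.of fun i j =>
    (if j = i then
      2 * Real.pi * I / N * ∑ m : Fin N, ∑ k ∈ Finset.Ico 1 N,
        S m m * e (k * (((i : ℕ) : ℂ) - ((m : ℕ) : ℂ)) / N) * (e (-((k : ℂ) / N)) - 1)⁻¹
      else 0)
    + (if j = i + 1 then 2 * Real.pi * I * S (i + 1) (i + 2) * e (-(z / N)) else 0)
    - (if j = i - 1 then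
        (if (i : ℕ) = 0 then K.wrap else 1) * (2 * Real.pi * I * S i (i - 1) * e (z / N))
      else 0)

/-- The second limiting Lax matrix (the same for both chains). -/
noncomputable def limM (S : Phase N) (z : ℂ) : Matrix (Fin N) (Fin N) ℂ :=
  Matrix.of fun i j =>
    (if j = i then
      -((Real.pi : ℂ) ^ 2 / N) * ∑ m ∈ Finset.Ico 1 N, ∑ k : Fin N,
        (sin (Real.pi * (m / N)) ^ 2)⁻¹ * e (m * (((i : ℕ) : ℂ) - ((k : ℕ) : ℂ)) / N) * S k k
      else 0)
    + (if j = i + 1 then 4 * (Real.pi : ℂ) ^ 2 * S (i + 1) (i + 2) * e (-(z / N)) else 0)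

/-- The limiting Hamiltonian. -/
noncomputable def limH (K : Chain) (S : Phase N) : ℂ :=
  -((Real.pi : ℂ) ^ 2 / N) * ∑ m : Fin N, ∑ n : Fin N, ∑ k ∈ Finset.Ico 1 N,
      S m m * S n n * e (k * (((n : ℕ) : ℂ) - ((m : ℕ) : ℂ)) / N)
        * (1 - cos (2 * Real.pi * (k / N)))⁻¹
    + 4 * (Real.pi : ℂ) ^ 2 * ∑ i : Fin N,
      (if (i : ℕ) = 0 then K.wrap else 1) * (S i (i + 1) * S i (i - 1))

/-- The curve `S` satisfies the limiting equations of motion `dS_{ij}/dt = {H̃, S_{ij}}` at the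
time `t`. -/
def LimMotionAt (K : Chain) (S : ℝ → Phase N) (t : ℝ) : Prop :=
  ∀ i j, HasDerivAt (fun s => S s i j) (limBracket (limH K) (coord i j) (S t)) t

/-! ### The Toda chains -/

/-- The vectors of `ℂ^N` with zero sum. -/
def centred (N : ℕ) : Submodule ℂ (Fin N → ℂ) where
  carrier := {w | ∑ i, w i = 0}
  add_mem' := by
    intro a b ha hb
    simp only [Set.mem_ofPred_eq] at ha hb
    simp [Finset.sum_add_distrib, ha, hb]
  zero_mem' := by simp
  smul_mem' := by
    intro c a ha
    simp only [Set.mem_ofPred_eq] at ha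
    simp [← Finset.mul_sum, ha]

/-- Pairs `(u, v)` of positions and momenta of `N` particles. -/
abbrev Pairs (N : ℕ) : Type := (Fin N → ℂ) × (Fin N → ℂ)

/-- The phase space `{(u, v) : ∑ u_i = 0, ∑ v_i = 0}` of the Toda chains in the centre-of-mass
frame. -/
abbrev TodaPhase (N : ℕ) : Type := centred N × centred N

/-- The inclusion of the centre-of-mass phase space. -/
def incl (x : TodaPhase N) : Pairs N := (x.1.1, x.2.1)

/-- The canonical bracket `{v_i, u_j} = δ_{ij}` on all pairs `(u, v)`. -/
noncomputable def canBracket (F G : Pairs N → ℂ) (x : Pairs N) : ℂ :=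
  ∑ k : Fin N,
    (fderiv ℂ F x (0, Pi.single k 1) * fderiv ℂ G x (Pi.single k 1, 0)
      - fderiv ℂ F x (Pi.single k 1, 0) * fderiv ℂ G x (0, Pi.single k 1))

/-- The symplectic form `∑ dv_i ∧ du_i` restricted to the centre-of-mass phase space. -/
noncomputable def todaForm (a b : TodaPhase N) : ℂ :=
  ∑ i, (a.2.1 i * b.1.1 i - a.1.1 i * b.2.1 i)

/-- The projection of the `k`-th standard basis vector onto the vectors with zero sum. -/
noncomputable def proj (k : Fin N) : centred N :=
  ⟨fun i => (if i = k then 1 else 0) - 1 / (N : ℂ), by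
    have hN : (N : ℂ) ≠ 0 := Nat.cast_ne_zero.mpr (NeZero.ne N)
    change ∑ i : Fin N, ((if i = k then (1 : ℂ) else 0) - 1 / (N : ℂ)) = 0
    simp [Finset.sum_sub_distrib, hN]⟩

/-- The Hamiltonian vector field of `F` with respect to `todaForm`; see `todaForm_hamField`. -/
noncomputable def hamField (F : TodaPhase N → ℂ) (x : TodaPhase N) : TodaPhase N :=
  (∑ k, fderiv ℂ F x (0, proj k) • proj k, -∑ k, fderiv ℂ F x (proj k, 0) • proj k)

/-- The Poisson bracket of the symplectic form `todaForm`. -/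
noncomputable def todaBracket (F G : TodaPhase N → ℂ) (x : TodaPhase N) : ℂ :=
  fderiv ℂ G x (hamField F x)

theorem sum_smul_proj (w : centred N) : ∑ k, w.1 k • proj k = w := by
  have hw : ∑ i, w.1 i = 0 := w.2
  apply Subtype.ext
  funext i
  simp only [AddSubmonoidClass.coe_finsetSum, SetLike.val_smul, Finset.sum_apply, Pi.smul_apply,
    smul_eq_mul, proj, mul_sub, Finset.sum_sub_distrib, ← Finset.sum_mul, hw]
  simp

theorem sum_proj_mul (a : centred N) (k : Fin N) : ∑ i, (proj k).1 i * a.1 i = a.1 k := by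
  have ha : ∑ i, a.1 i = 0 := a.2
  simp only [proj, sub_mul, Finset.sum_sub_distrib, ← Finset.mul_sum, ha]
  simp

/-- The vector field `hamField F` is the one dual to `-dF` with respect to the symplectic form. -/
theorem todaForm_hamField (F : TodaPhase N → ℂ) (x w : TodaPhase N) :
    todaForm (hamField F x) w = -fderiv ℂ F x w := by
  have key : ∀ (c : Fin N → ℂ) (a : centred N),
      ∑ i, (∑ k, c k • proj k : centred N).1 i * a.1 i = ∑ k, c k * a.1 k := by
    intro c a
    simp only [AddSubmonoidClass.coe_finsetSum, SetLike.val_smul, Finset.sum_apply,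
      Pi.smul_apply, smul_eq_mul, Finset.sum_mul]
    rw [Finset.sum_comm]
    refine Finset.sum_congr rfl fun k _ => ?_
    rw [← sum_proj_mul a k, Finset.mul_sum]
    exact Finset.sum_congr rfl fun i _ => by ring
  have h1 : fderiv ℂ F x (w.1, 0) = ∑ k, fderiv ℂ F x (proj k, 0) * w.1.1 k := by
    have : ((w.1, 0) : TodaPhase N) = ∑ k, w.1.1 k • ((proj k, 0) : TodaPhase N) := by
      refine Prod.ext ?_ ?_
      · simp [Prod.fst_sum, sum_smul_proj]
      · simp [Prod.snd_sum]
    rw [this, map_sum]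
    exact Finset.sum_congr rfl fun k _ => by rw [map_smul, smul_eq_mul, mul_comm]
  have h2 : fderiv ℂ F x (0, w.2) = ∑ k, fderiv ℂ F x (0, proj k) * w.2.1 k := by
    have : ((0, w.2) : TodaPhase N) = ∑ k, w.2.1 k • ((0, proj k) : TodaPhase N) := by
      refine Prod.ext ?_ ?_
      · simp [Prod.fst_sum]
      · simp [Prod.snd_sum, sum_smul_proj]
    rw [this, map_sum]
    exact Finset.sum_congr rfl fun k _ => by rw [map_smul, smul_eq_mul, mul_comm]
  have h3 : fderiv ℂ F x w = fderiv ℂ F x (w.1, 0) + fderiv ℂ F x (0, w.2) := by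
    rw [← map_add]
    simp
  have k1 := key (fun k => fderiv ℂ F x (proj k, 0)) w.1
  have k2 := key (fun k => fderiv ℂ F x (0, proj k)) w.2
  rw [h3, h1, h2, ← k1, ← k2]
  simp only [todaForm, hamField, Submodule.coe_neg, Pi.neg_apply, Finset.sum_sub_distrib, neg_mul,
    Finset.sum_neg_distrib]
  ring

/-- The Toda Hamiltonian `½ ∑ v_i² + 4π²M² ∑ e(u_{i+1} - u_i)`, where the term `e(u_1 - u_N)` is
present for the periodic chain only. -/
noncomputable def todaH (K : Chain) (M : ℂ) (x : Pairs N) : ℂ :=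
  1 / 2 * ∑ i, x.2 i ^ 2
    + 4 * (Real.pi : ℂ) ^ 2 * M ^ 2 * ∑ i : Fin N,
      (if (i : ℕ) + 1 = N then K.wrap else 1) * e (x.1 (i + 1) - x.1 i)

/-- The curve `x` satisfies Hamilton's equations with the Hamiltonian `H` at the time `t`. -/
def TodaMotionAt (H : TodaPhase N → ℂ) (x : ℝ → TodaPhase N) (t : ℝ) : Prop :=
  ∀ i, HasDerivAt (fun s => (incl (x s)).1 i) (todaBracket H (fun y => (incl y).1 i) (x t)) t ∧
    HasDerivAt (fun s => (incl (x s)).2 i) (todaBracket H (fun y => (incl y).2 i) (x t)) t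

/-! ### Bosonization -/

/-- The coefficient of `e(-u_N)` in `S̃_{1,N}`: it is `MN` for the periodic chain and an arbitrary
constant `d` for the nonperiodic one. -/
noncomputable def edge (N : ℕ) (K : Chain) (M d : ℂ) : ℂ :=
  match K with
  | .periodic => M * N
  | .nonperiodic => d

/-- The bosonization formulas. -/
noncomputable def boson (K : Chain) (M d : ℂ) (c : Fin N → Fin N → ℂ) (x : Pairs N) : Phase N :=
  fun i j =>
    if j = i then N / (2 * Real.pi * I) * (x.2 (i - 1) - x.2 i)
    else if j = i + 1 then M * N * e (x.1 i)
    else if j = i - 1 then (if (i : ℕ) = 0 then edge N K M d else M * N) * e (-(x.1 j))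
    else c i j * e (∑ n ∈ Finset.range ((j - i : Fin N) : ℕ), x.1 (i + Fin.ofNat N n))

/-- The bosonization formulas on the centre-of-mass phase space. -/
noncomputable def bosonT (K : Chain) (M d : ℂ) (c : Fin N → Fin N → ℂ) (x : TodaPhase N) :
    Phase N := boson K M d c (incl x)

/-- A common level set of the Casimir functions. -/
def leaf (K : Chain) (M d : ℂ) (c : Fin N → Fin N → ℂ) : Set (Phase N) :=
  {S | ∑ i, S i i = 0 ∧
    (∏ i, S i (i + 1) = (M * N) ^ N) ∧
    (∀ i : Fin N, S i (i + 1) * S (i + 1) i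
      = M * N * (if (i : ℕ) + 1 = N then edge N K M d else M * N)) ∧
    (∀ (i : Fin N) (k : ℕ), 2 ≤ k → k + 2 ≤ N →
      (∏ j ∈ Finset.range k, S (i + Fin.ofNat N j) (i + Fin.ofNat N j + 1))
          * S (i + Fin.ofNat N k) i
        = (M * N) ^ k * c (i + Fin.ofNat N k) i)}

/-- The span at `S` of all Hamiltonian vector fields of the limiting Poisson structure. -/
def hamSpan (S : Phase N) : Submodule ℂ (Phase N) :=
  Submodule.span ℂ
    (Set.range fun p : Fin N × Fin N => (fun i j => limTensor S p.1 p.2 i j : Phase N))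

/-! ### Lax matrices of the Toda chains -/

/-- The diagonal entries `e(iz/N) ∏_{k<i} e(-u_k)` of the gauge transformation. -/
noncomputable def gauge (z : ℂ) (x : Pairs N) (i : Fin N) : ℂ :=
  e ((((i : ℕ) : ℂ) + 1) * z / N) * ∏ k ∈ Finset.univ.filter (fun k => k < i), e (-(x.1 k))

/-- The entry `e(u_{i+1} - u_i)`, which carries the spectral parameter in the corner `(N, 1)`. -/
noncomputable def hop (z : ℂ) (x : Pairs N) (i : Fin N) : ℂ :=
  if (i : ℕ) + 1 = N then e (x.1 (i + 1) - x.1 i - z) else e (x.1 (i + 1) - x.1 i)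

/-- The first Toda Lax matrix in its standard form. -/
noncomputable def todaL (K : Chain) (M z : ℂ) (x : Pairs N) : Matrix (Fin N) (Fin N) ℂ :=
  Matrix.of fun i j =>
    if j = i then N * x.2 i
    else if j = i + 1 then 2 * Real.pi * I * M * N * hop z x i
    else if j = i - 1 then
      -(2 * Real.pi * I * M * N * (if (i : ℕ) = 0 then K.wrap * e z else 1))
    else 0

/-- The second Toda Lax matrix in its standard form. -/
noncomputable def todaM (M z : ℂ) (x : Pairs N) : Matrix (Fin N) (Fin N) ℂ :=
  Matrix.of fun i j => if j = i + 1 then 4 * (Real.pi : ℂ) ^ 2 * M * N * hop z x i else 0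

end Limit

end EllipticTop

/-!
# The Inozemtsev limit of the elliptic top and the Toda chains

**The limit.** Write the arguments of the elliptic functions as `α + βτ` with `β` real. After
division by its lowest power of `q`, the theta series at such a point converges, by dominated
convergence, to its one or two lowest terms (`tendsto_theta`). This gives the leading coefficients
of `ϕ` and of `∂ϕ/∂u`, and summation over rows does the same for `E₂` (`tendsto_E2`). A sum over the
sin-algebra basis only mixes entries on the same cyclic diagonal (`sinSum_apply`). On the diagonal
`j - i = n ≠ 0` the coefficients of the Lax matrices are of order `q` to the power
`min(n, N - n) / (2N)` (`lax_expo`), while the scaling of the coordinates can make up for at most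
`1 / (2N)`. So only the diagonals next to the main one survive, and there the sum over the
characters is undone by Fourier inversion. The brackets converge because the scaling exponents
satisfy the triangle inequality, strictly when both coordinates are off-diagonal
(`Chain.rexpo_add_gt`).

**The Poisson algebra.** With `D i = ∂/∂S i i` and the linear vector fields `X i = {S i i, ·}`, which
multiply every coordinate by a weight, the limiting bracket is
`{F, G} = ∑ i, (D i F * X i G - X i F * D i G)` (`limBracket_eq`). All these derivations commute,
which gives the Jacobi identity. The weights cancel around a cycle, which gives the Casimir
functions.

**The Lax equation.** Let `l` and `m` be the diagonals of the two limiting Lax matrices. They are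
discrete primitives: `m (i + 1) - m i = 2πi * l i`, and `l (i - 1) - l i` is `2πi * S i i` up to the
trace (`mDiag_succ_sub`, `lDiag_sub_succ`). Summation by parts gives `H = ½ Tr L²`. Moreover
`∂H/∂S i i = m i`, so the Hamiltonian vector field is explicit (`ham_limH`), and the Lax equation is
an entrywise comparison (`limL_ham`).

**Bosonization.** The exponents of the off-diagonal coordinates are differences `y j - y i` of a
primitive `y` of `u` (`bosonLog_diff`). Hence the derivative of the bosonization map sends positions
to combinations of the fields `X k`, and momenta to diagonal matrices (`weightCLM_eq_bosonDeriv`,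
`bosonDeriv_snd`). Summation by parts then identifies the image of the canonical Poisson tensor
(`sum_bosonDeriv`), and the same two facts give the span of the Hamiltonian vectors
(`range_bosonDeriv`). The image is the level set because the Casimir functions determine every entry
from the diagonal and the nonzero entries `(i, i + 1)` (`leaf_ext`).

**The Toda chain.** After the substitution `l i = N v i` (`lDiag_bosonT`), since both sides have zero
sum and the same differences; so `H` becomes the Toda Hamiltonian. As the bosonization map is a
Poisson immersion, it matches the equations of motion in both directions
(`limMotionAt_bosonT_iff`). The gauge factors satisfy a two-term recursion (`gauge_succ`), from which
both standard Lax matrices are read off.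
-/

namespace EllipticTop

/-! ### The exponential and the characters of the cyclic group -/

theorem e_add (a b : ℂ) : e (a + b) = e a * e b := by
  simp only [e, mul_add, exp_add]

theorem e_zero : e 0 = 1 := by simp [e]

theorem e_ne_zero (a : ℂ) : e a ≠ 0 := exp_ne_zero _

theorem e_neg (a : ℂ) : e (-a) = (e a)⁻¹ := by simp only [e, mul_neg, exp_neg]

theorem e_sub (a b : ℂ) : e (a - b) = e a * (e b)⁻¹ := by rw [sub_eq_add_neg, e_add, e_neg]

theorem e_nat_mul (n : ℕ) (a : ℂ) : e (n * a) = e a ^ n := by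
  rw [e, e, ← exp_nat_mul]; ring_nf

theorem e_sum {ι : Type*} (s : Finset ι) (f : ι → ℂ) : e (∑ i ∈ s, f i) = ∏ i ∈ s, e (f i) := by
  rw [e, Finset.mul_sum, exp_sum]; rfl

theorem e_eq_one_iff (a : ℂ) : e a = 1 ↔ ∃ n : ℤ, a = n := by
  rw [e, exp_eq_one_iff]
  have h : (2 * Real.pi * I : ℂ) ≠ 0 := two_pi_I_ne_zero
  refine exists_congr fun n => ⟨fun H => ?_, fun H => by rw [H]; ring⟩
  exact mul_left_cancel₀ h (by rw [H]; ring)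

theorem e_int (n : ℤ) : e n = 1 := (e_eq_one_iff _).2 ⟨n, rfl⟩

theorem e_nat (n : ℕ) : e n = 1 := by exact_mod_cast e_int n

theorem norm_e (a : ℂ) : ‖e a‖ = Real.exp (-2 * Real.pi * a.im) := by
  rw [e, norm_exp]; congr 1; simp

theorem hasDerivAt_e (a : ℂ) : HasDerivAt e (2 * Real.pi * I * e a) a := by
  have := ((hasDerivAt_id a).const_mul (2 * Real.pi * I : ℂ)).cexp
  exact this.congr_deriv (by simp [e, mul_comm])

theorem sin_eq_e (a : ℂ) : sin (Real.pi * a) = I / 2 * (e (-(a / 2)) - e (a / 2)) := by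
  rw [sin, e, e]
  ring_nf

theorem cos_eq_e (a : ℂ) : cos (2 * Real.pi * a) = (e a + e (-a)) / 2 := by
  rw [cos, e, e]
  ring_nf

theorem e_half_sq (a : ℂ) : e (a / 2) ^ 2 = e a := by
  rw [← e_nat_mul]; congr 1; push_cast; ring

theorem sin_sq_eq_e (a : ℂ) : sin (Real.pi * a) ^ 2 = (2 - e a - e (-a)) / 4 := by
  have h := e_half_sq a
  have h' := e_half_sq (-a)
  have h2 : e (a / 2) * e (-(a / 2)) = 1 := by rw [← e_add]; simp [e_zero]
  rw [show -a / 2 = -(a / 2) by ring] at h'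
  rw [sin_eq_e]
  linear_combination (1 / 4) * (-h' - h + 2 * h2) +
    (1 / 4) * (e (-(a / 2)) - e (a / 2)) ^ 2 * I_sq

/-- The value `e(k a / N)` of the `k`-th character of the cyclic group `Fin N`. -/
noncomputable def χ {N : ℕ} (k : ℕ) (a : Fin N) : ℂ := e (k * ((a : ℕ) : ℂ) / N)

theorem sum_Ico_reflect (N : ℕ) (f : ℕ → ℂ) :
    ∑ k ∈ Finset.Ico 1 N, f (N - k) = ∑ k ∈ Finset.Ico 1 N, f k := by
  refine Finset.sum_nbij' (fun k => N - k) (fun k => N - k) ?_ ?_ ?_ ?_ ?_ <;>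
    intro k hk <;> simp only [Finset.mem_Ico] at hk ⊢ <;> omega

section
variable {N : ℕ} [NeZero N]

theorem N_ne_zero : (N : ℂ) ≠ 0 := Nat.cast_ne_zero.2 (NeZero.ne N)

theorem e_mod (k a : ℕ) : e (k * ((a % N : ℕ) : ℂ) / N) = e (k * (a : ℂ) / N) := by
  have h : (a : ℂ) = (a % N : ℕ) + N * (a / N : ℕ) := by exact_mod_cast (Nat.mod_add_div a N).symm
  conv_rhs => rw [h]
  have hN : (N : ℂ) ≠ 0 := N_ne_zero
  rw [show (k * ((a % N : ℕ) + N * (a / N : ℕ) : ℂ) / N) =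
    k * ((a % N : ℕ) : ℂ) / N + ((k * (a / N) : ℕ) : ℂ) by push_cast; field_simp, e_add, e_nat,
    mul_one]

theorem χ_add (k : ℕ) (a b : Fin N) : χ k (a + b) = χ k a * χ k b := by
  rw [χ, χ, χ, Fin.val_add, e_mod, ← e_add]
  congr 1; push_cast; ring

theorem χ_zero (k : ℕ) : χ k (0 : Fin N) = 1 := by simp [χ, e_zero]

theorem χ_neg (k : ℕ) (a : Fin N) : χ k (-a) = (χ k a)⁻¹ := by
  refine eq_inv_of_mul_eq_one_left ?_
  rw [← χ_add, neg_add_cancel, χ_zero]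

theorem χ_sub (k : ℕ) (a b : Fin N) : χ k (a - b) = χ k a * (χ k b)⁻¹ := by
  rw [sub_eq_add_neg, χ_add, χ_neg]

theorem χ_sub_eq (k : ℕ) (a b : Fin N) :
    χ k (a - b) = e (k * (((a : ℕ) : ℂ) - ((b : ℕ) : ℂ)) / N) := by
  rw [χ_sub, χ, χ, ← e_neg, ← e_add]; congr 1; ring

theorem χ_one (hN : 2 ≤ N) (k : ℕ) : χ k (1 : Fin N) = e (k / N) := by
  rw [χ, Fin.val_one', Nat.mod_eq_of_lt hN]; simp

theorem χ_reflect {k : ℕ} (hk : k ≤ N) (a : Fin N) : χ (N - k) a = (χ k a)⁻¹ := by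
  have hN : (N : ℂ) ≠ 0 := N_ne_zero
  refine eq_inv_of_mul_eq_one_left ?_
  rw [χ, χ, ← e_add, Nat.cast_sub hk]
  rw [show ((N : ℂ) - k) * ((a : ℕ) : ℂ) / N + k * ((a : ℕ) : ℂ) / N = ((a : ℕ) : ℂ) by
    field_simp; ring, e_nat]

theorem e_frac_ne_one {k : ℕ} (h0 : 0 < k) (hk : k < N) : e ((k : ℂ) / N) ≠ 1 := by
  rw [Ne, e_eq_one_iff]
  rintro ⟨n, hn⟩
  have hN : (N : ℂ) ≠ 0 := N_ne_zero
  rw [div_eq_iff hN] at hn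
  have hn' : (k : ℤ) = n * N := by exact_mod_cast hn
  have : N ∣ k := Int.natCast_dvd_natCast.1 ⟨n, by rw [hn', mul_comm]⟩
  exact absurd (Nat.le_of_dvd h0 this) (not_le.2 hk)

/-- Orthogonality of the characters, summed over the characters. -/
theorem sum_range_χ (a : Fin N) :
    ∑ k ∈ Finset.range N, χ k a = if a = 0 then (N : ℂ) else 0 := by
  split_ifs with h
  · simp [h, χ_zero]
  · have h1 : ∀ k, χ k a = e (((a : ℕ) : ℂ) / N) ^ k := fun k => by
      rw [← e_nat_mul, χ]; congr 1; ring
    simp only [h1]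
    have ha : 0 < (a : ℕ) := Nat.pos_of_ne_zero fun h' => h (Fin.ext (by simpa using h'))
    have h2 := e_frac_ne_one ha a.2
    rw [geom_sum_eq h2, ← e_nat_mul, mul_div_cancel₀ _ (N_ne_zero (N := N)), e_nat]
    simp

theorem sum_Ico_χ (a : Fin N) :
    ∑ k ∈ Finset.Ico 1 N, χ k a = (if a = 0 then (N : ℂ) else 0) - 1 := by
  have h := sum_range_χ a
  rw [Finset.range_eq_Ico, Finset.sum_eq_sum_Ico_succ_bot (NeZero.pos N)] at h
  rw [← h]; simp [χ, e_zero]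

/-- Orthogonality of the characters, summed over the group. -/
theorem sum_χ {k : ℕ} (h0 : 0 < k) (hk : k < N) : ∑ a : Fin N, χ k a = 0 := by
  have h1 : ∀ a : Fin N, χ k a = e ((k : ℂ) / N) ^ (a : ℕ) := fun a => by
    rw [← e_nat_mul, χ]; congr 1; ring
  simp only [h1]
  rw [Fin.sum_univ_eq_sum_range (fun i => e ((k : ℂ) / N) ^ i), geom_sum_eq (e_frac_ne_one h0 hk),
    ← e_nat_mul, mul_div_cancel₀ _ (N_ne_zero (N := N)), e_nat]
  simp

end

/-! ### Theta functions near the cusp -/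

/-- The filter `Im τ → +∞`. -/
abbrev imInfty : Filter ℂ := comap Complex.im atTop

theorem tendsto_im_imInfty : Tendsto Complex.im imInfty atTop := tendsto_comap

theorem eventually_one_le_im : ∀ᶠ τ : ℂ in imInfty, 1 ≤ τ.im :=
  tendsto_im_imInfty.eventually (eventually_ge_atTop 1)

theorem norm_e_real_mul (a : ℝ) (τ : ℂ) : ‖e (a * τ)‖ = Real.exp (-(2 * Real.pi * a) * τ.im) := by
  rw [norm_e]; congr 1; simp; ring

theorem tendsto_e_mul {a : ℝ} (ha : 0 < a) :
    Tendsto (fun τ : ℂ => e (a * τ)) imInfty (𝓝 0) := by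
  rw [tendsto_zero_iff_norm_tendsto_zero]
  simp only [norm_e_real_mul]
  have h : (-(2 * Real.pi * a)) < 0 := by have := Real.pi_pos; nlinarith [mul_pos this ha]
  exact Real.tendsto_exp_atBot.comp (tendsto_im_imInfty.const_mul_atTop_of_neg h)

/-- A nonnegative power of `q` tends to `1` or to `0`. -/
theorem tendsto_e_mul_of_nonneg {a : ℝ} (ha : 0 ≤ a) :
    Tendsto (fun τ : ℂ => e (a * τ)) imInfty (𝓝 (if a = 0 then 1 else 0)) := by
  split_ifs with h
  · simpa [h, e_zero] using tendsto_const_nhds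
  · exact tendsto_e_mul (lt_of_le_of_ne ha (Ne.symm h))

/-- The `j`-th term of the `p`-th derivative of the odd theta function. -/
noncomputable def thetaTerm (p : ℕ) (w τ : ℂ) (j : ℤ) : ℂ :=
  (2 * Real.pi * I * (j + 1 / 2)) ^ p *
    (e (((j : ℂ) + 1 / 2) ^ 2 / 2 * τ) * e (((j : ℂ) + 1 / 2) * (w + 1 / 2)))

theorem vartheta_eq_tsum (w τ : ℂ) : vartheta w τ = ∑' j, thetaTerm 0 w τ j := by
  simp [vartheta, thetaTerm]

/-- Up to a common factor, the terms of the odd theta series are those of Mathlib's two-variable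
Jacobi theta function, which provides summability and differentiability. -/
theorem thetaTerm_zero_eq (w τ : ℂ) (j : ℤ) : thetaTerm 0 w τ j =
    e (τ / 8 + (w + 1 / 2) / 2) * jacobiTheta₂_term j (w + 1 / 2 + τ / 2) τ := by
  rw [thetaTerm, pow_zero, one_mul, ← e_add, jacobiTheta₂_term, e, e, ← exp_add]
  ring_nf

theorem thetaTerm_one_eq (w τ : ℂ) (j : ℤ) : thetaTerm 1 w τ j =
    Real.pi * I * (e (τ / 8 + (w + 1 / 2) / 2) * jacobiTheta₂_term j (w + 1 / 2 + τ / 2) τ) +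
      e (τ / 8 + (w + 1 / 2) / 2) * jacobiTheta₂'_term j (w + 1 / 2 + τ / 2) τ := by
  rw [← thetaTerm_zero_eq, jacobiTheta₂'_term,
    show e (τ / 8 + (w + 1 / 2) / 2) * (2 * Real.pi * I * j *
      jacobiTheta₂_term j (w + 1 / 2 + τ / 2) τ) = 2 * Real.pi * I * j *
      (e (τ / 8 + (w + 1 / 2) / 2) * jacobiTheta₂_term j (w + 1 / 2 + τ / 2) τ) by ring,
    ← thetaTerm_zero_eq, thetaTerm, thetaTerm]
  ring

theorem hasDerivAt_vartheta (w : ℂ) {τ : ℂ} (hτ : 0 < τ.im) :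
    HasDerivAt (fun w => vartheta w τ) (∑' j, thetaTerm 1 w τ j) w := by
  have h0 : (fun w => vartheta w τ) = fun w =>
      e (τ / 8 + (w + 1 / 2) / 2) * jacobiTheta₂ (w + 1 / 2 + τ / 2) τ := by
    funext w
    simp only [vartheta_eq_tsum, thetaTerm_zero_eq, jacobiTheta₂, tsum_mul_left]
  have h1 : ∑' j, thetaTerm 1 w τ j =
      Real.pi * I * (e (τ / 8 + (w + 1 / 2) / 2) * jacobiTheta₂ (w + 1 / 2 + τ / 2) τ) +
      e (τ / 8 + (w + 1 / 2) / 2) * jacobiTheta₂' (w + 1 / 2 + τ / 2) τ := by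
    simp only [thetaTerm_one_eq]
    rw [Summable.tsum_add, tsum_mul_left, tsum_mul_left, tsum_mul_left, jacobiTheta₂, jacobiTheta₂']
    · exact (((summable_jacobiTheta₂_term_iff _ _).2 hτ).mul_left _).mul_left _
    · exact ((summable_jacobiTheta₂'_term_iff _ _).2 hτ).mul_left _
  rw [h0, h1]
  have h2 : HasDerivAt (fun w : ℂ => τ / 8 + (w + 1 / 2) / 2) (1 / 2) w :=
    (((hasDerivAt_id w).add_const (1 / 2)).div_const 2).const_add _
  have h3 : HasDerivAt (fun w : ℂ => w + 1 / 2 + τ / 2) 1 w :=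
    ((hasDerivAt_id w).add_const (1 / 2)).add_const _
  have h4 := (hasDerivAt_jacobiTheta₂_fst (w + 1 / 2 + τ / 2) hτ).comp w h3
  refine (((hasDerivAt_e _).comp w h2).mul h4).congr_deriv ?_
  simp only [Function.comp]
  ring

/-- The exponent of `q` in the `j`-th term of `ϑ(α + βτ)`, relative to the smallest exponent. -/
noncomputable def thetaExpo (β : ℝ) (j : ℤ) : ℝ :=
  ((j : ℝ) + 1 / 2) ^ 2 / 2 + (j + 1 / 2) * β - 1 / 8 + |β| / 2

theorem thetaExpo_pos {β : ℝ} (hβ : |β| < 1) {j : ℤ} (h0 : j ≠ 0) (h1 : j ≠ -1) :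
    0 < thetaExpo β j := by
  have hb := abs_lt.1 hβ
  have h2 := neg_abs_le β
  have h3 := le_abs_self β
  unfold thetaExpo
  rcases le_or_gt 1 j with hj | hj
  · have : (1 : ℝ) ≤ j := by exact_mod_cast hj
    nlinarith [mul_pos (show (0 : ℝ) < j by linarith) (sub_pos.2 hβ),
      mul_nonneg (show (0 : ℝ) ≤ j by linarith) (sub_nonneg.2 h2)]
  · have : (j : ℝ) ≤ -2 := by exact_mod_cast (show j ≤ -2 by omega)
    nlinarith [mul_pos (show (0 : ℝ) < -j - 1 by linarith) (sub_pos.2 hβ),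
      mul_nonneg (show (0 : ℝ) ≤ -j - 1 by linarith) (sub_nonneg.2 h3)]

theorem thetaExpo_zero (β : ℝ) : thetaExpo β 0 = (β + |β|) / 2 := by
  simp only [thetaExpo, Int.cast_zero]; ring

theorem thetaExpo_neg_one (β : ℝ) : thetaExpo β (-1) = (|β| - β) / 2 := by
  simp only [thetaExpo, Int.cast_neg, Int.cast_one]; ring

theorem thetaExpo_nonneg {β : ℝ} (hβ : |β| < 1) (j : ℤ) : 0 ≤ thetaExpo β j := by
  by_cases h0 : j = 0
  · rw [h0, thetaExpo_zero]; linarith [neg_abs_le β]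
  by_cases h1 : j = -1
  · rw [h1, thetaExpo_neg_one]; linarith [le_abs_self β]
  exact (thetaExpo_pos hβ h0 h1).le

/-- A lower bound, uniform in `β`, that makes the theta series dominated by a Gaussian one. -/
theorem thetaExpo_ge {β : ℝ} (hβ : |β| < 1) (j : ℤ) :
    (j : ℝ) ^ 2 / 2 - 3 / 2 * |(j : ℝ)| ≤ thetaExpo β j := by
  have h2 := neg_abs_le β
  have h3 : -|(j : ℝ)| ≤ j := neg_abs_le _
  have h4 : -|(j : ℝ)| ≤ j * β := by
    have h5 : |(j : ℝ) * β| ≤ |(j : ℝ)| := by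
      rw [abs_mul]; exact mul_le_of_le_one_right (abs_nonneg _) hβ.le
    linarith [neg_abs_le ((j : ℝ) * β)]
  unfold thetaExpo
  nlinarith

/-- The limit of the rescaled `p`-th derivative of the theta function at `α + βτ`. -/
noncomputable def thetaLim (p : ℕ) (α : ℂ) (β : ℝ) : ℂ :=
  (if 0 ≤ β then (-(Real.pi * I)) ^ p * e (-((α + 1 / 2) / 2)) else 0) +
    if β ≤ 0 then (Real.pi * I) ^ p * e ((α + 1 / 2) / 2) else 0

/-- After division by its smallest power of `q`, the theta series at `α + βτ` converges, by
dominated convergence, to the sum of the terms which carry this power. -/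
theorem tendsto_theta (p : ℕ) (α : ℂ) {β : ℝ} (hβ : |β| < 1) :
    Tendsto (fun τ => e (((|β| / 2 - 1 / 8 : ℝ) : ℂ) * τ) * ∑' j, thetaTerm p (α + β * τ) τ j)
      imInfty (𝓝 (thetaLim p α β)) := by
  set a : ℤ → ℂ := fun j =>
    (2 * Real.pi * I * (j + 1 / 2)) ^ p * e (((j : ℂ) + 1 / 2) * (α + 1 / 2)) with ha
  have hterm : ∀ τ, e (((|β| / 2 - 1 / 8 : ℝ) : ℂ) * τ) * ∑' j, thetaTerm p (α + β * τ) τ j =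
      ∑' j, a j * e ((thetaExpo β j : ℝ) * τ) := by
    intro τ
    rw [← tsum_mul_left]
    refine tsum_congr fun j => ?_
    have key : e (((|β| / 2 - 1 / 8 : ℝ) : ℂ) * τ) *
        (e (((j : ℂ) + 1 / 2) ^ 2 / 2 * τ) * e (((j : ℂ) + 1 / 2) * (α + β * τ + 1 / 2))) =
        e (((j : ℂ) + 1 / 2) * (α + 1 / 2)) * e ((thetaExpo β j : ℝ) * τ) := by
      rw [← e_add, ← e_add, ← e_add]
      congr 1
      simp only [thetaExpo]
      push_cast
      ring
    simp only [thetaTerm, ha]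
    linear_combination (2 * Real.pi * I * ((j : ℂ) + 1 / 2)) ^ p * key
  simp only [hterm]
  have hlim : thetaLim p α β = ∑' j, a j * (if thetaExpo β j = 0 then 1 else 0) := by
    rw [tsum_eq_sum (s := {-1, 0})]
    · rw [Finset.sum_pair (by decide), thetaLim, thetaExpo_zero, thetaExpo_neg_one]
      have h1 : ((|β| - β) / 2 = 0) ↔ 0 ≤ β := by
        rw [div_eq_zero_iff, sub_eq_zero, abs_eq_self]; norm_num
      have h2 : ((β + |β|) / 2 = 0) ↔ β ≤ 0 := by
        rw [div_eq_zero_iff, add_comm, add_eq_zero_iff_eq_neg, abs_eq_neg_self]; norm_num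
      simp only [h1, h2, ha, mul_ite, mul_one, mul_zero]
      have e1 : (2 * Real.pi * I * (((-1 : ℤ) : ℂ) + 1 / 2)) = -(Real.pi * I) := by
        push_cast; ring
      have e2 : (2 * Real.pi * I * (((0 : ℤ) : ℂ) + 1 / 2)) = Real.pi * I := by
        push_cast; ring
      have e3 : (((-1 : ℤ) : ℂ) + 1 / 2) * (α + 1 / 2) = -((α + 1 / 2) / 2) := by
        push_cast; ring
      have e4 : (((0 : ℤ) : ℂ) + 1 / 2) * (α + 1 / 2) = (α + 1 / 2) / 2 := by
        push_cast; ring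
      rw [e1, e2, e3, e4]
    · intro j hj
      simp only [Finset.mem_insert, Finset.mem_singleton, not_or] at hj
      rw [if_neg (thetaExpo_pos hβ hj.2 hj.1).ne', mul_zero]
  rw [hlim]
  set S : ℝ := p + |α.im| + 3 / 2 with hS
  refine tendsto_tsum_of_dominated_convergence
    (bound := fun j : ℤ => Real.exp (Real.pi * (p + |α.im|)) *
      ((|j| ^ 0 : ℝ) * Real.exp (-Real.pi * (1 * j ^ 2 - 2 * S * |j|)))) ?_ ?_ ?_
  · exact (summable_pow_mul_jacobiTheta₂_term_bound S one_pos 0).mul_left _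
  · intro j
    exact (tendsto_e_mul_of_nonneg (thetaExpo_nonneg hβ j)).const_mul _
  · filter_upwards [eventually_one_le_im] with τ hτ j
    have hpi := Real.pi_pos
    have hj : |(j : ℝ) + 1 / 2| ≤ |(j : ℝ)| + 1 / 2 :=
      (abs_add_le _ _).trans (by norm_num)
    have n1 : ‖(2 * Real.pi * I * ((j : ℂ) + 1 / 2)) ^ p‖ ≤
        Real.exp (p * (2 * Real.pi * (|(j : ℝ)| + 1 / 2))) := by
      rw [norm_pow, Real.exp_nat_mul]
      refine pow_le_pow_left₀ (norm_nonneg _) ?_ _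
      have h : ‖2 * Real.pi * I * ((j : ℂ) + 1 / 2)‖ = 2 * Real.pi * |(j : ℝ) + 1 / 2| := by
        rw [show ((j : ℂ) + 1 / 2) = (((j : ℝ) + 1 / 2 : ℝ) : ℂ) by push_cast; ring, norm_mul,
          norm_real, Real.norm_eq_abs]
        simp [abs_of_pos hpi]
      rw [h]
      have h2 : 2 * Real.pi * |(j : ℝ) + 1 / 2| ≤ 2 * Real.pi * (|(j : ℝ)| + 1 / 2) := by
        gcongr
      linarith [Real.add_one_le_exp (2 * Real.pi * (|(j : ℝ)| + 1 / 2))]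
    have n2 : ‖e (((j : ℂ) + 1 / 2) * (α + 1 / 2))‖ ≤
        Real.exp (2 * Real.pi * ((|(j : ℝ)| + 1 / 2) * |α.im|)) := by
      rw [norm_e]
      refine Real.exp_le_exp.2 ?_
      have h : (((j : ℂ) + 1 / 2) * (α + 1 / 2)).im = ((j : ℝ) + 1 / 2) * α.im := by
        simp
      rw [h]
      have h3 : -(((j : ℝ) + 1 / 2) * α.im) ≤ (|(j : ℝ)| + 1 / 2) * |α.im| := by
        refine (neg_le_abs _).trans ?_
        rw [abs_mul]
        gcongr
      nlinarith
    have n3 : ‖e ((thetaExpo β j : ℝ) * τ)‖ ≤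
        Real.exp (-(2 * Real.pi * ((j : ℝ) ^ 2 / 2 - 3 / 2 * |(j : ℝ)|))) := by
      rw [norm_e_real_mul]
      refine Real.exp_le_exp.2 ?_
      have h4 := thetaExpo_ge hβ j
      have h5 := thetaExpo_nonneg hβ j
      have h6 : thetaExpo β j ≤ thetaExpo β j * τ.im := le_mul_of_one_le_right h5 hτ
      nlinarith
    rw [ha, norm_mul, norm_mul]
    refine (mul_le_mul (mul_le_mul n1 n2 (norm_nonneg _) (Real.exp_pos _).le) n3 (norm_nonneg _)
      (by positivity)).trans (le_of_eq ?_)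
    rw [← Real.exp_add, ← Real.exp_add, pow_zero, one_mul, ← Real.exp_add]
    congr 1
    rw [hS]
    push_cast
    ring

theorem tendsto_vartheta (α : ℂ) {β : ℝ} (hβ : |β| < 1) :
    Tendsto (fun τ => e (((|β| / 2 - 1 / 8 : ℝ) : ℂ) * τ) * vartheta (α + β * τ) τ)
      imInfty (𝓝 (thetaLim 0 α β)) := by
  simpa only [vartheta_eq_tsum] using tendsto_theta 0 α hβ

theorem tendsto_deriv_vartheta (α : ℂ) {β : ℝ} (hβ : |β| < 1) :
    Tendsto (fun τ => e (((|β| / 2 - 1 / 8 : ℝ) : ℂ) * τ) *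
      deriv (fun w => vartheta w τ) (α + β * τ)) imInfty (𝓝 (thetaLim 1 α β)) := by
  refine (tendsto_theta 1 α hβ).congr' ?_
  filter_upwards [eventually_one_le_im] with τ hτ
  rw [(hasDerivAt_vartheta (α + β * τ) (τ := τ) (by linarith)).deriv]

/-! ### The Kronecker function near the cusp -/

theorem thetaLim_of_pos (p : ℕ) (α : ℂ) {β : ℝ} (hβ : 0 < β) :
    thetaLim p α β = (-(Real.pi * I)) ^ p * e (-((α + 1 / 2) / 2)) := by
  rw [thetaLim, if_pos hβ.le, if_neg (not_le.2 hβ), add_zero]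

theorem thetaLim_of_neg (p : ℕ) (α : ℂ) {β : ℝ} (hβ : β < 0) :
    thetaLim p α β = (Real.pi * I) ^ p * e ((α + 1 / 2) / 2) := by
  rw [thetaLim, if_neg (not_le.2 hβ), if_pos hβ.le, zero_add]

theorem e_quarter : e (1 / 4) = I := by
  rw [e, show (2 * Real.pi * I * (1 / 4) : ℂ) = Real.pi / 2 * I by ring, exp_pi_div_two_mul_I]

theorem e_half_add (α : ℂ) : e ((α + 1 / 2) / 2) = I * e (α / 2) := by
  rw [← e_quarter, ← e_add]; congr 1; ring

theorem e_neg_half_add (α : ℂ) : e (-((α + 1 / 2) / 2)) = -I * (e (α / 2))⁻¹ := by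
  rw [e_neg, e_half_add, mul_inv, inv_I]

theorem thetaLim_one_zero : thetaLim 1 0 0 = -2 * Real.pi := by
  rw [thetaLim, if_pos le_rfl, if_pos le_rfl, e_half_add, e_neg_half_add]
  simp only [zero_div, e_zero, inv_one, pow_one]
  linear_combination 2 * Real.pi * I_sq

/-- The exponent of the leading power of `q` in `ϕ(α₁ + β₁τ, α₂ + β₂τ)`, up to the sign. -/
noncomputable def phiExpo (β₁ β₂ : ℝ) : ℝ := (|β₁ + β₂| - |β₁| - |β₂|) / 2

/-- The leading coefficient of the Kronecker function at `(α₁ + β₁τ, α₂ + β₂τ)`. -/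
theorem tendsto_phi (α₁ α₂ : ℂ) {β₁ β₂ : ℝ} (h₁ : |β₁| < 1) (h₂ : |β₂| < 1)
    (h₃ : |β₁ + β₂| < 1) (n₁ : thetaLim 0 α₁ β₁ ≠ 0) (n₂ : thetaLim 0 α₂ β₂ ≠ 0) :
    Tendsto (fun τ => e ((phiExpo β₁ β₂ : ℝ) * τ) * phi (α₁ + β₁ * τ) (α₂ + β₂ * τ) τ) imInfty
      (𝓝 (thetaLim 0 (α₁ + α₂) (β₁ + β₂) * (-2 * Real.pi) /
        (thetaLim 0 α₁ β₁ * thetaLim 0 α₂ β₂))) := by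
  have t0 := tendsto_deriv_vartheta 0 (β := 0) (by simp)
  rw [thetaLim_one_zero] at t0
  have t := ((tendsto_vartheta (α₁ + α₂) h₃).mul t0).div
    ((tendsto_vartheta α₁ h₁).mul (tendsto_vartheta α₂ h₂)) (mul_ne_zero n₁ n₂)
  refine t.congr fun τ => ?_
  have key : e (((|β₁ + β₂| / 2 - 1 / 8 : ℝ) : ℂ) * τ) * e (((|0| / 2 - 1 / 8 : ℝ) : ℂ) * τ) =
      e ((phiExpo β₁ β₂ : ℝ) * τ) *
      (e (((|β₁| / 2 - 1 / 8 : ℝ) : ℂ) * τ) * e (((|β₂| / 2 - 1 / 8 : ℝ) : ℂ) * τ)) := by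
    rw [← e_add, ← e_add, ← e_add]; congr 1; simp only [phiExpo, abs_zero]; push_cast; ring
  rw [phi, Pi.div_apply, ofReal_zero, zero_mul, add_zero,
    show α₁ + α₂ + ((β₁ + β₂ : ℝ) : ℂ) * τ = α₁ + β₁ * τ + (α₂ + β₂ * τ) by push_cast; ring,
    mul_mul_mul_comm, key, mul_mul_mul_comm (e (((|β₁| / 2 - 1 / 8 : ℝ) : ℂ) * τ)),
    mul_comm (e ((phiExpo β₁ β₂ : ℝ) * τ)), mul_assoc,
    mul_div_mul_left _ _ (mul_ne_zero (e_ne_zero _) (e_ne_zero _)), mul_div_assoc]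

/-- The leading coefficient of `∂ϕ/∂u` at `(α₁ + β₁τ, α₂ + β₂τ)`. -/
theorem tendsto_deriv_phi (α₁ α₂ : ℂ) {β₁ β₂ : ℝ} (h₁ : |β₁| < 1) (h₂ : |β₂| < 1)
    (h₃ : |β₁ + β₂| < 1) (n₁ : thetaLim 0 α₁ β₁ ≠ 0) (n₂ : thetaLim 0 α₂ β₂ ≠ 0) :
    Tendsto (fun τ => e ((phiExpo β₁ β₂ : ℝ) * τ) *
        deriv (fun u => phi u (α₂ + β₂ * τ) τ) (α₁ + β₁ * τ)) imInfty
      (𝓝 ((thetaLim 1 (α₁ + α₂) (β₁ + β₂) * thetaLim 0 α₁ β₁ -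
        thetaLim 0 (α₁ + α₂) (β₁ + β₂) * thetaLim 1 α₁ β₁) * (-2 * Real.pi) /
        (thetaLim 0 α₁ β₁ ^ 2 * thetaLim 0 α₂ β₂))) := by
  have t0 := tendsto_deriv_vartheta 0 (β := 0) (by simp)
  rw [thetaLim_one_zero] at t0
  have t := ((((tendsto_deriv_vartheta (α₁ + α₂) h₃).mul (tendsto_vartheta α₁ h₁)).sub
    ((tendsto_vartheta (α₁ + α₂) h₃).mul (tendsto_deriv_vartheta α₁ h₁))).mul t0).div
    (((tendsto_vartheta α₁ h₁).pow 2).mul (tendsto_vartheta α₂ h₂))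
    (mul_ne_zero (pow_ne_zero 2 n₁) n₂)
  refine t.congr' ?_
  filter_upwards [eventually_one_le_im, (tendsto_vartheta α₁ h₁).eventually_ne n₁,
    (tendsto_vartheta α₂ h₂).eventually_ne n₂] with τ hτ m₁ m₂
  have hτ' : 0 < τ.im := by linarith
  have m₁' := right_ne_zero_of_mul m₁
  have m₂' := right_ne_zero_of_mul m₂
  have key : e (((|β₁ + β₂| / 2 - 1 / 8 : ℝ) : ℂ) * τ) * e (((|0| / 2 - 1 / 8 : ℝ) : ℂ) * τ) =
      e ((phiExpo β₁ β₂ : ℝ) * τ) *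
      (e (((|β₁| / 2 - 1 / 8 : ℝ) : ℂ) * τ) * e (((|β₂| / 2 - 1 / 8 : ℝ) : ℂ) * τ)) := by
    rw [← e_add, ← e_add, ← e_add]; congr 1; simp only [phiExpo, abs_zero]; push_cast; ring
  have d1 : HasDerivAt (fun u => vartheta (u + (α₂ + β₂ * τ)) τ)
      (deriv (fun w => vartheta w τ) (α₁ + β₁ * τ + (α₂ + β₂ * τ))) (α₁ + β₁ * τ) := by
    have := (hasDerivAt_vartheta (α₁ + β₁ * τ + (α₂ + β₂ * τ)) hτ').differentiableAt.hasDerivAt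
    simpa using this.comp_add_const (α₁ + β₁ * τ) (α₂ + β₂ * τ)
  have d2 : HasDerivAt (fun u => vartheta u τ)
      (deriv (fun w => vartheta w τ) (α₁ + β₁ * τ)) (α₁ + β₁ * τ) :=
    (hasDerivAt_vartheta (α₁ + β₁ * τ) hτ').differentiableAt.hasDerivAt
  have d := ((d1.mul_const (deriv (fun w => vartheta w τ) 0)).div
    (d2.mul_const (vartheta (α₂ + β₂ * τ) τ)) (mul_ne_zero m₁' m₂')).deriv
  have d' : deriv (fun u => phi u (α₂ + β₂ * τ) τ) (α₁ + β₁ * τ) = _ := d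
  rw [d', Pi.div_apply, ofReal_zero, zero_mul, add_zero,
    show α₁ + α₂ + ((β₁ + β₂ : ℝ) : ℂ) * τ = α₁ + β₁ * τ + (α₂ + β₂ * τ) by push_cast; ring]
  have q1 := e_ne_zero (((|β₁| / 2 - 1 / 8 : ℝ) : ℂ) * τ)
  have q2 := e_ne_zero (((|β₂| / 2 - 1 / 8 : ℝ) : ℂ) * τ)
  generalize e (((|β₁| / 2 - 1 / 8 : ℝ) : ℂ) * τ) = a₁ at *
  generalize e (((|β₂| / 2 - 1 / 8 : ℝ) : ℂ) * τ) = a₂ at *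
  generalize e (((|β₁ + β₂| / 2 - 1 / 8 : ℝ) : ℂ) * τ) = a₃ at *
  generalize e (((|0| / 2 - 1 / 8 : ℝ) : ℂ) * τ) = a₀ at *
  generalize e ((phiExpo β₁ β₂ : ℝ) * τ) = b at *
  generalize vartheta (α₂ + β₂ * τ) τ = x₂ at *
  generalize vartheta (α₁ + β₁ * τ) τ = x₁ at *
  generalize vartheta (α₁ + β₁ * τ + (α₂ + β₂ * τ)) τ = x₃ at *
  generalize deriv (fun w => vartheta w τ) (α₁ + β₁ * τ + (α₂ + β₂ * τ)) = y₃ at *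
  generalize deriv (fun w => vartheta w τ) (α₁ + β₁ * τ) = y₁ at *
  generalize deriv (fun w => vartheta w τ) 0 = y₀ at *
  rw [show (a₃ * y₃ * (a₁ * x₁) - a₃ * x₃ * (a₁ * y₁)) * (a₀ * y₀) =
    (a₃ * a₀) * (a₁ * ((y₃ * x₁ - x₃ * y₁) * y₀)) by ring, key]
  field_simp

/-! ### The second Eisenstein function near the cusp -/

/-- The sum of a row of the double series, by Lipschitz's formula and the geometric series. -/
theorem rowSum_of_im_pos {w : ℂ} (hw : 0 < w.im) :
    ∑' k : ℤ, 1 / (w + k) ^ 2 = -4 * (Real.pi : ℂ) ^ 2 * (e w / (1 - e w) ^ 2) := by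
  have h := EisensteinSeries.qExpansion_identity (k := 1) le_rfl ⟨w, hw⟩
  simp only [pow_one, Nat.factorial_one, Nat.cast_one, div_one] at h
  have hn : ‖e w‖ < 1 := by
    rw [norm_e, Real.exp_lt_one_iff]
    nlinarith [mul_pos Real.pi_pos hw]
  have h2 : ∑' n : ℕ, (n : ℂ) * e w ^ n = e w / (1 - e w) ^ 2 :=
    tsum_coe_mul_geometric_of_norm_lt_one hn
  refine h.trans ?_
  change _ * ∑' n : ℕ, (n : ℂ) * e w ^ n = _
  rw [h2]
  linear_combination 4 * Real.pi ^ 2 * (e w / (1 - e w) ^ 2) * I_sq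

theorem rowSum_neg (w : ℂ) : ∑' k : ℤ, 1 / (-w + k) ^ 2 = ∑' k : ℤ, 1 / (w + k) ^ 2 := by
  rw [← (Equiv.neg ℤ).tsum_eq]
  refine tsum_congr fun k => ?_
  congr 1
  simp only [Equiv.neg_apply, Int.cast_neg]
  ring

/-- The row through a real point. It is obtained by continuity from the rows in the upper half-
plane. -/
theorem rowSum_real {x : ℝ} (hx : e x ≠ 1) :
    ∑' k : ℤ, 1 / ((x : ℂ) + k) ^ 2 = (Real.pi : ℂ) ^ 2 * (sin (Real.pi * x) ^ 2)⁻¹ := by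
  have hne : 1 - e (x : ℂ) ≠ 0 := sub_ne_zero.2 (Ne.symm hx)
  have hrhs : (Real.pi : ℂ) ^ 2 * (sin (Real.pi * x) ^ 2)⁻¹ =
      -4 * (Real.pi : ℂ) ^ 2 * (e x / (1 - e x) ^ 2) := by
    rw [sin_sq_eq_e, e_neg]
    have h0 := e_ne_zero (x : ℂ)
    have h1 : (2 - e (x : ℂ) - (e (x : ℂ))⁻¹) / 4 = -(1 - e (x : ℂ)) ^ 2 / (4 * e x) := by
      field_simp
      ring
    rw [h1, inv_div]
    field_simp
  rw [hrhs]
  -- both sides are limits of their values at `x + it` as `t → 0+`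
  have hl : Tendsto (fun t : ℝ => ∑' k : ℤ, 1 / ((x : ℂ) + t * I + k) ^ 2) (𝓝[>] 0)
      (𝓝 (∑' k : ℤ, 1 / ((x : ℂ) + k) ^ 2)) := by
    have hxk : ∀ k : ℤ, (x : ℂ) + k ≠ 0 := by
      intro k hk
      refine hx ((e_eq_one_iff _).2 ⟨-k, ?_⟩)
      push_cast
      linear_combination hk
    refine tendsto_tsum_of_dominated_convergence (bound := fun k : ℤ => 1 / |(k : ℝ) + x| ^ (2 : ℝ))
      ((Real.summable_one_div_int_add_rpow x 2).2 (by norm_num)) ?_ ?_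
    · intro k
      have hc : Tendsto (fun t : ℝ => (x : ℂ) + t * I + k) (𝓝[>] 0) (𝓝 ((x : ℂ) + k)) := by
        have : Continuous fun t : ℝ => (x : ℂ) + t * I + k := by fun_prop
        have h := (this.tendsto 0).mono_left (nhdsWithin_le_nhds (s := Set.Ioi 0))
        simpa using h
      exact tendsto_const_nhds.div (hc.pow 2) (pow_ne_zero 2 (hxk k))
    · refine Eventually.of_forall fun t k => ?_
      rw [norm_div, norm_one, norm_pow, Real.rpow_two]
      have h2 : |(k : ℝ) + x| ≤ ‖(x : ℂ) + t * I + k‖ := by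
        have := abs_re_le_norm ((x : ℂ) + t * I + k)
        simpa [add_comm] using this
      have h3 : 0 < |(k : ℝ) + x| := by
        rw [abs_pos]
        intro h
        exact hxk k (by rw [add_comm]; exact_mod_cast h)
      gcongr
  have hr : Tendsto (fun t : ℝ => -4 * (Real.pi : ℂ) ^ 2 *
      (e (x + t * I) / (1 - e (x + t * I)) ^ 2)) (𝓝[>] 0)
      (𝓝 (-4 * (Real.pi : ℂ) ^ 2 * (e x / (1 - e x) ^ 2))) := by
    have hc : Tendsto (fun t : ℝ => e (x + t * I)) (𝓝[>] 0) (𝓝 (e x)) := by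
      have : Continuous fun t : ℝ => e ((x : ℂ) + t * I) := by unfold e; fun_prop
      have h := (this.tendsto 0).mono_left (nhdsWithin_le_nhds (s := Set.Ioi 0))
      simpa using h
    exact (hc.div ((tendsto_const_nhds.sub hc).pow 2) (pow_ne_zero 2 hne)).const_mul _
  refine tendsto_nhds_unique hl (hr.congr' ?_)
  filter_upwards [self_mem_nhdsWithin] with t ht
  rw [rowSum_of_im_pos]
  simpa using ht

/-- The limit of a row of the double series, divided by a power `q ^ γ`. -/
theorem tendsto_row {α : ℂ} (hα : α.im = 0) {ρ γ : ℝ} (hρ : ρ ≠ 0) (hγ : γ ≤ |ρ|) :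
    Tendsto (fun τ => e ((-γ : ℝ) * τ) * ∑' k : ℤ, 1 / (α + ρ * τ + k) ^ 2) imInfty
      (𝓝 (-4 * (Real.pi : ℂ) ^ 2 * (if |ρ| = γ then e (if 0 < ρ then α else -α) else 0))) := by
  wlog h : 0 < ρ generalizing α ρ
  · have hneg : 0 < -ρ := by
      rcases lt_or_gt_of_ne hρ with h' | h'
      · linarith
      · exact absurd h' h
    have := this (α := -α) (ρ := -ρ) (by simp [hα]) hneg.ne' (by rwa [abs_neg]) hneg
    rw [abs_neg, if_pos hneg] at this
    rw [if_neg h]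
    refine this.congr fun τ => ?_
    rw [← rowSum_neg (α + ρ * τ)]
    push_cast
    ring_nf
  rw [if_pos h, abs_of_pos h]
  rw [abs_of_pos h] at hγ
  have h1 : Tendsto (fun τ : ℂ => e (α + ρ * τ)) imInfty (𝓝 0) := by
    simp only [e_add]
    simpa using (tendsto_e_mul h).const_mul (e α)
  have h2 := tendsto_e_mul_of_nonneg (sub_nonneg.2 hγ)
  have h3 := ((h2.const_mul (e α)).div ((tendsto_const_nhds (x := (1 : ℂ))).sub h1 |>.pow 2)
    (by simp)).const_mul (-4 * (Real.pi : ℂ) ^ 2)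
  have hlim : -4 * (Real.pi : ℂ) ^ 2 * (e α * (if ρ - γ = 0 then 1 else 0) / (1 - 0) ^ 2) =
      -4 * (Real.pi : ℂ) ^ 2 * (if ρ = γ then e α else 0) := by
    simp only [sub_eq_zero]
    split_ifs <;> simp
  rw [hlim] at h3
  refine h3.congr' ?_
  filter_upwards [eventually_one_le_im] with τ hτ
  have him : 0 < (α + ρ * τ).im := by
    have : (α + ρ * τ).im = ρ * τ.im := by simp [hα]
    rw [this]; exact mul_pos h (by linarith)
  rw [rowSum_of_im_pos him, Pi.div_apply]
  have : e α * e (((ρ - γ : ℝ) : ℂ) * τ) = e ((-γ : ℝ) * τ) * e (α + ρ * τ) := by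
    rw [← e_add, ← e_add]; congr 1; push_cast; ring
  rw [this]
  ring

/-- A summable bound for the rows of the double series, uniform in `Im τ ≥ 1`. -/
theorem norm_row_le {α : ℂ} (hα : α.im = 0) {ρ γ δ : ℝ} (hδ : 0 < δ) (hρ : δ ≤ |ρ|)
    (hγ : γ ≤ |ρ|) {τ : ℂ} (hτ : 1 ≤ τ.im) :
    ‖e ((-γ : ℝ) * τ) * ∑' k : ℤ, 1 / (α + ρ * τ + k) ^ 2‖ ≤
      4 * Real.pi ^ 2 / (1 - Real.exp (-(2 * Real.pi * δ))) ^ 2 *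
        Real.exp (-(2 * Real.pi) * (|ρ| - γ)) := by
  wlog h : 0 < ρ generalizing α ρ
  · have hneg : 0 < -ρ := by
      rcases lt_or_eq_of_le (not_lt.1 h) with h' | h'
      · linarith
      · rw [h', abs_zero] at hρ; linarith
    have := this (α := -α) (ρ := -ρ) (by simp [hα]) (by rwa [abs_neg]) (by rwa [abs_neg]) hneg
    rw [abs_neg] at this
    rw [← rowSum_neg (α + ρ * τ)]
    refine le_trans (le_of_eq ?_) this
    congr 3
    funext k
    push_cast
    ring
  rw [abs_of_pos h] at hρ hγ ⊢
  have him : (α + ρ * τ).im = ρ * τ.im := by simp [hα]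
  have him' : 0 < (α + ρ * τ).im := by rw [him]; exact mul_pos h (by linarith)
  have hpi := Real.pi_pos
  rw [rowSum_of_im_pos him']
  have hr : ‖e (α + ρ * τ)‖ ≤ Real.exp (-(2 * Real.pi * δ)) := by
    rw [norm_e, him]
    refine Real.exp_le_exp.2 ?_
    have : δ ≤ ρ * τ.im := by nlinarith
    nlinarith
  have hlt : Real.exp (-(2 * Real.pi * δ)) < 1 := by
    rw [Real.exp_lt_one_iff]; nlinarith [mul_pos hpi hδ]
  have hden : (1 - Real.exp (-(2 * Real.pi * δ))) ^ 2 ≤ ‖(1 - e (α + ρ * τ)) ^ 2‖ := by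
    rw [norm_pow]
    refine pow_le_pow_left₀ (by linarith) ?_ 2
    have := norm_sub_norm_le (1 : ℂ) (e (α + ρ * τ))
    rw [norm_one] at this
    linarith
  have hnum : ‖e ((-γ : ℝ) * τ)‖ * ‖e (α + ρ * τ)‖ ≤ Real.exp (-(2 * Real.pi) * (ρ - γ)) := by
    rw [norm_e_real_mul, norm_e, him, ← Real.exp_add]
    refine Real.exp_le_exp.2 ?_
    have : (ρ - γ) ≤ (ρ - γ) * τ.im := le_mul_of_one_le_right (by linarith) hτ
    nlinarith
  have h4 : ‖(-4 * (Real.pi : ℂ) ^ 2)‖ = 4 * Real.pi ^ 2 := by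
    simp [abs_of_pos hpi]
  rw [norm_mul, norm_mul, norm_div, h4]
  have hpos : 0 < (1 - Real.exp (-(2 * Real.pi * δ))) ^ 2 := by
    have : 0 < 1 - Real.exp (-(2 * Real.pi * δ)) := by linarith
    positivity
  have hfin := div_le_div₀ (Real.exp_pos _).le hnum hpos hden
  calc _ = 4 * Real.pi ^ 2 * ((‖e ((-γ : ℝ) * τ)‖ * ‖e (α + ρ * τ)‖) /
        ‖(1 - e (α + ρ * τ)) ^ 2‖) := by ring
    _ ≤ _ := mul_le_mul_of_nonneg_left hfin (by positivity)
    _ = _ := by ring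

theorem summable_exp_neg_abs (β γ : ℝ) :
    Summable fun n : ℤ => Real.exp (-(2 * Real.pi) * (|β + n| - γ)) := by
  have hs : Summable fun n : ℤ => Real.exp (-(|(n : ℝ)|)) := by
    have : Summable fun n : ℕ => Real.exp (-(n : ℝ)) := Real.summable_exp_neg_nat
    apply Summable.of_nat_of_neg <;> simpa using this
  refine (hs.mul_left (Real.exp (2 * Real.pi * (|β| + γ)))).of_nonneg_of_le
    (fun _ => (Real.exp_pos _).le) fun n => ?_
  rw [← Real.exp_add]
  refine Real.exp_le_exp.2 ?_
  have h1 : |(n : ℝ)| ≤ |β + n| + |β| := by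
    have := abs_sub (β + n) β
    simpa using this
  have h2 := Real.pi_gt_three
  nlinarith [abs_nonneg (n : ℝ), mul_nonneg (show (0 : ℝ) ≤ 2 * Real.pi - 1 by linarith)
    (abs_nonneg (n : ℝ))]

/-- The second Eisenstein function at `α + βτ` for `0 < β < 1`: only the rows `0` and `-1` can
contribute to the limit. -/
theorem tendsto_E2 {α : ℂ} (hα : α.im = 0) {β γ : ℝ} (h0 : 0 < β) (h1 : β < 1) (hγ : γ ≤ β)
    (hγ' : γ ≤ 1 - β) :
    Tendsto (fun τ => e ((-γ : ℝ) * τ) * E2 (α + β * τ) τ) imInfty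
      (𝓝 (-4 * (Real.pi : ℂ) ^ 2 *
        ((if β = γ then e α else 0) + if 1 - β = γ then e (-α) else 0))) := by
  have habs : ∀ n : ℤ, (n ≠ 0 → 1 - β ≤ |β + n|) ∧ (n ≠ -1 → β ≤ |β + n|) ∧
      (n ≠ 0 → n ≠ -1 → γ < |β + n|) := by
    intro n
    rcases lt_trichotomy n (-1) with h | h | h
    · have : (n : ℝ) ≤ -2 := by exact_mod_cast (show n ≤ -2 by omega)
      rw [abs_of_neg (by linarith)]
      exact ⟨fun _ => by linarith, fun _ => by linarith, fun _ _ => by linarith⟩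
    · subst h
      push_cast
      rw [abs_of_neg (by linarith)]
      exact ⟨fun _ => by linarith, fun h => absurd h (by simp), fun _ h => absurd h (by simp)⟩
    · have : (0 : ℝ) ≤ n := by exact_mod_cast (show 0 ≤ n by omega)
      rw [abs_of_pos (by linarith)]
      refine ⟨fun h => ?_, fun _ => by linarith, fun h _ => ?_⟩ <;>
      · have : (1 : ℝ) ≤ n := by exact_mod_cast (show 1 ≤ n by omega)
        linarith
  have hmin : ∀ n : ℤ, min β (1 - β) ≤ |β + n| := by
    intro n
    by_cases h : n = 0
    · exact (min_le_left _ _).trans ((habs n).2.1 (by omega))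
    · exact (min_le_right _ _).trans ((habs n).1 h)
  have hδ : 0 < min β (1 - β) := lt_min h0 (by linarith)
  have hγmin : γ ≤ min β (1 - β) := le_min hγ hγ'
  have hlim : -4 * (Real.pi : ℂ) ^ 2 *
        ((if β = γ then e α else 0) + if 1 - β = γ then e (-α) else 0) =
      ∑' n : ℤ, -4 * (Real.pi : ℂ) ^ 2 *
        (if |β + n| = γ then e (if 0 < β + n then α else -α) else 0) := by
    rw [tsum_eq_sum (s := {0, -1})]
    · rw [Finset.sum_pair (by decide), mul_add]
      have a1 : |β + ((0 : ℤ) : ℝ)| = β := by simp [abs_of_pos h0]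
      have a2 : |β + ((-1 : ℤ) : ℝ)| = 1 - β := by
        push_cast; rw [abs_of_neg (by linarith)]; ring
      rw [a1, a2, if_pos (show 0 < β + ((0 : ℤ) : ℝ) by simpa using h0),
        if_neg (show ¬ 0 < β + ((-1 : ℤ) : ℝ) by push_cast; linarith)]
    · intro n hn
      simp only [Finset.mem_insert, Finset.mem_singleton, not_or] at hn
      rw [if_neg ((habs n).2.2 hn.1 hn.2).ne', mul_zero]
  rw [hlim]
  have hE : ∀ τ, e ((-γ : ℝ) * τ) * E2 (α + β * τ) τ =
      ∑' n : ℤ, e ((-γ : ℝ) * τ) * ∑' k : ℤ, 1 / (α + ((β + n : ℝ) : ℂ) * τ + k) ^ 2 := by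
    intro τ
    rw [E2, tsum_mul_left]
    congr 1
    refine tsum_congr fun n => tsum_congr fun k => ?_
    push_cast
    congr 2
    ring
  simp only [hE]
  refine tendsto_tsum_of_dominated_convergence
    (bound := fun n : ℤ => 4 * Real.pi ^ 2 / (1 - Real.exp (-(2 * Real.pi * min β (1 - β)))) ^ 2 *
        Real.exp (-(2 * Real.pi) * (|β + n| - γ))) ?_ ?_ ?_
  · exact (summable_exp_neg_abs β γ).mul_left _
  · intro n
    exact tendsto_row hα (abs_pos.1 (hδ.trans_le (hmin n))) (hγmin.trans (hmin n))
  · filter_upwards [eventually_one_le_im] with τ hτ n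
    exact norm_row_le hα hδ (hmin n) (hγmin.trans (hmin n)) hτ

/-- The second Eisenstein function at a real point. -/
theorem tendsto_E2_real {x : ℝ} (hx : e x ≠ 1) :
    Tendsto (fun τ => E2 x τ) imInfty
      (𝓝 ((Real.pi : ℂ) ^ 2 * (sin (Real.pi * x) ^ 2)⁻¹)) := by
  have hlim : (Real.pi : ℂ) ^ 2 * (sin (Real.pi * x) ^ 2)⁻¹ = ∑' n : ℤ,
      if n = 0 then (Real.pi : ℂ) ^ 2 * (sin (Real.pi * x) ^ 2)⁻¹ else 0 := by
    rw [tsum_ite_eq]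
  rw [hlim]
  have habs : ∀ n : ℤ, n ≠ 0 → 1 ≤ |(n : ℝ)| := fun n hn => by
    exact_mod_cast Int.one_le_abs hn
  refine tendsto_tsum_of_dominated_convergence
    (bound := fun n : ℤ => (if n = 0 then ‖(Real.pi : ℂ) ^ 2 * (sin (Real.pi * x) ^ 2)⁻¹‖ else 0) +
      4 * Real.pi ^ 2 / (1 - Real.exp (-(2 * Real.pi * 1))) ^ 2 *
        Real.exp (-(2 * Real.pi) * (|(0 : ℝ) + n| - 0))) ?_ ?_ ?_
  · refine Summable.add ?_ ((summable_exp_neg_abs 0 0).mul_left _)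
    exact summable_of_ne_finset_zero (s := {0}) fun n hn => if_neg (by simpa using hn)
  · intro n
    by_cases h : n = 0
    · subst h
      simp only [if_pos, Int.cast_zero, zero_mul, add_zero, rowSum_real hx]
      exact tendsto_const_nhds
    · rw [if_neg h]
      have h1 := habs n h
      have := tendsto_row (ofReal_im x) (ρ := (n : ℝ)) (γ := 0) (Int.cast_ne_zero.2 h)
        (abs_nonneg _)
      rw [if_neg (by linarith), mul_zero] at this
      simpa [e_zero] using this
  · filter_upwards [eventually_one_le_im] with τ hτ n
    by_cases h : n = 0
    · subst h
      simp only [if_pos, Int.cast_zero, zero_mul, add_zero, rowSum_real hx]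
      exact le_add_of_nonneg_right (by positivity)
    · rw [if_neg h, zero_add]
      have := norm_row_le (ofReal_im x) (ρ := (n : ℝ)) (γ := 0) one_pos (habs n h)
        (abs_nonneg _) hτ
      rw [zero_add]
      simpa [e_zero] using this

/-! ### Sums over the sin-algebra basis -/

section
variable {N : ℕ} [NeZero N]

omit [NeZero N] in
theorem dvd_sub_sub_iff (i j r : Fin N) :
    (N : ℤ) ∣ ((j : ℕ) : ℤ) - ((i : ℕ) : ℤ) - ((r : ℕ) : ℤ) ↔ j - i = r := by
  have h := Fin.intCast_val_sub_eq_sub_add_ite j i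
  have h2 : ((j : ℕ) : ℤ) - ((i : ℕ) : ℤ) =
      (((j - i : Fin N) : ℕ) : ℤ) - if i ≤ j then 0 else (N : ℤ) := by
    rw [h]; push_cast; ring
  rw [h2]
  have h3 : (N : ℤ) ∣ (if i ≤ j then 0 else (N : ℤ)) := by split_ifs <;> simp
  rw [sub_right_comm, dvd_sub_left h3]
  constructor
  · intro hd
    have h4 := (j - i).2
    have h5 := r.2
    have h6 : (((j - i : Fin N) : ℕ) : ℤ) - ((r : ℕ) : ℤ) = 0 := by
      refine Int.eq_zero_of_abs_lt_dvd hd ?_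
      rw [abs_lt]; omega
    exact Fin.ext (by omega)
  · rintro rfl; simp

omit [NeZero N] in
theorem T_apply (m : ℤ) (r i j : Fin N) : T N m ((r : ℕ) : ℤ) i j =
    if j - i = r then e ((m : ℂ) * ((r : ℕ) : ℂ) / (2 * N)) * e ((((i : ℕ) : ℂ) + 1) * m / N)
    else 0 := by
  rw [T, Matrix.of_apply]
  simp only [dvd_sub_sub_iff, Int.cast_natCast]

theorem sum_shift {A : Type*} [AddCommMonoid A] (i : Fin N) (f : Fin N → A) :
    ∑ j, f j = ∑ r, f (i + r) :=
  (Fintype.sum_equiv (Equiv.addLeft i) _ _ fun _ => rfl).symm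

theorem sinCoord_apply (S : Phase N) (m : ℤ) (r : Fin N) : sinCoord S m ((r : ℕ) : ℤ) =
    1 / (N : ℂ) * ∑ b, S b (b + r) *
      (e (-(m : ℂ) * ((r : ℕ) : ℂ) / (2 * N)) * e ((((b : ℕ) : ℂ) + 1) * (-m) / N)) := by
  rw [sinCoord]
  congr 1
  refine Finset.sum_congr rfl fun b _ => ?_
  rw [sum_shift b]
  simp only [T_apply, add_sub_cancel_left, mul_ite, mul_zero, Finset.sum_ite_eq', Finset.mem_univ,
    if_true, Int.cast_neg]

/-- The labels `m` which occur in `sinSum` together with the label `n = r`. -/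
def modes (r : Fin N) : Finset ℕ := if r = 0 then Finset.Ico 1 N else Finset.range N

theorem sum_erase_eq (f : ℕ → ℕ → ℂ) :
    ∑ p ∈ (Finset.range N ×ˢ Finset.range N).erase (0, 0), f p.1 p.2 =
      ∑ r : Fin N, ∑ m ∈ modes r, f m r := by
  have h1 : (Finset.range N ×ˢ Finset.range N).erase (0, 0) =
      (Finset.range N ×ˢ Finset.range N).filter (fun p => p ≠ (0, 0)) := by
    ext p; simp [and_comm]
  rw [h1, Finset.sum_filter, Finset.sum_product_right, Finset.sum_range]
  refine Finset.sum_congr rfl fun r _ => ?_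
  rw [modes]
  split_ifs with h
  · subst h
    rw [Finset.range_eq_Ico, Finset.sum_eq_sum_Ico_succ_bot (NeZero.pos N)]
    simp only [Fin.val_zero, ne_eq, not_true_eq_false, if_false, zero_add]
    refine Finset.sum_congr rfl fun m hm => if_pos ?_
    rw [Finset.mem_Ico] at hm
    intro h
    have := (Prod.ext_iff.1 h).1
    simp only at this
    omega
  · refine Finset.sum_congr rfl fun m _ => if_pos ?_
    intro h'
    exact h (Fin.ext (by simpa using (Prod.ext_iff.1 h').2))

/-- The entries of a sum over the sin-algebra basis: the entry `(i, j)` involves only the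
coordinates on the same cyclic diagonal. -/
theorem sinSum_apply (S : Phase N) (a : ℕ → ℕ → ℂ) (i j : Fin N) : sinSum S a i j =
    1 / (N : ℂ) * ∑ b, ∑ m ∈ modes (j - i),
      S b (b + (j - i)) * a m ((j - i : Fin N) : ℕ) * χ m (i - b) := by
  rw [sinSum, Matrix.sum_apply]
  simp only [Matrix.smul_apply, smul_eq_mul]
  rw [sum_erase_eq (fun m n => sinCoord S m n * a m n * T N m n i j)]
  simp only [T_apply, mul_ite, mul_zero]
  rw [Finset.sum_eq_single (j - i) (fun r _ hr => by simp [Ne.symm hr]) (by simp)]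
  simp only [if_true, sinCoord_apply]
  rw [Finset.sum_comm, Finset.mul_sum]
  refine Finset.sum_congr rfl fun m _ => ?_
  rw [Finset.mul_sum, Finset.mul_sum, Finset.sum_mul, Finset.sum_mul]
  refine Finset.sum_congr rfl fun b _ => ?_
  have key : (e (-((m : ℤ) : ℂ) * (((j - i : Fin N) : ℕ) : ℂ) / (2 * N)) *
      e ((((b : ℕ) : ℂ) + 1) * (-((m : ℤ) : ℂ)) / N)) *
      (e (((m : ℤ) : ℂ) * (((j - i : Fin N) : ℕ) : ℂ) / (2 * N)) *
        e ((((i : ℕ) : ℂ) + 1) * ((m : ℤ) : ℂ) / N)) = χ m (i - b) := by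
    rw [χ_sub_eq, ← e_add, ← e_add, ← e_add]
    congr 1
    push_cast
    ring
  rw [← key]
  push_cast
  ring

/-! ### The scaling exponents -/

/-- The scaling exponents as real numbers. -/
noncomputable def Chain.rexpo (K : Chain) (i j : Fin N) : ℝ :=
  match K with
  | .periodic => (1 - if i = j then 1 else 0) / (2 * N)
  | .nonperiodic =>
    (1 - (if i = j then 1 else 0) - (if (i : ℕ) = 0 ∧ (j : ℕ) + 1 = N then 1 / 2 else 0)) / (2 * N)

omit [NeZero N] in
theorem Chain.expo_eq (K : Chain) (i j : Fin N) : K.expo i j = (K.rexpo i j : ℝ) := by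
  cases K <;> simp only [Chain.expo, Chain.rexpo] <;> split_ifs <;> push_cast <;> ring

/-- The factor of the coordinate `S̃_{ij}` in the limit: it is `w` for `(i,j) = (1,N)`. -/
def Chain.factor (K : Chain) (i j : Fin N) : ℂ :=
  if (i : ℕ) = 0 ∧ (j : ℕ) + 1 = N then K.wrap else 1

theorem N_pos : (0 : ℝ) < N := Nat.cast_pos.2 (NeZero.pos N)

omit [NeZero N] in
theorem Chain.rexpo_self (hN : 2 ≤ N) (K : Chain) (i : Fin N) : K.rexpo i i = 0 := by
  cases K
  · simp [Chain.rexpo]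
  · have : ¬ ((i : ℕ) = 0 ∧ (i : ℕ) + 1 = N) := by omega
    rw [Chain.rexpo, if_pos rfl, if_neg this]
    simp

theorem Chain.rexpo_le (K : Chain) (i j : Fin N) : K.rexpo i j ≤ 1 / (2 * N) := by
  have := N_pos (N := N)
  cases K
  · simp only [Chain.rexpo]
    gcongr
    split_ifs <;> norm_num
  · simp only [Chain.rexpo]
    gcongr
    split_ifs <;> norm_num

theorem Chain.factor_eq (K : Chain) {i j : Fin N} (h : i ≠ j) :
    (if K.rexpo i j = 1 / (2 * N) then (1 : ℂ) else 0) = K.factor i j := by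
  have h0 : (2 * (N : ℝ)) ≠ 0 := by have := N_pos (N := N); positivity
  cases K
  · simp [Chain.rexpo, Chain.factor, Chain.wrap, h]
  · simp only [Chain.rexpo, Chain.factor, Chain.wrap, if_neg h, div_left_inj' h0]
    split_ifs with h1 h2 h3 <;> first | rfl | (exfalso; norm_num at *)

omit [NeZero N] in
theorem unscale_eq (K : Chain) (τ : ℂ) (S : Phase N) (i j : Fin N) :
    unscale K τ S i j = S i j * e ((-K.rexpo i j : ℝ) * τ) := by
  rw [unscale, K.expo_eq]; push_cast; rfl

/-! ### The limits of the coefficients -/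

/-- The power of `q` which is left over in the coefficients of the Lax matrices. -/
theorem lax_expo {n : ℕ} (hn : n < N) :
    -(n / (2 * N) : ℝ) - phiExpo (-(n / N)) (1 / 2) = min (n : ℝ) (N - n) / (2 * N) := by
  have hN := N_pos (N := N)
  have hn' : (n : ℝ) < N := by exact_mod_cast hn
  have h0 : (0 : ℝ) ≤ n / N := by positivity
  rw [phiExpo, abs_neg, abs_of_nonneg h0, abs_of_pos (by norm_num : (0 : ℝ) < 1 / 2)]
  rcases le_total (n : ℝ) (N - n) with h | h
  · have h1 : (n : ℝ) / N ≤ 1 / 2 := by rw [div_le_iff₀ hN]; linarith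
    rw [min_eq_left h, abs_of_nonneg (by linarith)]
    field_simp
    ring
  · have h1 : 1 / 2 ≤ (n : ℝ) / N := by rw [le_div_iff₀ hN]; linarith
    rw [min_eq_right h, abs_of_nonpos (by linarith)]
    field_simp
    ring

/-- The limit of an off-diagonal coefficient of a Lax matrix, multiplied by the scaling factor of a
coordinate with exponent `g`. By `lax_expo` it survives only if the exponent is maximal and the
coefficient belongs to one of the two diagonals next to the main one. -/
theorem tendsto_lax_coeff {n : ℕ} (h0 : 0 < n) (hn : n < N) {g : ℝ} (hg : g ≤ 1 / (2 * N)) (z : ℂ)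
    {f : ℂ → ℂ} {c : ℂ}
    (h : Tendsto (fun τ => e ((phiExpo (-(n / N)) (1 / 2) : ℝ) * τ) * f τ) imInfty (𝓝 c)) :
    Tendsto (fun τ => e ((-g : ℝ) * τ) * (e (-(n * (z + τ / 2) / N)) * f τ)) imInfty
      (𝓝 ((if g = 1 / (2 * N) then 1 else 0) *
        (e (-(n * z / N)) * if n = 1 ∨ n + 1 = N then c else 0))) := by
  have hN := N_pos (N := N)
  have hn' : (n : ℝ) + 1 ≤ N := by exact_mod_cast hn
  have h0' : (1 : ℝ) ≤ n := by exact_mod_cast h0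
  set D : ℝ := min (n : ℝ) (N - n) / (2 * N) with hD
  have hmin : (1 : ℝ) ≤ min (n : ℝ) (N - n) := le_min h0' (by linarith)
  have hDg : 1 / (2 * N) ≤ D := by rw [hD]; gcongr
  have hexp : 0 ≤ D - g := by linarith
  have ht := ((tendsto_e_mul_of_nonneg hexp).mul h).const_mul (e (-(n * z / N)))
  have hiff : D - g = 0 ↔ g = 1 / (2 * N) ∧ (n = 1 ∨ n + 1 = N) := by
    have hiff2 : D = 1 / (2 * N) ↔ (n = 1 ∨ n + 1 = N) := by
      rw [hD, div_left_inj' (by positivity)]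
      constructor
      · intro hm
        rcases min_choice (n : ℝ) (N - n) with h' | h' <;> rw [h'] at hm
        · left; exact_mod_cast hm
        · right
          have : (n : ℝ) + 1 = N := by linarith
          exact_mod_cast this
      · rintro (h' | h')
        · refine le_antisymm ((min_le_left _ _).trans (by simp [h'])) hmin
        · refine le_antisymm ((min_le_right _ _).trans ?_) hmin
          have : (n : ℝ) + 1 = N := by exact_mod_cast h'
          linarith
    rw [← hiff2]
    constructor
    · intro h'
      constructor <;> linarith
    · rintro ⟨h1, h2⟩
      rw [h1, h2, sub_self]
  have hlim : e (-(n * z / N)) * ((if D - g = 0 then 1 else 0) * c) =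
      (if g = 1 / (2 * N) then 1 else 0) *
        (e (-(n * z / N)) * if n = 1 ∨ n + 1 = N then c else 0) := by
    simp only [hiff]
    by_cases h1 : g = 1 / (2 * N) <;> by_cases h2 : n = 1 ∨ n + 1 = N <;> simp [h1, h2]
  rw [hlim] at ht
  refine ht.congr fun τ => ?_
  have key : e (-(n * z / N)) * (e ((D - g : ℝ) * τ) * e ((phiExpo (-(n / N)) (1 / 2) : ℝ) * τ)) =
      e ((-g : ℝ) * τ) * e (-(n * (z + τ / 2) / N)) := by
    rw [← e_add, ← e_add, ← e_add]
    congr 1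
    rw [hD, ← lax_expo hn]
    push_cast
    ring
  rw [← mul_assoc (e ((-g : ℝ) * τ)), ← key]
  ring

theorem thetaLim_ne_zero_of_ne (α : ℂ) {β : ℝ} (h : β ≠ 0) : thetaLim 0 α β ≠ 0 := by
  rcases lt_or_gt_of_ne h with h | h
  · rw [thetaLim_of_neg _ _ h, pow_zero, one_mul]; exact e_ne_zero _
  · rw [thetaLim_of_pos _ _ h, pow_zero, one_mul]; exact e_ne_zero _

theorem thetaLim_zero_zero (α : ℂ) : thetaLim 0 α 0 = I * (e (α / 2))⁻¹ * (e α - 1) := by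
  have h := e_ne_zero (α / 2)
  rw [thetaLim, if_pos le_rfl, if_pos le_rfl, e_half_add, e_neg_half_add, ← e_half_sq α]
  field_simp
  ring

theorem thetaLim_zero_zero_ne {α : ℂ} (h : e α ≠ 1) : thetaLim 0 α 0 ≠ 0 := by
  rw [thetaLim_zero_zero]
  exact mul_ne_zero (mul_ne_zero I_ne_zero (inv_ne_zero (e_ne_zero _))) (sub_ne_zero.2 h)

omit [NeZero N] in
theorem phi_arg (m n : ℕ) (τ : ℂ) :
    -((m + n * τ) / N) = -((m : ℂ) / N) + ((-(n / N) : ℝ) : ℂ) * τ := by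
  push_cast; ring

theorem phi_arg' (z τ : ℂ) : z + τ / 2 = z + ((1 / 2 : ℝ) : ℂ) * τ := by
  push_cast; ring

theorem abs_frac_lt {n : ℕ} (hn : n < N) : |(-(n / N) : ℝ)| < 1 ∧ |(-(n / N) : ℝ) + 1 / 2| < 1 := by
  have hN := N_pos (N := N)
  have hn' : (n : ℝ) < N := by exact_mod_cast hn
  have h0 : (0 : ℝ) ≤ n / N := by positivity
  have h1 : (n : ℝ) / N < 1 := by rwa [div_lt_one hN]
  constructor <;> rw [abs_lt] <;> constructor <;> linarith

theorem e_neg_frac_ne_one {m : ℕ} (h0 : 0 < m) (hm : m < N) : e (-((m : ℂ) / N)) ≠ 1 := by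
  rw [e_neg]
  exact inv_ne_one.2 (e_frac_ne_one h0 hm)

theorem tendsto_L_diag {m : ℕ} (h0 : 0 < m) (hm : m < N) (z : ℂ) :
    Tendsto (fun τ => phi (-((m + (0 : ℕ) * τ) / N)) (z + τ / 2) τ) imInfty
      (𝓝 (2 * Real.pi * I * (e (-((m : ℂ) / N)) - 1)⁻¹)) := by
  have hne := e_neg_frac_ne_one h0 hm
  have ht := tendsto_phi (-((m : ℂ) / N)) z (β₁ := 0) (β₂ := 1 / 2) (by norm_num)
    (by rw [abs_of_pos] <;> norm_num) (by rw [abs_of_pos] <;> norm_num)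
    (thetaLim_zero_zero_ne hne) (thetaLim_ne_zero_of_ne _ (by norm_num))
  rw [thetaLim_zero_zero, zero_add, thetaLim_of_pos _ _ (by norm_num), thetaLim_of_pos _ _
    (by norm_num), e_neg_half_add, e_neg_half_add, add_div, e_add] at ht
  have hlim : (-(Real.pi * I)) ^ 0 * (-I * (e (-((m : ℂ) / N) / 2) * e (z / 2))⁻¹) *
      (-2 * Real.pi) / (I * (e (-((m : ℂ) / N) / 2))⁻¹ * (e (-((m : ℂ) / N)) - 1) *
        ((-(Real.pi * I)) ^ 0 * (-I * (e (z / 2))⁻¹))) =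
      2 * Real.pi * I * (e (-((m : ℂ) / N)) - 1)⁻¹ := by
    have a1 := e_ne_zero (-((m : ℂ) / N) / 2)
    have a2 := e_ne_zero (z / 2)
    have a3 := sub_ne_zero.2 hne
    have a4 := I_ne_zero
    rw [pow_zero, one_mul, one_mul]
    generalize e (-((m : ℂ) / N) / 2) = x at *
    generalize e (z / 2) = y at *
    generalize e (-((m : ℂ) / N)) = t at *
    field_simp
    linear_combination -I_sq
  rw [hlim] at ht
  refine ht.congr fun τ => ?_
  have h1 : phiExpo 0 (1 / 2) = 0 := by simp [phiExpo]
  rw [h1, phi_arg', phi_arg]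
  simp [e_zero]

theorem tendsto_M_diag {m : ℕ} (h0 : 0 < m) (hm : m < N) (z : ℂ) :
    Tendsto (fun τ => deriv (fun u => phi u (z + τ / 2) τ) (-((m + (0 : ℕ) * τ) / N))) imInfty
      (𝓝 (-(Real.pi : ℂ) ^ 2 * (sin (Real.pi * (m / N)) ^ 2)⁻¹)) := by
  have hne := e_neg_frac_ne_one h0 hm
  have ht := tendsto_deriv_phi (-((m : ℂ) / N)) z (β₁ := 0) (β₂ := 1 / 2) (by norm_num)
    (by rw [abs_of_pos] <;> norm_num) (by rw [abs_of_pos] <;> norm_num)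
    (thetaLim_zero_zero_ne hne) (thetaLim_ne_zero_of_ne _ (by norm_num))
  have hsin : sin (Real.pi * (m / N)) ^ 2 =
      -(e (-((m : ℂ) / N)) - 1) ^ 2 / (4 * e (-((m : ℂ) / N))) := by
    have a1 := e_ne_zero (-((m : ℂ) / N))
    have a2 : e ((m : ℂ) / N) = (e (-((m : ℂ) / N)))⁻¹ := by rw [e_neg, inv_inv]
    rw [sin_sq_eq_e, a2]
    field_simp
    ring
  have h1z : thetaLim 1 (-((m : ℂ) / N)) 0 = Real.pi * I * I * (e (-((m : ℂ) / N) / 2))⁻¹ *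
      (e (-((m : ℂ) / N)) + 1) := by
    have h := e_ne_zero (-((m : ℂ) / N) / 2)
    rw [thetaLim, if_pos le_rfl, if_pos le_rfl, e_half_add, e_neg_half_add,
      ← e_half_sq (-((m : ℂ) / N))]
    field_simp
    ring
  rw [thetaLim_zero_zero, zero_add, h1z, thetaLim_of_pos _ _ (by norm_num), thetaLim_of_pos _ _
    (by norm_num), thetaLim_of_pos _ _ (by norm_num), e_neg_half_add, e_neg_half_add, add_div,
    e_add] at ht
  refine (ht.congr fun τ => ?_).trans (le_of_eq (congrArg 𝓝 ?_))
  · have h1 : phiExpo 0 (1 / 2) = 0 := by simp [phiExpo]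
    rw [h1, phi_arg', phi_arg]
    simp [e_zero]
  · rw [hsin, ← e_half_sq (-((m : ℂ) / N))]
    rw [← e_half_sq (-((m : ℂ) / N))] at hne
    have a1 := e_ne_zero (-((m : ℂ) / N) / 2)
    have a2 := e_ne_zero (z / 2)
    have a3 := sub_ne_zero.2 hne
    generalize e (-((m : ℂ) / N) / 2) = x at *
    generalize e (z / 2) = y at *
    have a4 := I_ne_zero
    rw [pow_zero, one_mul, one_mul, pow_one, inv_div]
    field_simp
    ring

end

section
variable {N : ℕ} [NeZero N]

/-- The limits of the coefficients of the first Lax matrix off the main diagonal. -/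
theorem tendsto_L_off (hN : 3 ≤ N) {m n : ℕ} (h0 : 0 < n) (hn : n < N) {g : ℝ}
    (hg : g ≤ 1 / (2 * N)) (z : ℂ) :
    Tendsto (fun τ => e ((-g : ℝ) * τ) * (e (-(n * (z + τ / 2) / N)) *
        phi (-((m + n * τ) / N)) (z + τ / 2) τ)) imInfty
      (𝓝 ((if g = 1 / (2 * N) then 1 else 0) *
        (if n = 1 then 2 * Real.pi * I * e (-(z / N)) * e (m / N) else
          if n + 1 = N then -(2 * Real.pi * I * e (z / N)) else 0))) := by
  have hNr := N_pos (N := N)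
  have hNc := N_ne_zero (N := N)
  have hn0 : (-(n / N) : ℝ) ≠ 0 := by
    have : (0 : ℝ) < n := by exact_mod_cast h0
    have : (0 : ℝ) < n / N := by positivity
    linarith
  have hneg : (-(n / N) : ℝ) < 0 := lt_of_le_of_ne (neg_nonpos.2 (by positivity)) hn0
  have ht := tendsto_phi (-((m : ℂ) / N)) z (abs_frac_lt hn).1
    (by rw [abs_of_pos] <;> norm_num) (abs_frac_lt hn).2
    (thetaLim_ne_zero_of_ne _ hn0) (thetaLim_ne_zero_of_ne z (β := 1 / 2) (by norm_num))
  simp only [← phi_arg, ← phi_arg'] at ht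
  refine (tendsto_lax_coeff h0 hn hg z ht).trans (le_of_eq (congrArg 𝓝 (congrArg _ ?_)))
  have a1 := e_ne_zero (-((m : ℂ) / N) / 2)
  have a2 := e_ne_zero (z / 2)
  have a4 := I_ne_zero
  rw [thetaLim_of_neg 0 (-((m : ℂ) / N)) hneg, thetaLim_of_pos 0 z (by norm_num : (0 : ℝ) < 1 / 2),
    e_half_add, e_neg_half_add z]
  by_cases h1 : n = 1
  · have hb : (0 : ℝ) < -(n / N) + 1 / 2 := by
      have h3 : (3 : ℝ) ≤ N := by exact_mod_cast hN
      have : (1 : ℝ) / N ≤ 1 / 3 := by gcongr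
      rw [h1]; push_cast; linarith
    have hm : e ((m : ℂ) / N) = (e (-((m : ℂ) / N) / 2))⁻¹ ^ 2 := by
      rw [inv_pow, e_half_sq, e_neg, inv_inv]
    rw [if_pos (Or.inl h1), if_pos h1, thetaLim_of_pos _ _ hb, e_neg_half_add, add_div, e_add, hm,
      h1, Nat.cast_one, one_mul]
    generalize e (-((m : ℂ) / N) / 2) = x at *
    generalize e (z / 2) = y at *
    generalize e (-(z / N)) = t at *
    field_simp
    linear_combination -t * I_sq
  · rw [if_neg h1]
    by_cases h2 : n + 1 = N
    · have hn2 : (2 : ℝ) ≤ n := by exact_mod_cast (show 2 ≤ n by omega)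
      have hN2 : (n : ℝ) + 1 = N := by exact_mod_cast h2
      have hb : (-(n / N) + 1 / 2 : ℝ) < 0 := by
        have : (1 : ℝ) / 2 < n / N := by rw [lt_div_iff₀ hNr]; linarith
        linarith
      have hz : e (-((n : ℂ) * z / N)) * e (z / 2) ^ 2 = e (z / N) := by
        rw [e_half_sq, ← e_add]
        congr 1
        have hc : (n : ℂ) + 1 = N := by exact_mod_cast h2
        field_simp
        linear_combination -z * hc
      rw [if_pos (Or.inr h2), if_pos h2, thetaLim_of_neg _ _ hb, e_half_add, add_div, e_add, ← hz]
      generalize e (-((m : ℂ) / N) / 2) = x at *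
      generalize e (z / 2) = y at *
      generalize e (-((n : ℂ) * z / N)) = t at *
      field_simp
      linear_combination t * I_sq
    · rw [if_neg h2, if_neg (by tauto), mul_zero]

/-- The limits of the coefficients of the second Lax matrix off the main diagonal. On the diagonal
below the main one the leading terms of the derivative of the quotient `ϕ` cancel. -/
theorem tendsto_M_off (hN : 3 ≤ N) {m n : ℕ} (h0 : 0 < n) (hn : n < N) {g : ℝ}
    (hg : g ≤ 1 / (2 * N)) (z : ℂ) :
    Tendsto (fun τ => e ((-g : ℝ) * τ) * (e (-(n * (z + τ / 2) / N)) *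
        deriv (fun u => phi u (z + τ / 2) τ) (-((m + n * τ) / N)))) imInfty
      (𝓝 ((if g = 1 / (2 * N) then 1 else 0) *
        (if n = 1 then 4 * (Real.pi : ℂ) ^ 2 * e (-(z / N)) * e (m / N) else 0))) := by
  have hNr := N_pos (N := N)
  have hNc := N_ne_zero (N := N)
  have hn0 : (-(n / N) : ℝ) ≠ 0 := by
    have : (0 : ℝ) < n := by exact_mod_cast h0
    have : (0 : ℝ) < n / N := by positivity
    linarith
  have hneg : (-(n / N) : ℝ) < 0 := lt_of_le_of_ne (neg_nonpos.2 (by positivity)) hn0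
  have ht := tendsto_deriv_phi (-((m : ℂ) / N)) z (abs_frac_lt hn).1
    (by rw [abs_of_pos] <;> norm_num) (abs_frac_lt hn).2
    (thetaLim_ne_zero_of_ne _ hn0) (thetaLim_ne_zero_of_ne z (β := 1 / 2) (by norm_num))
  simp only [← phi_arg, ← phi_arg'] at ht
  refine (tendsto_lax_coeff h0 hn hg z ht).trans (le_of_eq (congrArg 𝓝 (congrArg _ ?_)))
  have a1 := e_ne_zero (-((m : ℂ) / N) / 2)
  have a2 := e_ne_zero (z / 2)
  have a4 := I_ne_zero
  rw [thetaLim_of_neg 0 (-((m : ℂ) / N)) hneg, thetaLim_of_neg 1 (-((m : ℂ) / N)) hneg,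
    thetaLim_of_pos 0 z (by norm_num : (0 : ℝ) < 1 / 2), e_half_add, e_neg_half_add z]
  by_cases h1 : n = 1
  · have hb : (0 : ℝ) < -(n / N) + 1 / 2 := by
      have h3 : (3 : ℝ) ≤ N := by exact_mod_cast hN
      have : (1 : ℝ) / N ≤ 1 / 3 := by gcongr
      rw [h1]; push_cast; linarith
    have hm : e ((m : ℂ) / N) = (e (-((m : ℂ) / N) / 2))⁻¹ ^ 2 := by
      rw [inv_pow, e_half_sq, e_neg, inv_inv]
    rw [if_pos (Or.inl h1), if_pos h1, thetaLim_of_pos _ _ hb, thetaLim_of_pos _ _ hb,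
      e_neg_half_add, add_div, e_add, hm, h1, Nat.cast_one, one_mul]
    generalize e (-((m : ℂ) / N) / 2) = x at *
    generalize e (z / 2) = y at *
    generalize e (-(z / N)) = t at *
    field_simp
    ring
  · rw [if_neg h1]
    by_cases h2 : n + 1 = N
    · have hn2 : (2 : ℝ) ≤ n := by exact_mod_cast (show 2 ≤ n by omega)
      have hN2 : (n : ℝ) + 1 = N := by exact_mod_cast h2
      have hb : (-(n / N) + 1 / 2 : ℝ) < 0 := by
        have : (1 : ℝ) / 2 < n / N := by rw [lt_div_iff₀ hNr]; linarith
        linarith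
      rw [if_pos (Or.inr h2), thetaLim_of_neg _ _ hb, thetaLim_of_neg _ _ hb]
      simp only [pow_zero, pow_one]
      ring
    · rw [if_neg (by tauto), mul_zero]

/-! ### Fourier inversion on the sin-algebra basis -/

/-- A sum over the sin-algebra basis converges if its coefficients do, once they have absorbed the
scaling factors of the coordinates. -/
theorem tendsto_sinSum (K : Chain) (S : Phase N) (i j : Fin N) {a : ℂ → ℕ → ℕ → ℂ}
    {c : Fin N → ℕ → ℂ} (h : ∀ b, ∀ m ∈ modes (j - i), Tendsto (fun τ =>
      e ((-K.rexpo b (b + (j - i)) : ℝ) * τ) * a τ m ((j - i : Fin N) : ℕ)) imInfty (𝓝 (c b m))) :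
    Tendsto (fun τ => sinSum (unscale K τ S) (a τ) i j) imInfty
      (𝓝 (1 / (N : ℂ) * ∑ b, ∑ m ∈ modes (j - i), S b (b + (j - i)) * c b m * χ m (i - b))) := by
  simp only [sinSum_apply, unscale_eq]
  refine Tendsto.const_mul _ (tendsto_finsetSum _ fun b _ => tendsto_finsetSum _ fun m hm => ?_)
  simpa only [mul_assoc] using ((h b m hm).const_mul (S b (b + (j - i)))).mul_const (χ m (i - b))

/-- Fourier inversion: only the coordinate shifted by `s` survives. -/
theorem fourier_inversion (f : Fin N → ℂ) (i s : Fin N) :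
    1 / (N : ℂ) * ∑ b, ∑ m ∈ Finset.range N, f b * χ m s * χ m (i - b) = f (i + s) := by
  have hN := N_ne_zero (N := N)
  have h : ∀ b, ∑ m ∈ Finset.range N, f b * χ m s * χ m (i - b) =
      if i + s = b then f b * N else 0 := by
    intro b
    simp only [mul_assoc, ← χ_add, ← Finset.mul_sum, sum_range_χ]
    have : s + (i - b) = 0 ↔ i + s = b := by
      rw [← add_sub_assoc, sub_eq_zero, add_comm]
    simp only [this, mul_ite, mul_zero]
  simp only [h, Finset.sum_ite_eq, Finset.mem_univ, if_true]
  field_simp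

/-! ### Indices modulo `N` -/

theorem val_eq_zero_iff (r : Fin N) : (r : ℕ) = 0 ↔ r = 0 := by
  rw [Fin.ext_iff, Fin.val_zero]

theorem val_one (hN : 3 ≤ N) : ((1 : Fin N) : ℕ) = 1 := by
  rw [Fin.val_one', Nat.mod_eq_of_lt (by omega)]

theorem val_eq_one_iff (hN : 3 ≤ N) (r : Fin N) : (r : ℕ) = 1 ↔ r = 1 := by
  rw [Fin.ext_iff, val_one hN]

theorem val_neg_one (hN : 3 ≤ N) : ((-1 : Fin N) : ℕ) = N - 1 := by
  rw [Fin.neg_def, val_one hN]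
  exact Nat.mod_eq_of_lt (by omega)

theorem val_add_one_iff (hN : 3 ≤ N) (r : Fin N) : (r : ℕ) + 1 = N ↔ r = -1 := by
  rw [Fin.ext_iff, val_neg_one hN]; omega

theorem one_ne_zero' (hN : 3 ≤ N) : (1 : Fin N) ≠ 0 := by
  rw [Ne, Fin.ext_iff, val_one hN]; simp

theorem one_ne_neg_one (hN : 3 ≤ N) : (1 : Fin N) ≠ -1 := by
  rw [Ne, Fin.ext_iff, val_one hN, val_neg_one hN]; omega

theorem two_eq : (2 : Fin N) = 1 + 1 := by
  apply Fin.ext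
  simp [Fin.val_add]

theorem val_sub_one_of_zero (hN : 3 ≤ N) {i : Fin N} (h : (i : ℕ) = 0) :
    ((i - 1 : Fin N) : ℕ) + 1 = N := by
  rw [val_add_one_iff hN, (val_eq_zero_iff i).1 h, zero_sub]

theorem Chain.factor_succ (hN : 3 ≤ N) (K : Chain) (i : Fin N) : K.factor i (i + 1) = 1 := by
  refine if_neg ?_
  rintro ⟨h1, h2⟩
  rw [(val_eq_zero_iff i).1 h1, zero_add, val_one hN] at h2
  omega

theorem Chain.factor_pred (hN : 3 ≤ N) (K : Chain) (i : Fin N) :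
    K.factor i (i - 1) = if (i : ℕ) = 0 then K.wrap else 1 := by
  rw [Chain.factor]
  congr 1
  exact propext ⟨fun h => h.1, fun h => ⟨h, val_sub_one_of_zero hN h⟩⟩

theorem eq_add_one_iff (i j : Fin N) : j = i + 1 ↔ j - i = 1 := by
  rw [sub_eq_iff_eq_add, add_comm]

theorem eq_sub_one_iff (i j : Fin N) : j = i - 1 ↔ j - i = -1 := by
  rw [sub_eq_iff_eq_add, sub_eq_add_neg, add_comm]

theorem eq_iff_sub (i j : Fin N) : j = i ↔ j - i = 0 := sub_eq_zero.symm

theorem ne_add_of_ne {r : Fin N} (hr : r ≠ 0) (b : Fin N) : b ≠ b + r := by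
  simpa using hr

theorem mem_modes_zero {r : Fin N} (hr : r = 0) {m : ℕ} (hm : m ∈ modes r) : 0 < m ∧ m < N := by
  rw [modes, if_pos hr, Finset.mem_Ico] at hm; exact ⟨by omega, hm.2⟩

/-! ### The limits of the Lax matrices -/

theorem tendsto_topL (hN : 3 ≤ N) (K : Chain) (S : Phase N) (z : ℂ) :
    Tendsto (fun τ => topL (unscale K τ S) (z + τ / 2) τ) imInfty (𝓝 (limL K S z)) := by
  refine tendsto_pi_nhds.2 fun i => tendsto_pi_nhds.2 fun j => ?_
  simp only [limL, Matrix.of_apply, eq_iff_sub i j, eq_add_one_iff, eq_sub_one_iff]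
  have h10 := one_ne_zero' hN
  have h1m := one_ne_neg_one hN
  by_cases hr : j - i = 0
  · rw [if_pos hr, if_neg (by rw [hr]; exact h10.symm),
      if_neg (by rw [hr]; exact fun h => h10 (by rw [← neg_eq_zero, ← h])), add_zero, sub_zero]
    refine (tendsto_sinSum K S i j (c := fun _ m =>
      2 * Real.pi * I * (e (-((m : ℂ) / N)) - 1)⁻¹) ?_).trans (le_of_eq (congrArg 𝓝 ?_))
    · intro b m hm
      obtain ⟨m0, mN⟩ := mem_modes_zero hr hm
      rw [hr, add_zero, K.rexpo_self (by omega), Fin.val_zero]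
      simpa [e_zero] using tendsto_L_diag m0 mN z
    · rw [hr, modes, if_pos rfl, Finset.mul_sum, Finset.mul_sum]
      refine Finset.sum_congr rfl fun b _ => ?_
      rw [Finset.mul_sum, Finset.mul_sum]
      refine Finset.sum_congr rfl fun m _ => ?_
      rw [add_zero, χ_sub_eq]
      ring
  · rw [if_neg hr, zero_add]
    have hpos : 0 < ((j - i : Fin N) : ℕ) :=
      Nat.pos_of_ne_zero fun h => hr ((val_eq_zero_iff _).1 h)
    have ht := tendsto_sinSum K S i j (a := fun τ m n =>
      e (-(n * (z + τ / 2) / N)) * phi (-((m + n * τ) / N)) (z + τ / 2) τ) fun b m _ =>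
      tendsto_L_off hN (m := m) hpos (j - i).2 (K.rexpo_le b (b + (j - i))) z
    refine ht.trans (le_of_eq (congrArg 𝓝 ?_))
    simp only [K.factor_eq (ne_add_of_ne hr _), modes, if_neg hr, val_eq_one_iff hN,
      val_add_one_iff hN]
    by_cases h1 : j - i = 1
    · simp only [h1, if_true, if_neg h1m, sub_zero, K.factor_succ hN]
      have h := fourier_inversion (fun b => S b (b + 1) * (2 * Real.pi * I * e (-(z / N)))) i 1
      simp only [χ_one (show 2 ≤ N by omega)] at h
      rw [two_eq, ← add_assoc]
      refine (Eq.trans ?_ h).trans (by ring)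
      congr 1
      refine Finset.sum_congr rfl fun b _ => Finset.sum_congr rfl fun m _ => ?_
      ring
    · simp only [if_neg h1, zero_sub]
      by_cases h2 : j - i = -1
      · simp only [h2, if_true, ← sub_eq_add_neg, K.factor_pred hN]
        have h := fourier_inversion (fun b => S b (b - 1) * ((if (b : ℕ) = 0 then K.wrap else 1) *
          -(2 * Real.pi * I * e (z / N)))) i 0
        simp only [χ_zero, mul_one, add_zero] at h
        rw [h]
        ring
      · simp [h2]

theorem tendsto_topM (hN : 3 ≤ N) (K : Chain) (S : Phase N) (z : ℂ) :
    Tendsto (fun τ => topM (unscale K τ S) (z + τ / 2) τ) imInfty (𝓝 (limM S z)) := by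
  refine tendsto_pi_nhds.2 fun i => tendsto_pi_nhds.2 fun j => ?_
  simp only [limM, Matrix.of_apply, eq_iff_sub i j, eq_add_one_iff]
  have h10 := one_ne_zero' hN
  by_cases hr : j - i = 0
  · rw [if_pos hr, if_neg (by rw [hr]; exact h10.symm), add_zero]
    refine (tendsto_sinSum K S i j (c := fun _ m =>
      -(Real.pi : ℂ) ^ 2 * (sin (Real.pi * (m / N)) ^ 2)⁻¹) ?_).trans (le_of_eq (congrArg 𝓝 ?_))
    · intro b m hm
      obtain ⟨m0, mN⟩ := mem_modes_zero hr hm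
      rw [hr, add_zero, K.rexpo_self (by omega), Fin.val_zero]
      simpa [e_zero] using tendsto_M_diag m0 mN z
    · rw [hr, modes, if_pos rfl, Finset.sum_comm, Finset.mul_sum, Finset.mul_sum]
      refine Finset.sum_congr rfl fun b _ => ?_
      rw [Finset.mul_sum, Finset.mul_sum]
      refine Finset.sum_congr rfl fun m _ => ?_
      rw [add_zero, χ_sub_eq]
      ring
  · rw [if_neg hr, zero_add]
    have hpos : 0 < ((j - i : Fin N) : ℕ) :=
      Nat.pos_of_ne_zero fun h => hr ((val_eq_zero_iff _).1 h)
    have ht := tendsto_sinSum K S i j (a := fun τ m n =>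
      e (-(n * (z + τ / 2) / N)) * deriv (fun u => phi u (z + τ / 2) τ) (-((m + n * τ) / N)))
      fun b m _ => tendsto_M_off hN (m := m) hpos (j - i).2 (K.rexpo_le b (b + (j - i))) z
    refine ht.trans (le_of_eq (congrArg 𝓝 ?_))
    simp only [K.factor_eq (ne_add_of_ne hr _), modes, if_neg hr, val_eq_one_iff hN]
    by_cases h1 : j - i = 1
    · simp only [h1, if_true, K.factor_succ hN]
      have h := fourier_inversion
        (fun b => S b (b + 1) * (4 * (Real.pi : ℂ) ^ 2 * e (-(z / N)))) i 1
      simp only [χ_one (show 2 ≤ N by omega)] at h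
      rw [two_eq, ← add_assoc]
      refine (Eq.trans ?_ h).trans (by ring)
      congr 1
      refine Finset.sum_congr rfl fun b _ => Finset.sum_congr rfl fun m _ => ?_
      ring
    · simp [h1]

end

section
variable {N : ℕ} [NeZero N]

/-! ### The limit of the Hamiltonian -/

/-- The limits of the off-diagonal coefficients of the Hamiltonian, multiplied by the scaling
factors of two coordinates with the exponents `g` and `g'`. -/
theorem tendsto_H_off (hN : 3 ≤ N) {m n : ℕ} (h0 : 0 < n) (hn : n < N) {g g' : ℝ}
    (hg : g ≤ 1 / (2 * N)) (hg' : g' ≤ 1 / (2 * N)) :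
    Tendsto (fun τ => e ((-g : ℝ) * τ) * e ((-g' : ℝ) * τ) * E2 ((m + n * τ) / N) τ) imInfty
      (𝓝 ((if g = 1 / (2 * N) then 1 else 0) * (if g' = 1 / (2 * N) then 1 else 0) *
        (-4 * (Real.pi : ℂ) ^ 2 * ((if n = 1 then e (m / N) else 0) +
          if n + 1 = N then e (-(m / N)) else 0)))) := by
  have hNr := N_pos (N := N)
  have hn' : (n : ℝ) + 1 ≤ N := by exact_mod_cast hn
  have h0' : (1 : ℝ) ≤ n := by exact_mod_cast h0
  have e1 : 1 / (2 * N) + 1 / (2 * N) = (1 : ℝ) / N := by field_simp; ring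
  have e2 : (1 : ℝ) / N ≤ n / N := by gcongr
  have e3 : (1 : ℝ) / N ≤ 1 - n / N := by
    rw [le_sub_iff_add_le, ← add_div, div_le_one hNr]; linarith
  have ht := tendsto_E2 (α := (m : ℂ) / N) (by simp)
    (β := n / N) (γ := g + g') (by positivity) (by rw [div_lt_one hNr]; linarith)
    (by linarith) (by linarith)
  refine (ht.congr fun τ => ?_).trans (le_of_eq (congrArg 𝓝 ?_))
  · rw [← e_add]
    congr 1
    · congr 1; push_cast; ring
    · congr 1; push_cast; ring
  · by_cases hgg : g = 1 / (2 * N) ∧ g' = 1 / (2 * N)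
    · have i1 : (n : ℝ) / N = g + g' ↔ n = 1 := by
        rw [hgg.1, hgg.2, e1, div_left_inj' hNr.ne', Nat.cast_eq_one]
      have i2 : 1 - (n : ℝ) / N = g + g' ↔ n + 1 = N := by
        rw [hgg.1, hgg.2, e1, sub_eq_iff_eq_add, ← add_div, eq_comm, div_eq_one_iff_eq hNr.ne',
          add_comm]
        exact_mod_cast Iff.rfl
      simp only [i1, i2, if_pos hgg.1, if_pos hgg.2, one_mul]
    · have hlt : g + g' < 1 / N := by
        rcases not_and_or.1 hgg with h | h
        · have := lt_of_le_of_ne hg h; linarith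
        · have := lt_of_le_of_ne hg' h; linarith
      rw [if_neg (show ¬ (n : ℝ) / N = g + g' by intro h; linarith),
        if_neg (show ¬ 1 - (n : ℝ) / N = g + g' by intro h; linarith)]
      rcases not_and_or.1 hgg with h | h <;> simp only [if_neg h] <;> ring

theorem tendsto_H_diag {m : ℕ} (h0 : 0 < m) (hm : m < N) :
    Tendsto (fun τ => E2 ((m + (0 : ℕ) * τ) / N) τ) imInfty
      (𝓝 ((Real.pi : ℂ) ^ 2 * (sin (Real.pi * (m / N)) ^ 2)⁻¹)) := by
  have h := tendsto_E2_real (x := m / N) (by push_cast; exact e_frac_ne_one h0 hm)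
  push_cast at h
  simpa using h

theorem topH_eq (S : Phase N) (τ : ℂ) : topH S τ = -(1 / 2) * ∑ i, ∑ j, 1 / (N : ℂ) *
    ∑ b, ∑ m ∈ modes (i - j), S i j * S b (b + (i - j)) *
      E2 ((m + (((i - j : Fin N) : ℕ) : ℂ) * τ) / N) τ * χ m (j - b) := by
  rw [topH, Matrix.trace]
  congr 1
  refine Finset.sum_congr rfl fun i _ => ?_
  rw [Matrix.diag_apply, Matrix.mul_apply]
  refine Finset.sum_congr rfl fun j _ => ?_
  rw [topJ, sinSum_apply, Matrix.of_apply, mul_left_comm, Finset.mul_sum]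
  congr 1
  refine Finset.sum_congr rfl fun b _ => ?_
  rw [Finset.mul_sum]
  refine Finset.sum_congr rfl fun m _ => ?_
  ring

theorem one_sub_cos (x : ℂ) : 1 - cos (2 * Real.pi * x) = 2 * sin (Real.pi * x) ^ 2 := by
  rw [show (2 * Real.pi * x : ℂ) = 2 * (Real.pi * x) by ring, cos_two_mul, cos_sq']
  ring

theorem tendsto_topH (hN : 3 ≤ N) (K : Chain) (S : Phase N) :
    Tendsto (fun τ => topH (unscale K τ S) τ) imInfty (𝓝 (limH K S)) := by
  have h10 := one_ne_zero' hN
  have h1m := one_ne_neg_one hN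
  have hm0 : (-1 : Fin N) ≠ 0 := neg_ne_zero.2 h10
  set A : Fin N → ℂ := fun i => 1 / (N : ℂ) * ∑ b, ∑ m ∈ Finset.Ico 1 N, S i i * S b b *
    ((Real.pi : ℂ) ^ 2 * (sin (Real.pi * (m / N)) ^ 2)⁻¹) * χ m (i - b) with hA
  set B : Fin N → ℂ := fun i => -4 * (Real.pi : ℂ) ^ 2 *
    ((if (i : ℕ) = 0 then K.wrap else 1) * (S i (i + 1) * S i (i - 1))) with hB
  have hlim : limH K S = -(1 / 2) * ∑ i, ∑ j, ((if i - j = 0 then A i else 0) +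
      ((if i - j = 1 then B i else 0) + if i - j = -1 then B i else 0)) := by
    have s1 : ∀ (c : Fin N → ℂ) (r i : Fin N), ∑ j, (if i - j = r then c i else 0) = c i := by
      intro c r i
      have : ∀ j : Fin N, i - j = r ↔ j = i - r := fun j =>
        ⟨fun h => by rw [← h]; abel, fun h => by rw [h]; abel⟩
      simp only [this, Finset.sum_ite_eq', Finset.mem_univ, if_true]
    simp only [Finset.sum_add_distrib, s1]
    rw [limH, hA, hB]
    simp only [← Finset.mul_sum]
    rw [Finset.sum_comm (γ := Fin N)]
    simp only [one_sub_cos, χ_sub_eq]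
    have : ∀ x y : ℂ, -(1 / 2) * (x + (-4 * (Real.pi : ℂ) ^ 2 * y + -4 * (Real.pi : ℂ) ^ 2 * y)) =
      -(1 / 2) * x + 4 * (Real.pi : ℂ) ^ 2 * y := fun x y => by ring
    rw [this]
    congr 1
    simp only [Finset.mul_sum]
    refine Finset.sum_congr rfl fun i _ => Finset.sum_congr rfl fun b _ =>
      Finset.sum_congr rfl fun m _ => ?_
    rw [mul_inv]
    ring
  rw [hlim]
  simp only [topH_eq, unscale_eq]
  refine Tendsto.const_mul _ (tendsto_finsetSum _ fun i _ => tendsto_finsetSum _ fun j _ => ?_)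
  have hne : ∀ {i j : Fin N}, i - j ≠ 0 → i ≠ j := fun h h' => h (by rw [h', sub_self])
  by_cases hr : i - j = 0
  · have hij := sub_eq_zero.1 hr
    subst hij
    simp only [sub_self, if_true, if_neg h10.symm, if_neg hm0.symm, add_zero,
      K.rexpo_self (show 2 ≤ N by omega), hA]
    refine Tendsto.const_mul _ (tendsto_finsetSum _ fun b _ => ?_)
    rw [modes, if_pos rfl]
    refine tendsto_finsetSum _ fun m hm => ?_
    rw [Finset.mem_Ico] at hm
    simpa [e_zero] using ((tendsto_H_diag (N := N) (m := m) (by omega) hm.2).const_mul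
      (S i i * S b b)).mul_const (χ m (i - b))
  · have hij := hne hr
    have hpos : 0 < ((i - j : Fin N) : ℕ) :=
      Nat.pos_of_ne_zero fun h => hr ((val_eq_zero_iff _).1 h)
    have ht : Tendsto (fun τ => 1 / (N : ℂ) * ∑ b, ∑ m ∈ modes (i - j),
        S i j * e ((-K.rexpo i j : ℝ) * τ) *
        (S b (b + (i - j)) * e ((-K.rexpo b (b + (i - j)) : ℝ) * τ)) *
        E2 ((m + (((i - j : Fin N) : ℕ) : ℂ) * τ) / N) τ * χ m (j - b)) imInfty
        (𝓝 (1 / (N : ℂ) * ∑ b, ∑ m ∈ modes (i - j), S i j * S b (b + (i - j)) *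
          (K.factor i j * K.factor b (b + (i - j)) * (-4 * (Real.pi : ℂ) ^ 2 *
          ((if i - j = 1 then e (m / N) else 0) + if i - j = -1 then e (-(m / N)) else 0))) *
          χ m (j - b))) := by
      refine Tendsto.const_mul _ (tendsto_finsetSum _ fun b _ => tendsto_finsetSum _ fun m _ => ?_)
      have h := tendsto_H_off hN (m := m) hpos (i - j).2 (K.rexpo_le i j)
        (K.rexpo_le b (b + (i - j)))
      rw [K.factor_eq hij, K.factor_eq (ne_add_of_ne hr b)] at h
      simp only [val_eq_one_iff hN, val_add_one_iff hN] at h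
      refine ((h.const_mul (S i j * S b (b + (i - j)))).mul_const (χ m (j - b))).congr fun τ => ?_
      ring
    refine ht.trans (le_of_eq (congrArg 𝓝 ?_))
    rw [if_neg hr, zero_add, modes, if_neg hr]
    by_cases h1 : i - j = 1
    · simp only [h1, if_true, if_neg h1m, add_zero, K.factor_succ hN, mul_one]
      have hj : j = i - 1 := by rw [← h1]; abel
      have h := fourier_inversion (fun b => S i j * S b (b + 1) *
        (K.factor i j * (-4 * (Real.pi : ℂ) ^ 2))) j 1
      simp only [χ_one (show 2 ≤ N by omega)] at h
      refine Eq.trans ?_ (h.trans ?_)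
      · congr 1
        refine Finset.sum_congr rfl fun b _ => Finset.sum_congr rfl fun m _ => ?_
        ring
      · rw [hj, sub_add_cancel, K.factor_pred hN, hB]
        ring
    · simp only [if_neg h1, zero_add]
      by_cases h2 : i - j = -1
      · have hj : j = i + 1 := by rw [← sub_neg_eq_add, ← h2]; abel
        simp only [h2, if_true, ← sub_eq_add_neg]
        have h := fourier_inversion (fun b => S i j * S b (b - 1) *
          (K.factor i j * K.factor b (b - 1) * (-4 * (Real.pi : ℂ) ^ 2))) j (-1)
        simp only [χ_neg, χ_one (show 2 ≤ N by omega), ← e_neg] at h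
        refine Eq.trans ?_ (h.trans ?_)
        · congr 1
          refine Finset.sum_congr rfl fun b _ => Finset.sum_congr rfl fun m _ => ?_
          ring
        · rw [hj, ← sub_eq_add_neg, add_sub_cancel_right, K.factor_pred hN, K.factor_succ hN, hB]
          ring
      · simp [h2]

/-! ### The limit of the Poisson brackets -/

/-- The scaling of the coordinates as a continuous linear map. -/
noncomputable def scaleCLM (K : Chain) (τ : ℂ) : Phase N →L[ℂ] Phase N :=
  LinearMap.toContinuousLinearMap
    { toFun := scale K τ
      map_add' := fun R S => by funext i j; simp [scale, add_mul]
      map_smul' := fun c S => by funext i j; simp [scale, mul_assoc] }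

omit [NeZero N] in
theorem scaleCLM_apply (K : Chain) (τ : ℂ) (S : Phase N) : scaleCLM K τ S = scale K τ S := rfl

omit [NeZero N] in
theorem scale_unscale (K : Chain) (τ : ℂ) (S : Phase N) : scale K τ (unscale K τ S) = S := by
  funext i j
  rw [scale, unscale, mul_assoc, ← e_add]
  simp [e_zero]

omit [NeZero N] in
theorem scale_single (K : Chain) (τ : ℂ) (i j : Fin N) :
    scale K τ (Pi.single i (Pi.single j 1)) =
      e (K.expo i j * τ) • (Pi.single i (Pi.single j 1) : Phase N) := by
  funext k l
  simp only [scale, Pi.smul_apply, smul_eq_mul, Pi.single_apply]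
  by_cases hk : k = i
  · subst hk
    by_cases hl : l = j
    · subst hl; simp
    · simp [hl]
  · simp [hk]

omit [NeZero N] in
theorem pd_comp_scale (K : Chain) (τ : ℂ) {F : Phase N → ℂ} {S : Phase N}
    (hF : DifferentiableAt ℂ F S) (i j : Fin N) :
    pd (F ∘ scale K τ) (unscale K τ S) i j = e (K.expo i j * τ) * pd F S i j := by
  have h : scale K τ = scaleCLM (N := N) K τ := by funext R; rw [scaleCLM_apply]
  have hF' : DifferentiableAt ℂ F (scaleCLM K τ (unscale K τ S)) := by
    rwa [scaleCLM_apply, scale_unscale]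
  rw [pd, h, fderiv_comp _ hF' (scaleCLM K τ).differentiableAt, ContinuousLinearMap.fderiv,
    ContinuousLinearMap.comp_apply, scaleCLM_apply, scaleCLM_apply, scale_unscale, scale_single,
    map_smul, smul_eq_mul, pd]

/-- The strict triangle inequality for the exponents, which removes the brackets of two off-diagonal
coordinates in the limit. For the nonperiodic chain the smaller exponent at `(1, N)` does not spoil
it. -/
theorem Chain.rexpo_add_gt (hN : 3 ≤ N) (K : Chain) {i j k : Fin N} (hij : i ≠ j) (hki : k ≠ i) :
    K.rexpo k j < K.rexpo i j + K.rexpo k i := by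
  have hNr := N_pos (N := N)
  cases K
  · simp only [Chain.rexpo, if_neg hij, if_neg hki, ← add_div]
    gcongr
    split_ifs <;> norm_num
  · simp only [Chain.rexpo, if_neg hij, if_neg hki, ← add_div]
    gcongr
    split_ifs <;> first | (norm_num; done) | (exfalso; omega)

/-- The limit of one term of the scaled bracket: the powers of `q` cancel exactly when one of the
two coordinates is diagonal. -/
theorem tendsto_bracket_term (hN : 3 ≤ N) (K : Chain) (i j k : Fin N) :
    Tendsto (fun τ => e (K.expo i j * τ) * e (K.expo k i * τ) * e (-(K.expo k j) * τ)) imInfty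
      (𝓝 (if i = j ∨ k = i then 1 else 0)) := by
  have h : ∀ τ, e (K.expo i j * τ) * e (K.expo k i * τ) * e (-(K.expo k j) * τ) =
      e ((K.rexpo i j + K.rexpo k i - K.rexpo k j : ℝ) * τ) := fun τ => by
    simp only [K.expo_eq]
    rw [← e_add, ← e_add]; congr 1; push_cast; ring
  simp only [h]
  split_ifs with hc
  · have : K.rexpo i j + K.rexpo k i - K.rexpo k j = 0 := by
      rcases hc with rfl | rfl
      · rw [K.rexpo_self (by omega)]; ring
      · rw [K.rexpo_self (by omega)]; ring
    rw [this]
    simpa [e_zero] using tendsto_const_nhds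
  · rw [not_or] at hc
    exact tendsto_e_mul (sub_pos.2 (K.rexpo_add_gt hN hc.1 hc.2))

omit [NeZero N] in
/-- The tensor of the limiting bracket, in terms of the weights of the coordinates. -/
theorem limTensor_eq (S : Phase N) (i j k l : Fin N) : limTensor S i j k l =
    (if i = j then (N : ℂ) * ((if i = l then 1 else 0) - if i = k then 1 else 0) * S k l else 0) -
    (if k = l then (N : ℂ) * ((if k = j then 1 else 0) - if k = i then 1 else 0) * S i j
      else 0) := by
  rw [limTensor]
  by_cases h1 : i = j
  · subst h1
    by_cases h2 : k = l
    · subst h2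
      by_cases h3 : i = k <;> simp [h3]
    · simp only [if_true, if_neg h2]
      by_cases h3 : i = l
      · subst h3; by_cases h4 : i = k <;> simp [h4]
      · by_cases h4 : i = k
        · subst h4; simp [h3]
        · simp [h3, h4]
  · by_cases h2 : k = l
    · subst h2
      simp only [if_neg h1, if_true]
      by_cases h3 : k = j
      · subst h3
        by_cases h4 : k = i <;> simp [h4]
      · by_cases h4 : k = i
        · subst h4; simp [h3]
        · simp [h3, h4]
    · simp [h1, h2]

theorem tendsto_scaledBracket (hN : 3 ≤ N) (K : Chain) {F G : Phase N → ℂ} {S : Phase N}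
    (hF : DifferentiableAt ℂ F S) (hG : DifferentiableAt ℂ G S) :
    Tendsto (fun τ => scaledBracket K τ F G S) imInfty (𝓝 (limBracket F G S)) := by
  simp only [scaledBracket, limBracket, bracketOf, pd_comp_scale K _ hF, pd_comp_scale K _ hG]
  refine tendsto_finsetSum _ fun i _ => tendsto_finsetSum _ fun j _ =>
    tendsto_finsetSum _ fun k _ => tendsto_finsetSum _ fun l _ => ?_
  have t1 := tendsto_bracket_term hN K i j k
  have t2 := tendsto_bracket_term hN K k l i
  have ht := (((t1.const_mul (if i = l then S k j else 0)).sub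
    (t2.const_mul (if k = j then S i l else 0))).const_mul (N : ℂ)).const_mul
    (pd F S i j * pd G S k l)
  refine (ht.congr fun τ => ?_).trans (le_of_eq (congrArg 𝓝 ?_))
  · rw [topTensor, unscale, unscale]
    by_cases h1 : i = l
    · subst h1
      by_cases h2 : k = j
      · subst h2; simp only [if_true]; ring
      · simp only [if_true, if_neg h2]; ring
    · by_cases h2 : k = j
      · subst h2; simp only [if_true, if_neg h1]; ring
      · simp only [if_neg h1, if_neg h2]; ring
  · congr 1
    rw [limTensor_eq]
    by_cases h1 : i = j
    · subst h1
      by_cases h2 : k = l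
      · subst h2
        by_cases h3 : i = k
        · subst h3; simp
        · simp [h3, Ne.symm h3]
      · by_cases h3 : i = l
        · subst h3; simp [h2, Ne.symm h2]
        · by_cases h4 : k = i
          · subst h4; simp [h2]
          · simp [h2, h3, h4, Ne.symm h4]
    · by_cases h2 : k = l
      · subst h2
        by_cases h3 : k = j
        · subst h3; simp [h1, Ne.symm h1]
        · by_cases h4 : i = k
          · subst h4; simp [h1]
          · simp [h1, h3, h4, Ne.symm h4]
      · by_cases h3 : i = l
        · subst h3
          by_cases h4 : k = j
          · subst h4; simp [h1, h2]
          · simp [h1, h2, h4]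
        · by_cases h4 : k = j
          · subst h4; simp [h1, h2, h3]
          · simp [h1, h2, h3, h4]

end

/-! ### Derivatives along vector fields -/

section
variable {E : Type*} [NormedAddCommGroup E] [NormedSpace ℂ E]

/-- The derivative of a function along a vector field. -/
noncomputable def lieD (V : E → E) (F : E → ℂ) (S : E) : ℂ := fderiv ℂ F S (V S)

theorem contDiff_lieD {V : E → E} {F : E → ℂ} (hV : ContDiff ℂ (⊤ : ℕ∞) V)
    (hF : ContDiff ℂ (⊤ : ℕ∞) F) : ContDiff ℂ (⊤ : ℕ∞) (lieD V F) :=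
  (hF.fderiv_right le_rfl).clm_apply hV

theorem lieD_mul {V : E → E} {F G : E → ℂ} {S : E} (hF : DifferentiableAt ℂ F S)
    (hG : DifferentiableAt ℂ G S) :
    lieD V (F * G) S = lieD V F S * G S + F S * lieD V G S := by
  simp only [lieD]
  rw [fderiv_mul hF hG]
  simp only [add_apply, FunLike.coe_smul, Pi.smul_apply, smul_eq_mul]
  ring

theorem lieD_add {V : E → E} {F G : E → ℂ} {S : E} (hF : DifferentiableAt ℂ F S)
    (hG : DifferentiableAt ℂ G S) : lieD V (F + G) S = lieD V F S + lieD V G S := by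
  simp only [lieD]
  rw [fderiv_add hF hG, add_apply]

theorem lieD_sub {V : E → E} {F G : E → ℂ} {S : E} (hF : DifferentiableAt ℂ F S)
    (hG : DifferentiableAt ℂ G S) : lieD V (F - G) S = lieD V F S - lieD V G S := by
  simp only [lieD]
  rw [fderiv_sub hF hG, sub_apply]

theorem lieD_sum {ι : Type*} (s : Finset ι) {V : E → E} {F : ι → E → ℂ} {S : E}
    (hF : ∀ i ∈ s, DifferentiableAt ℂ (F i) S) :
    lieD V (∑ i ∈ s, F i) S = ∑ i ∈ s, lieD V (F i) S := by
  simp only [lieD]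
  rw [fderiv_sum hF, sum_apply]

/-- Derivatives along commuting vector fields commute. -/
theorem lieD_comm {V W : E → E} {V' W' : E →L[ℂ] E} {F : E → ℂ} {S : E}
    (hV : HasFDerivAt V V' S) (hW : HasFDerivAt W W' S) (hVW : V' (W S) = W' (V S))
    (hF : ContDiff ℂ (⊤ : ℕ∞) F) : lieD V (lieD W F) S = lieD W (lieD V F) S := by
  have h2 : DifferentiableAt ℂ (fderiv ℂ F) S :=
    ((hF.fderiv_right (m := (⊤ : ℕ∞)) le_rfl).differentiable (by simp)).differentiableAt
  have hs : IsSymmSndFDerivAt ℂ F S := by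
    refine hF.contDiffAt.isSymmSndFDerivAt ?_
    rw [minSmoothness_of_isRCLikeNormedField]
    exact WithTop.coe_le_coe.2 le_top
  have key : ∀ {U : E → E} {U' : E →L[ℂ] E}, HasFDerivAt U U' S → ∀ w,
      fderiv ℂ (lieD U F) S w = fderiv ℂ (fderiv ℂ F) S w (U S) + fderiv ℂ F S (U' w) := by
    intro U U' hU w
    have h := (h2.hasFDerivAt.clm_apply hU).fderiv
    have h' : fderiv ℂ (lieD U F) S = _ := h
    rw [h']
    simp [add_comm]
  rw [lieD, lieD, key hW, key hV, hs.eq, hVW]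

end

/-! ### The limiting Poisson algebra -/

section
variable {N : ℕ}

/-- The Hamiltonian vector field `{S_{ii}, ·}` of a diagonal coordinate: it multiplies each
coordinate by its weight. -/
noncomputable def weightCLM (i : Fin N) : Phase N →L[ℂ] Phase N :=
  LinearMap.toContinuousLinearMap
    { toFun := fun S k l => (N : ℂ) * ((if i = l then 1 else 0) - if i = k then 1 else 0) * S k l
      map_add' := fun R S => by funext k l; simp [mul_add]
      map_smul' := fun c S => by funext k l; simp [mul_left_comm] }

theorem weightCLM_apply (i : Fin N) (S : Phase N) (k l : Fin N) : weightCLM i S k l =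
    (N : ℂ) * ((if i = l then 1 else 0) - if i = k then 1 else 0) * S k l := rfl

/-- The matrix unit at `(i, j)`. -/
def unit (i j : Fin N) : Phase N := Pi.single i (Pi.single j 1)

theorem unit_apply (i j k l : Fin N) :
    (unit i j : Phase N) k l = if k = i ∧ l = j then 1 else 0 := by
  rw [unit, Pi.single_apply]
  by_cases hk : k = i
  · simp [hk, Pi.single_apply]
  · simp [hk]

theorem sum_unit (S : Phase N) : ∑ i, ∑ j, S i j • (unit i j : Phase N) = S := by
  funext k l
  simp only [Finset.sum_apply, Pi.smul_apply, unit_apply, smul_eq_mul, ite_and, mul_ite, mul_one,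
    mul_zero]
  simp

theorem clm_eq_sum {A : Type*} [AddCommGroup A] [Module ℂ A] [TopologicalSpace A]
    (φ : Phase N →L[ℂ] A) (S : Phase N) : φ S = ∑ i, ∑ j, S i j • φ (unit i j) := by
  conv_lhs => rw [← sum_unit S]
  simp only [map_sum, map_smul]

/-- The constant vector field `∂/∂S_{ii}`. -/
def unitField (i : Fin N) : Phase N → Phase N := fun _ => unit i i

theorem limTensor_eq' (S : Phase N) (i j k l : Fin N) : limTensor S i j k l =
    (if i = j then weightCLM i S k l else 0) - if k = l then weightCLM k S i j else 0 :=
  limTensor_eq S i j k l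

/-- The limiting bracket is built from the commuting derivations `∂/∂S_{ii}` and `{S_{ii}, ·}`, in
the same way as a canonical Poisson bracket. -/
theorem limBracket_eq (F G : Phase N → ℂ) (S : Phase N) :
    limBracket F G S = ∑ i, (lieD (unitField i) F S * lieD (weightCLM i) G S -
      lieD (weightCLM i) F S * lieD (unitField i) G S) := by
  have hX : ∀ (F : Phase N → ℂ) i,
      lieD (weightCLM i) F S = ∑ k, ∑ l, weightCLM i S k l * pd F S k l := by
    intro F i
    simp only [lieD, pd]
    rw [clm_eq_sum]
    rfl
  simp only [limBracket, bracketOf, limTensor_eq', hX, mul_sub,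
    Finset.sum_sub_distrib, mul_ite, mul_zero]
  congr 1
  · refine Finset.sum_congr rfl fun i _ => ?_
    rw [Finset.sum_eq_single i (fun j _ hj => by simp [Ne.symm hj]) (by simp)]
    simp only [if_true, Finset.mul_sum]
    refine Finset.sum_congr rfl fun k _ => Finset.sum_congr rfl fun l _ => ?_
    change pd F S i i * _ * _ = pd F S i i * _
    ring
  · have : ∀ i j : Fin N, ∑ k, ∑ l, (if k = l then pd F S i j * pd G S k l * weightCLM k S i j
        else 0) = ∑ k, pd F S i j * pd G S k k * weightCLM k S i j := fun i j =>
      Finset.sum_congr rfl fun k _ => by simp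
    simp only [this]
    have h2 : ∀ i : Fin N, ∑ j, ∑ k, pd F S i j * pd G S k k * weightCLM k S i j =
        ∑ k, ∑ j, pd F S i j * pd G S k k * weightCLM k S i j := fun i => Finset.sum_comm
    simp only [h2]
    rw [Finset.sum_comm]
    refine Finset.sum_congr rfl fun k _ => ?_
    rw [Finset.sum_mul]
    refine Finset.sum_congr rfl fun i _ => ?_
    rw [Finset.sum_mul]
    refine Finset.sum_congr rfl fun j _ => ?_
    change _ = _ * pd G S k k
    ring

theorem limBracket_fun (F G : Phase N → ℂ) :
    limBracket F G = ∑ i, (lieD (unitField i) F * lieD (weightCLM i) G -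
      lieD (weightCLM i) F * lieD (unitField i) G) := by
  funext S
  rw [limBracket_eq]
  simp

theorem contDiff_lieD_unitField (i : Fin N) {F : Phase N → ℂ} (hF : ContDiff ℂ (⊤ : ℕ∞) F) :
    ContDiff ℂ (⊤ : ℕ∞) (lieD (unitField i) F) := contDiff_lieD contDiff_const hF

theorem contDiff_lieD_weight (i : Fin N) {F : Phase N → ℂ} (hF : ContDiff ℂ (⊤ : ℕ∞) F) :
    ContDiff ℂ (⊤ : ℕ∞) (lieD (weightCLM i) F) := contDiff_lieD (weightCLM i).contDiff hF

theorem differentiableAt_of_contDiff {F : Phase N → ℂ} (hF : ContDiff ℂ (⊤ : ℕ∞) F)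
    (S : Phase N) : DifferentiableAt ℂ F S := (hF.differentiable (by simp)).differentiableAt

theorem weightCLM_unit (i j : Fin N) : weightCLM i (unit j j) = 0 := by
  funext k l
  rw [weightCLM_apply, unit_apply]
  by_cases h : k = j ∧ l = j
  · rw [h.1, h.2]; simp
  · simp [h]

theorem lieD_unitField_comm (i j : Fin N) {F : Phase N → ℂ} (hF : ContDiff ℂ (⊤ : ℕ∞) F)
    (S : Phase N) :
    lieD (unitField i) (lieD (unitField j) F) S = lieD (unitField j) (lieD (unitField i) F) S :=
  lieD_comm (hasFDerivAt_const _ _) (hasFDerivAt_const _ _) rfl hF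

theorem lieD_weight_comm (i j : Fin N) {F : Phase N → ℂ} (hF : ContDiff ℂ (⊤ : ℕ∞) F)
    (S : Phase N) :
    lieD (weightCLM i) (lieD (weightCLM j) F) S = lieD (weightCLM j) (lieD (weightCLM i) F) S := by
  refine lieD_comm (weightCLM i).hasFDerivAt (weightCLM j).hasFDerivAt ?_ hF
  funext k l
  simp only [weightCLM_apply]
  ring

theorem lieD_weight_unitField (i j : Fin N) {F : Phase N → ℂ} (hF : ContDiff ℂ (⊤ : ℕ∞) F)
    (S : Phase N) :
    lieD (weightCLM i) (lieD (unitField j) F) S = lieD (unitField j) (lieD (weightCLM i) F) S :=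
  lieD_comm (weightCLM i).hasFDerivAt (hasFDerivAt_const _ _)
    (by simp [unitField, weightCLM_unit]) hF

/-- A derivative of the bracket, expanded by the Leibniz rule. -/
theorem lieD_limBracket (V : Phase N → Phase N) {F G : Phase N → ℂ}
    (hF : ContDiff ℂ (⊤ : ℕ∞) F) (hG : ContDiff ℂ (⊤ : ℕ∞) G) (S : Phase N) :
    lieD V (limBracket F G) S = ∑ i,
      (lieD V (lieD (unitField i) F) S * lieD (weightCLM i) G S
        + lieD (unitField i) F S * lieD V (lieD (weightCLM i) G) S
        - (lieD V (lieD (weightCLM i) F) S * lieD (unitField i) G S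
          + lieD (weightCLM i) F S * lieD V (lieD (unitField i) G) S)) := by
  have d1 := fun i => differentiableAt_of_contDiff (contDiff_lieD_unitField i hF) S
  have d2 := fun i => differentiableAt_of_contDiff (contDiff_lieD_weight i hF) S
  have d3 := fun i => differentiableAt_of_contDiff (contDiff_lieD_unitField i hG) S
  have d4 := fun i => differentiableAt_of_contDiff (contDiff_lieD_weight i hG) S
  rw [limBracket_fun, lieD_sum _ fun i _ => ((d1 i).mul (d4 i)).sub ((d2 i).mul (d3 i))]
  refine Finset.sum_congr rfl fun i _ => ?_
  rw [lieD_sub ((d1 i).mul (d4 i)) ((d2 i).mul (d3 i)), lieD_mul (d1 i) (d4 i),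
    lieD_mul (d2 i) (d3 i)]

theorem sum_sum_eq_zero_of_antisymm {ι : Type*} [Fintype ι] (Q : ι → ι → ℂ)
    (h : ∀ i j, Q i j + Q j i = 0) : ∑ i, ∑ j, Q i j = 0 := by
  have h1 : ∑ i, ∑ j, Q i j + ∑ i, ∑ j, Q j i = 0 := by
    simp only [← Finset.sum_add_distrib, h, Finset.sum_const_zero]
  have h2 : ∑ i, ∑ j, Q j i = ∑ i, ∑ j, Q i j := Finset.sum_comm
  rw [h2] at h1
  exact self_eq_neg.1 (eq_neg_of_add_eq_zero_left h1)

/-- The Jacobi identity, term by term from the commutativity of the derivations in `limBracket_eq`.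
-/
theorem limBracket_jacobi {F G K : Phase N → ℂ} (hF : ContDiff ℂ (⊤ : ℕ∞) F)
    (hG : ContDiff ℂ (⊤ : ℕ∞) G) (hK : ContDiff ℂ (⊤ : ℕ∞) K) :
    limBracket F (limBracket G K) + limBracket G (limBracket K F) +
      limBracket K (limBracket F G) = 0 := by
  funext S
  simp only [Pi.add_apply, Pi.zero_apply, limBracket_eq, lieD_limBracket _ hG hK,
    lieD_limBracket _ hK hF, lieD_limBracket _ hF hG, Finset.mul_sum, ← Finset.sum_sub_distrib,
    ← Finset.sum_add_distrib]
  refine sum_sum_eq_zero_of_antisymm _ fun i j => ?_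
  simp only [lieD_weight_unitField _ _ hF, lieD_weight_unitField _ _ hG,
    lieD_weight_unitField _ _ hK]
  rw [lieD_unitField_comm j i hF, lieD_unitField_comm j i hG, lieD_unitField_comm j i hK,
    lieD_weight_comm j i hF, lieD_weight_comm j i hG, lieD_weight_comm j i hK]
  ring

theorem isPoisson_limBracket : IsPoisson (limBracket (N := N)) where
  smooth F G hF hG := by
    rw [limBracket_fun]
    have : ContDiff ℂ (⊤ : ℕ∞) fun S =>
        ∑ i, (lieD (unitField i) F S * lieD (weightCLM i) G S -
          lieD (weightCLM i) F S * lieD (unitField i) G S) :=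
      ContDiff.sum fun i _ => ((contDiff_lieD_unitField i hF).mul (contDiff_lieD_weight i hG)).sub
        ((contDiff_lieD_weight i hF).mul (contDiff_lieD_unitField i hG))
    convert this using 1
    funext S
    simp
  add F G K hF hG _ := by
    funext S
    simp only [Pi.add_apply, limBracket_eq, ← Finset.sum_add_distrib]
    refine Finset.sum_congr rfl fun i _ => ?_
    rw [lieD_add (differentiableAt_of_contDiff hF S) (differentiableAt_of_contDiff hG S),
      lieD_add (differentiableAt_of_contDiff hF S) (differentiableAt_of_contDiff hG S)]
    ring
  smul a F G hF _ := by
    have h : ∀ (V : Phase N → Phase N) S, lieD V (a • F) S = a * lieD V F S := fun V S => by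
      simp only [lieD]
      rw [fderiv_const_smul (differentiableAt_of_contDiff hF S)]
      simp
    funext S
    simp only [Pi.smul_apply, smul_eq_mul, limBracket_eq, h, Finset.mul_sum]
    exact Finset.sum_congr rfl fun i _ => by ring
  skew F G _ _ := by
    funext S
    simp only [Pi.neg_apply, limBracket_eq, ← Finset.sum_neg_distrib]
    exact Finset.sum_congr rfl fun i _ => by ring
  leibniz F G K _ hG hK := by
    funext S
    simp only [Pi.add_apply, Pi.mul_apply, limBracket_eq, Finset.mul_sum, Finset.sum_mul,
      ← Finset.sum_add_distrib]
    refine Finset.sum_congr rfl fun i _ => ?_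
    rw [lieD_mul (differentiableAt_of_contDiff hG S) (differentiableAt_of_contDiff hK S),
      lieD_mul (differentiableAt_of_contDiff hG S) (differentiableAt_of_contDiff hK S)]
    ring
  jacobi F G K hF hG hK := limBracket_jacobi hF hG hK

/-! ### Brackets with coordinates, and Casimir functions -/

/-- The coordinate function as a continuous linear functional. -/
noncomputable def coordCLM (i j : Fin N) : Phase N →L[ℂ] ℂ :=
  (ContinuousLinearMap.proj (R := ℂ) (φ := fun _ : Fin N => ℂ) j).comp
    (ContinuousLinearMap.proj (R := ℂ) (φ := fun _ : Fin N => Fin N → ℂ) i)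

theorem hasFDerivAt_coord (i j : Fin N) (S : Phase N) :
    HasFDerivAt (fun R : Phase N => R i j) (coordCLM i j) S := (coordCLM i j).hasFDerivAt

theorem coordCLM_apply (i j : Fin N) (S : Phase N) : coordCLM i j S = S i j := rfl

theorem lieD_coord (V : Phase N → Phase N) (i j : Fin N) (S : Phase N) :
    lieD V (fun R => R i j) S = V S i j := by
  rw [lieD, (hasFDerivAt_coord i j S).fderiv, coordCLM_apply]

theorem sum_weightCLM (S : Phase N) : ∑ i, weightCLM i S = 0 := by
  funext k l
  rw [Finset.sum_apply, Finset.sum_apply]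
  simp only [weightCLM_apply, ← Finset.sum_mul, ← Finset.mul_sum, Finset.sum_sub_distrib,
    Finset.sum_ite_eq', Finset.mem_univ, if_true, sub_self, mul_zero, zero_mul, Pi.zero_apply]

theorem sum_lieD_weight (G : Phase N → ℂ) (S : Phase N) : ∑ i, lieD (weightCLM i) G S = 0 := by
  simp only [lieD]
  rw [← map_sum, sum_weightCLM, map_zero]

/-- The trace is a Casimir function because the weights add up to zero. -/
theorem limBracket_trace (G : Phase N → ℂ) (S : Phase N) :
    limBracket (fun R => ∑ i, R i i) G S = 0 := by
  have h : ∀ V : Phase N → Phase N, lieD V (fun R => ∑ i, R i i) S = ∑ i, V S i i := by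
    intro V
    have := lieD_sum Finset.univ (V := V) (F := fun (i : Fin N) (R : Phase N) => R i i) (S := S)
      fun i _ => (hasFDerivAt_coord i i S).differentiableAt
    simp only [lieD_coord] at this
    rw [← this]
    congr 1
    funext R
    simp
  rw [limBracket_eq]
  have h1 : ∀ i : Fin N, ∑ k, (unit i i : Phase N) k k = 1 := fun i => by
    simp [unit_apply]
  have h2 : ∀ i : Fin N, ∑ k, weightCLM i S k k = 0 := fun i => by
    simp [weightCLM_apply]
  simp only [h, unitField, h1, h2, one_mul, zero_mul, sub_zero]
  exact sum_lieD_weight G S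

/-- Cyclic products are Casimir functions: they do not contain diagonal coordinates, and the
weights of their factors cancel around the cycle. -/
theorem limBracket_cycle (G : Phase N → ℂ) (S : Phase N) {k : ℕ} (hk : 2 ≤ k)
    {σ : Fin k → Fin N} (hσ : Function.Injective σ) :
    limBracket (fun R => ∏ a, R (σ a) (σ (finRotate k a))) G S = 0 := by
  have hne : ∀ a, σ a ≠ σ (finRotate k a) := by
    intro a h
    obtain ⟨n, rfl⟩ : ∃ n, k = n + 1 := ⟨k - 1, by omega⟩
    have h1 := hσ h
    rw [finRotate_apply] at h1
    have h2 := congrArg Fin.val h1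
    rw [Fin.val_add_one] at h2
    split_ifs at h2 with h3
    · subst h3; simp at h2; omega
    · omega
  have h : ∀ V : Phase N → Phase N, lieD V (fun R => ∏ a, R (σ a) (σ (finRotate k a))) S =
      ∑ a, (∏ b ∈ Finset.univ.erase a, S (σ b) (σ (finRotate k b))) *
        V S (σ a) (σ (finRotate k a)) := by
    intro V
    have hd := HasFDerivAt.finsetProd (u := Finset.univ) (x := S)
      (g := fun (a : Fin k) (R : Phase N) => R (σ a) (σ (finRotate k a)))
      (g' := fun a => coordCLM (σ a) (σ (finRotate k a))) fun a _ => hasFDerivAt_coord _ _ S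
    rw [lieD, hd.fderiv]
    simp [coordCLM_apply]
  have hD : ∀ i, lieD (unitField i) (fun R => ∏ a, R (σ a) (σ (finRotate k a))) S = 0 := by
    intro i
    rw [h]
    refine Finset.sum_eq_zero fun a _ => ?_
    rw [unitField, unit_apply, if_neg, mul_zero]
    rintro ⟨h1, h2⟩
    exact hne a (h1.trans h2.symm)
  have hX : ∀ i, lieD (weightCLM i) (fun R => ∏ a, R (σ a) (σ (finRotate k a))) S = 0 := by
    intro i
    rw [h]
    have : ∀ a, (∏ b ∈ Finset.univ.erase a, S (σ b) (σ (finRotate k b))) *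
        weightCLM i S (σ a) (σ (finRotate k a)) =
        ((N : ℂ) * ∏ b, S (σ b) (σ (finRotate k b))) *
          ((if i = σ (finRotate k a) then 1 else 0) - if i = σ a then 1 else 0) := by
      intro a
      rw [← Finset.prod_erase_mul _ _ (Finset.mem_univ a), weightCLM_apply]
      ring
    simp only [this, ← Finset.mul_sum, Finset.sum_sub_distrib]
    rw [Equiv.sum_comp (finRotate k) fun a => if i = σ a then (1 : ℂ) else 0, sub_self, mul_zero]
  rw [limBracket_eq]
  exact Finset.sum_eq_zero fun i _ => by rw [hD, hX]; ring

end

section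
variable {N : ℕ} [NeZero N]

/-! ### The diagonal parts of the limiting Lax matrices -/

/-- The circulant coefficients of the diagonal of the first limiting Lax matrix. -/
noncomputable def lCoef (a : Fin N) : ℂ :=
  2 * Real.pi * I / N * ∑ k ∈ Finset.Ico 1 N, χ k a * (e (-((k : ℂ) / N)) - 1)⁻¹

/-- The circulant coefficients of the diagonal of the second limiting Lax matrix. -/
noncomputable def mCoef (a : Fin N) : ℂ :=
  -((Real.pi : ℂ) ^ 2 / N) * ∑ k ∈ Finset.Ico 1 N, χ k a * (sin (Real.pi * (k / N)) ^ 2)⁻¹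

/-- The diagonal entries of the first limiting Lax matrix. -/
noncomputable def lDiag (S : Phase N) (i : Fin N) : ℂ := ∑ k, lCoef (i - k) * S k k

/-- The diagonal entries of the second limiting Lax matrix. -/
noncomputable def mDiag (S : Phase N) (i : Fin N) : ℂ := ∑ k, mCoef (i - k) * S k k

/-- The interaction term of the limiting Hamiltonian at the site `i`. -/
noncomputable def bond (K : Chain) (S : Phase N) (i : Fin N) : ℂ :=
  4 * (Real.pi : ℂ) ^ 2 * ((if (i : ℕ) = 0 then K.wrap else 1) * (S i (i + 1) * S i (i - 1)))

theorem sin_frac_sq_ne {k : ℕ} (hk : k ∈ Finset.Ico 1 N) :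
    sin (Real.pi * ((k : ℂ) / N)) ^ 2 ≠ 0 := by
  rw [Finset.mem_Ico] at hk
  have h1 := e_frac_ne_one (N := N) (k := k) (by omega) hk.2
  have h0 := e_ne_zero ((k : ℂ) / N)
  rw [sin_sq_eq_e, e_neg]
  intro h
  apply h1
  have : (e ((k : ℂ) / N) - 1) ^ 2 = 0 := by
    field_simp at h
    linear_combination -h
  exact sub_eq_zero.1 (pow_eq_zero_iff two_ne_zero |>.1 this)

/-- Up to the factor `-2πi`, the coefficients of the first Lax matrix are a discrete primitive of a
delta function with its mean value removed. -/
theorem lCoef_sub_succ (hN : 3 ≤ N) (a : Fin N) : lCoef a - lCoef (a + 1) =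
    2 * Real.pi * I * ((if a + 1 = 0 then 1 else 0) - 1 / N) := by
  have hNc := N_ne_zero (N := N)
  have h : ∀ k ∈ Finset.Ico 1 N, χ k a * (e (-((k : ℂ) / N)) - 1)⁻¹ -
      χ k (a + 1) * (e (-((k : ℂ) / N)) - 1)⁻¹ = χ k (a + 1) := by
    intro k hk
    rw [Finset.mem_Ico] at hk
    have h1 := e_frac_ne_one (N := N) (k := k) (by omega) hk.2
    have h0 := e_ne_zero ((k : ℂ) / N)
    rw [χ_add, χ_one (by omega), e_neg]
    have h2 : (e ((k : ℂ) / N))⁻¹ - 1 ≠ 0 := sub_ne_zero.2 (inv_ne_one.2 h1)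
    field_simp
  rw [lCoef, lCoef, ← mul_sub, ← Finset.sum_sub_distrib, Finset.sum_congr rfl h, sum_Ico_χ]
  split_ifs <;> field_simp
  ring

/-- Up to the factor `2πi`, the coefficients of the second Lax matrix are a discrete primitive of
those of the first. -/
theorem mCoef_succ_sub (hN : 3 ≤ N) (a : Fin N) :
    mCoef (a + 1) - mCoef a = 2 * Real.pi * I * lCoef a := by
  have hNc := N_ne_zero (N := N)
  have h : ∀ k ∈ Finset.Ico 1 N, χ k (a + 1) * (sin (Real.pi * (k / N)) ^ 2)⁻¹ -
      χ k a * (sin (Real.pi * (k / N)) ^ 2)⁻¹ = 4 * (χ k a * (e (-((k : ℂ) / N)) - 1)⁻¹) := by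
    intro k hk
    have hs := sin_frac_sq_ne hk
    rw [Finset.mem_Ico] at hk
    have h1 := e_frac_ne_one (N := N) (k := k) (by omega) hk.2
    have h0 := e_ne_zero ((k : ℂ) / N)
    have hs' : sin (Real.pi * (k / N)) ^ 2 =
        (e ((k : ℂ) / N) - 1) * ((e ((k : ℂ) / N))⁻¹ - 1) / 4 := by
      rw [sin_sq_eq_e, e_neg]; field_simp; ring
    rw [χ_add, χ_one (by omega), hs', e_neg]
    have h2 : (e ((k : ℂ) / N))⁻¹ - 1 ≠ 0 := sub_ne_zero.2 (inv_ne_one.2 h1)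
    have h3 : e ((k : ℂ) / N) - 1 ≠ 0 := sub_ne_zero.2 h1
    generalize e ((k : ℂ) / N) = x at *
    field_simp
  rw [mCoef, mCoef, ← mul_sub, ← Finset.sum_sub_distrib, Finset.sum_congr rfl h, ← Finset.mul_sum,
    lCoef]
  generalize ∑ k ∈ Finset.Ico 1 N, χ k a * (e (-((k : ℂ) / N)) - 1)⁻¹ = X
  field_simp
  linear_combination (-4 * X) * I_sq

theorem mCoef_neg (a : Fin N) : mCoef (-a) = mCoef a := by
  rw [mCoef, mCoef]
  congr 1
  rw [← sum_Ico_reflect]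
  refine Finset.sum_congr rfl fun k hk => ?_
  rw [Finset.mem_Ico] at hk
  have hN := N_ne_zero (N := N)
  rw [χ_reflect hk.2.le, χ_neg, inv_inv, Nat.cast_sub hk.2.le]
  congr 2
  rw [sub_div, div_self hN, mul_sub, mul_one, sin_pi_sub]

theorem sum_shift_sub {A : Type*} [AddCommMonoid A] (f : Fin N → A) (i : Fin N) :
    ∑ k, f (k - i) = ∑ k, f k :=
  Fintype.sum_equiv (Equiv.subRight i) _ _ fun _ => rfl

theorem sum_shift_add {A : Type*} [AddCommMonoid A] (f : Fin N → A) (i : Fin N) :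
    ∑ k, f (k + i) = ∑ k, f k :=
  Fintype.sum_equiv (Equiv.addRight i) _ _ fun _ => rfl

theorem sum_lCoef : ∑ a : Fin N, lCoef a = 0 := by
  simp only [lCoef, ← Finset.mul_sum]
  rw [Finset.sum_comm, Finset.sum_eq_zero, mul_zero]
  intro k hk
  rw [Finset.mem_Ico] at hk
  rw [← Finset.sum_mul, sum_χ (by omega) hk.2, zero_mul]

theorem sum_mCoef : ∑ a : Fin N, mCoef a = 0 := by
  simp only [mCoef, ← Finset.mul_sum]
  rw [Finset.sum_comm, Finset.sum_eq_zero, mul_zero]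
  intro k hk
  rw [Finset.mem_Ico] at hk
  rw [← Finset.sum_mul, sum_χ (by omega) hk.2, zero_mul]

theorem sum_lDiag (S : Phase N) : ∑ i, lDiag S i = 0 := by
  simp only [lDiag]
  rw [Finset.sum_comm]
  refine Finset.sum_eq_zero fun k _ => ?_
  rw [← Finset.sum_mul, sum_shift_sub, sum_lCoef, zero_mul]

theorem sum_mDiag (S : Phase N) : ∑ i, mDiag S i = 0 := by
  simp only [mDiag]
  rw [Finset.sum_comm]
  refine Finset.sum_eq_zero fun k _ => ?_
  rw [← Finset.sum_mul, sum_shift_sub, sum_mCoef, zero_mul]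

theorem lDiag_sub_succ (hN : 3 ≤ N) (S : Phase N) (i : Fin N) : lDiag S i - lDiag S (i + 1) =
    2 * Real.pi * I * (S (i + 1) (i + 1) - (∑ k, S k k) / N) := by
  rw [lDiag, lDiag, ← Finset.sum_sub_distrib]
  have h : ∀ k : Fin N, lCoef (i - k) * S k k - lCoef (i + 1 - k) * S k k =
      (if i + 1 = k then 2 * Real.pi * I * S k k else 0) - 2 * Real.pi * I / N * S k k := by
    intro k
    have h1 := lCoef_sub_succ hN (i - k)
    have h2 : i - k + 1 = i + 1 - k := by abel
    rw [h2] at h1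
    simp only [sub_eq_zero (a := i + 1)] at h1
    rw [← sub_mul, h1]
    split_ifs <;> ring
  simp only [h, Finset.sum_sub_distrib, ← Finset.mul_sum, Finset.sum_ite_eq, Finset.mem_univ,
    if_true]
  ring

theorem mDiag_succ_sub (hN : 3 ≤ N) (S : Phase N) (i : Fin N) :
    mDiag S (i + 1) - mDiag S i = 2 * Real.pi * I * lDiag S i := by
  rw [mDiag, mDiag, lDiag, ← Finset.sum_sub_distrib, Finset.mul_sum]
  refine Finset.sum_congr rfl fun k _ => ?_
  have h1 := mCoef_succ_sub hN (i - k)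
  have h2 : i - k + 1 = i + 1 - k := by abel
  rw [h2] at h1
  rw [← sub_mul, h1]
  ring

/-! ### The limiting Lax matrices and Hamiltonian -/

theorem limL_apply (K : Chain) (S : Phase N) (z : ℂ) (i j : Fin N) : limL K S z i j =
    (if j = i then lDiag S i else 0)
    + (if j = i + 1 then 2 * Real.pi * I * S (i + 1) (i + 1 + 1) * e (-(z / N)) else 0)
    - (if j = i - 1 then
        (if (i : ℕ) = 0 then K.wrap else 1) * (2 * Real.pi * I * S i (i - 1) * e (z / N))
      else 0) := by
  have h : lDiag S i = 2 * Real.pi * I / N * ∑ m : Fin N, ∑ k ∈ Finset.Ico 1 N,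
        S m m * e (k * (((i : ℕ) : ℂ) - ((m : ℕ) : ℂ)) / N) * (e (-((k : ℂ) / N)) - 1)⁻¹ := by
    rw [lDiag, Finset.mul_sum]
    refine Finset.sum_congr rfl fun m _ => ?_
    rw [lCoef, mul_assoc, Finset.sum_mul]
    congr 1
    refine Finset.sum_congr rfl fun k _ => ?_
    rw [χ_sub_eq]
    ring
  rw [limL, Matrix.of_apply, ← h, two_eq, ← add_assoc]

theorem limM_apply (S : Phase N) (z : ℂ) (i j : Fin N) : limM S z i j =
    (if j = i then mDiag S i else 0)
    + (if j = i + 1 then 4 * (Real.pi : ℂ) ^ 2 * S (i + 1) (i + 1 + 1) * e (-(z / N)) else 0) := by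
  have h : mDiag S i = -((Real.pi : ℂ) ^ 2 / N) * ∑ m ∈ Finset.Ico 1 N, ∑ k : Fin N,
        (sin (Real.pi * (m / N)) ^ 2)⁻¹ * e (m * (((i : ℕ) : ℂ) - ((k : ℕ) : ℂ)) / N) * S k k := by
    rw [mDiag, Finset.sum_comm, Finset.mul_sum]
    refine Finset.sum_congr rfl fun m _ => ?_
    rw [mCoef, mul_assoc, Finset.sum_mul]
    congr 1
    refine Finset.sum_congr rfl fun k _ => ?_
    rw [χ_sub_eq]
    ring
  rw [limM, Matrix.of_apply, ← h, two_eq, ← add_assoc]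

theorem limH_eq_mDiag (K : Chain) (S : Phase N) :
    limH K S = 1 / 2 * ∑ i, S i i * mDiag S i + ∑ i, bond K S i := by
  rw [limH, Finset.sum_comm]
  simp only [bond, ← Finset.mul_sum, mDiag, mCoef, one_sub_cos]
  congr 1
  simp only [Finset.mul_sum, Finset.sum_mul]
  refine Finset.sum_congr rfl fun n _ => Finset.sum_congr rfl fun m _ =>
    Finset.sum_congr rfl fun k _ => ?_
  rw [χ_sub_eq, mul_inv]
  ring

/-- Summation by parts turns the quadratic form of the Hamiltonian into a sum of squares. -/
theorem limH_eq_lDiag (hN : 3 ≤ N) (K : Chain) (S : Phase N) :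
    limH K S = 1 / 2 * ∑ i, lDiag S i ^ 2 + ∑ i, bond K S i := by
  have hpi : (2 * Real.pi * I : ℂ) ≠ 0 := two_pi_I_ne_zero
  rw [limH_eq_mDiag]
  congr 2
  have h1 : 2 * Real.pi * I * ∑ i, S i i * mDiag S i =
      ∑ i, (lDiag S i - lDiag S (i + 1)) * mDiag S (i + 1) := by
    simp only [lDiag_sub_succ hN]
    rw [sum_shift_add (fun i => 2 * Real.pi * I * (S i i - (∑ k, S k k) / N) * mDiag S i) 1]
    simp only [mul_sub, sub_mul, Finset.sum_sub_distrib, ← Finset.mul_sum, sum_mDiag, mul_zero,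
      sub_zero, mul_assoc]
  have h2 : 2 * Real.pi * I * ∑ i, lDiag S i ^ 2 =
      ∑ i, lDiag S i * (mDiag S (i + 1) - mDiag S i) := by
    simp only [mDiag_succ_sub hN, Finset.mul_sum]
    exact Finset.sum_congr rfl fun i _ => by ring
  have h3 : ∑ i, lDiag S (i + 1) * mDiag S (i + 1) = ∑ i, lDiag S i * mDiag S i :=
    sum_shift_add (fun i => lDiag S i * mDiag S i) 1
  apply mul_left_cancel₀ hpi
  rw [h1, h2]
  simp only [sub_mul, mul_sub, Finset.sum_sub_distrib, h3]

/-- The differential of the limiting Hamiltonian: its derivatives in the diagonal coordinates are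
the diagonal entries of the second Lax matrix. -/
theorem lieD_limH (K : Chain) (V : Phase N → Phase N) (S : Phase N) :
    lieD V (limH K) S = ∑ i, V S i i * mDiag S i + ∑ i : Fin N, 4 * (Real.pi : ℂ) ^ 2 *
      ((if (i : ℕ) = 0 then K.wrap else 1) *
        (V S i (i + 1) * S i (i - 1) + S i (i + 1) * V S i (i - 1))) := by
  have hc := fun i j => hasFDerivAt_coord (N := N) i j S
  have hm : ∀ i, HasFDerivAt (fun R : Phase N => mDiag R i)
      (∑ k, mCoef (i - k) • coordCLM k k) S := fun i =>
    HasFDerivAt.fun_sum fun k _ => (hc k k).const_mul _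
  have hd := ((HasFDerivAt.fun_sum fun i (_ : i ∈ Finset.univ) =>
    (hc i i).mul (hm i)).const_mul (1 / 2 : ℂ)).add
    (HasFDerivAt.fun_sum fun i (_ : i ∈ Finset.univ) =>
      (((hc i (i + 1)).mul (hc i (i - 1))).const_mul
        (if (i : ℕ) = 0 then K.wrap else 1)).const_mul (4 * (Real.pi : ℂ) ^ 2))
  have hd' := hd.congr_of_eventuallyEq (f₁ := limH K)
    (Eventually.of_forall fun R => limH_eq_mDiag K R)
  rw [lieD, hd'.fderiv]
  have hsym : ∑ i, S i i * mDiag (V S) i = ∑ i, V S i i * mDiag S i := by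
    simp only [mDiag, Finset.mul_sum]
    rw [Finset.sum_comm]
    refine Finset.sum_congr rfl fun k _ => Finset.sum_congr rfl fun i _ => ?_
    rw [← mCoef_neg, neg_sub]
    ring
  simp only [add_apply, FunLike.coe_smul, Pi.smul_apply, sum_apply,
    smul_eq_mul, coordCLM_apply, Finset.sum_add_distrib]
  have h2 : ∀ i, ∑ k, mCoef (i - k) * V S k k = mDiag (V S) i := fun i => rfl
  simp only [h2, hsym]
  congr 1
  · simp only [mul_comm (mDiag S _)]
    ring
  · refine Finset.sum_congr rfl fun i _ => ?_
    ring

/-- The Hamiltonian vector field of `F`. -/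
noncomputable def ham (F : Phase N → ℂ) (S : Phase N) : Phase N :=
  ∑ i, (lieD (unitField i) F S • weightCLM i S - lieD (weightCLM i) F S • (unit i i : Phase N))

omit [NeZero N] in
theorem limBracket_eq_ham (F G : Phase N → ℂ) (S : Phase N) :
    limBracket F G S = lieD (ham F) G S := by
  rw [limBracket_eq, lieD, ham, map_sum]
  refine Finset.sum_congr rfl fun i _ => ?_
  rw [map_sub, map_smul, map_smul]
  rfl

omit [NeZero N] in
theorem limBracket_coord (F : Phase N → ℂ) (i j : Fin N) (S : Phase N) :
    limBracket F (coord i j) S = ham F S i j := by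
  rw [limBracket_eq_ham]
  exact lieD_coord _ i j S

theorem add_one_ne (hN : 3 ≤ N) (i : Fin N) : i + 1 ≠ i := by
  simpa using one_ne_zero' hN

theorem sub_one_ne (hN : 3 ≤ N) (i : Fin N) : i - 1 ≠ i := by
  simpa using one_ne_zero' hN

theorem add_one_ne_sub_one (hN : 3 ≤ N) (i : Fin N) : i + 1 ≠ i - 1 := by
  rw [sub_eq_add_neg]
  simpa using one_ne_neg_one hN

omit [NeZero N] in
theorem ham_apply (F : Phase N → ℂ) (S : Phase N) (i j : Fin N) : ham F S i j =
    N * (lieD (unitField j) F S - lieD (unitField i) F S) * S i j -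
      if i = j then lieD (weightCLM i) F S else 0 := by
  rw [ham, Finset.sum_apply, Finset.sum_apply]
  simp only [Pi.sub_apply, Pi.smul_apply, smul_eq_mul, weightCLM_apply, unit_apply,
    Finset.sum_sub_distrib]
  have h1 : ∀ k : Fin N, lieD (unitField k) F S *
      ((N : ℂ) * ((if k = j then 1 else 0) - if k = i then 1 else 0) * S i j) =
      (if k = j then N * lieD (unitField k) F S * S i j else 0) -
        if k = i then N * lieD (unitField k) F S * S i j else 0 := by
    intro k
    split_ifs <;> ring
  have h2 : ∀ k : Fin N, (lieD (weightCLM k) F S * if i = k ∧ j = k then 1 else 0) =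
      if k = i then (if i = j then lieD (weightCLM k) F S else 0) else 0 := by
    intro k
    by_cases hk : k = i
    · subst hk
      by_cases hj : k = j
      · simp [hj]
      · simp [hj, Ne.symm hj]
    · simp [hk, Ne.symm hk]
  simp only [h1, h2, Finset.sum_sub_distrib, Finset.sum_ite_eq', Finset.mem_univ, if_true]
  ring

/-- The equations of motion of the limiting system. -/
theorem ham_limH (hN : 3 ≤ N) (K : Chain) (S : Phase N) (i j : Fin N) : ham (limH K) S i j =
    N * (mDiag S j - mDiag S i) * S i j -
      if i = j then N * (bond K S (i - 1) + bond K S (i + 1) - 2 * bond K S i) else 0 := by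
  have h1 : ∀ i, lieD (unitField i) (limH K) S = mDiag S i := by
    intro i
    rw [lieD_limH]
    have a1 : ∀ k : Fin N, ¬ (k = i ∧ k + 1 = i) := by
      rintro k ⟨rfl, h⟩; exact add_one_ne hN k h
    have a2 : ∀ k : Fin N, ¬ (k = i ∧ k - 1 = i) := by
      rintro k ⟨rfl, h⟩; exact sub_one_ne hN k h
    simp [unitField, unit_apply, a1, a2]
  have h2 : lieD (weightCLM i) (limH K) S =
      N * (bond K S (i - 1) + bond K S (i + 1) - 2 * bond K S i) := by
    rw [lieD_limH]
    have a0 : ∀ k : Fin N, 4 * (Real.pi : ℂ) ^ 2 * ((if (k : ℕ) = 0 then K.wrap else 1) *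
        (weightCLM i S k (k + 1) * S k (k - 1) + S k (k + 1) * weightCLM i S k (k - 1))) =
        N * ((if k = i - 1 then bond K S k else 0) + (if k = i + 1 then bond K S k else 0) -
          2 * if k = i then bond K S k else 0) := by
      intro k
      have b1 : i = k + 1 ↔ k = i - 1 := by rw [eq_comm, eq_sub_iff_add_eq]
      have b2 : i = k - 1 ↔ k = i + 1 := by rw [eq_sub_iff_add_eq, eq_comm]
      simp only [weightCLM_apply, b1, b2, eq_comm (a := i) (b := k), bond]
      split_ifs <;> ring
    have a1 : ∀ k : Fin N, weightCLM i S k k = 0 := fun k => by simp [weightCLM_apply]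
    simp only [a0, a1, zero_mul, Finset.sum_const_zero, zero_add, ← Finset.mul_sum,
      Finset.sum_sub_distrib, Finset.sum_add_distrib, Finset.sum_ite_eq', Finset.mem_univ, if_true]
  rw [ham_apply, h1, h1, h2]

/-! ### The Lax equation of the limiting system -/

theorem limL_mul (K : Chain) (S : Phase N) (z : ℂ) (Q : Matrix (Fin N) (Fin N) ℂ) (i j : Fin N) :
    (limL K S z * Q) i j = lDiag S i * Q i j +
      2 * Real.pi * I * S (i + 1) (i + 1 + 1) * e (-(z / N)) * Q (i + 1) j -
      (if (i : ℕ) = 0 then K.wrap else 1) * (2 * Real.pi * I * S i (i - 1) * e (z / N)) *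
        Q (i - 1) j := by
  rw [Matrix.mul_apply]
  simp only [limL_apply, sub_mul, add_mul, Finset.sum_sub_distrib, Finset.sum_add_distrib, ite_mul,
    zero_mul, Finset.sum_ite_eq', Finset.mem_univ, if_true]

theorem limM_mul (S : Phase N) (z : ℂ) (Q : Matrix (Fin N) (Fin N) ℂ) (i j : Fin N) :
    (limM S z * Q) i j = mDiag S i * Q i j +
      4 * (Real.pi : ℂ) ^ 2 * S (i + 1) (i + 1 + 1) * e (-(z / N)) * Q (i + 1) j := by
  rw [Matrix.mul_apply]
  simp only [limM_apply, add_mul, Finset.sum_add_distrib, ite_mul,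
    zero_mul, Finset.sum_ite_eq', Finset.mem_univ, if_true]

theorem e_mul_neg (a : ℂ) : e a * e (-a) = 1 := by rw [← e_add, add_neg_cancel, e_zero]

theorem limH_eq_trace (hN : 3 ≤ N) (K : Chain) (S : Phase N) (z : ℂ) :
    limH K S = 1 / 2 * (limL K S z * limL K S z).trace := by
  have n1 := fun i : Fin N => (add_one_ne hN i)
  have n2 := fun i : Fin N => (sub_one_ne hN i)
  have n3 := fun i : Fin N => (add_one_ne_sub_one hN i)
  have hN2 : (1 : Fin N) + 1 ≠ 0 := fun h => one_ne_neg_one hN (eq_neg_of_add_eq_zero_left h)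
  have n4 : ∀ i : Fin N, i ≠ i + 1 + 1 := fun i h => hN2 (by simpa [add_assoc] using h)
  have n5 : ∀ i : Fin N, i ≠ i - 1 - 1 := fun i h => hN2 (by
    rw [sub_sub, eq_comm, sub_eq_self] at h; exact h)
  have hE := e_mul_neg (z / N)
  rw [limH_eq_lDiag hN, Matrix.trace]
  have h : ∀ i, (limL K S z * limL K S z).diag i =
      lDiag S i ^ 2 + bond K S (i + 1) + bond K S i := by
    intro i
    rw [Matrix.diag_apply, limL_mul]
    simp only [limL_apply, bond, if_neg (n1 i).symm, if_neg (n2 i).symm, if_neg (n4 i),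
      if_neg (n5 i), sub_add_cancel, add_sub_cancel_right, if_true]
    linear_combination -4 * (Real.pi : ℂ) ^ 2 * ((if ((i + 1 : Fin N) : ℕ) = 0 then K.wrap else 1) *
      (S (i + 1) (i + 1 + 1) * S (i + 1) i) + (if (i : ℕ) = 0 then K.wrap else 1) *
      (S i (i + 1) * S i (i - 1))) * (e (z / N) * e (-(z / N)) * I_sq - hE)
  simp only [h, Finset.sum_add_distrib, sum_shift_add (bond K S)]
  ring

/-- An entry of the first limiting Lax matrix as a linear functional. -/
noncomputable def limLCLM (K : Chain) (z : ℂ) (i j : Fin N) : Phase N →L[ℂ] ℂ :=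
  LinearMap.toContinuousLinearMap
    { toFun := fun S => limL K S z i j
      map_add' := fun R S => by
        simp only [limL_apply, lDiag, Pi.add_apply, mul_add, Finset.sum_add_distrib]
        split_ifs <;> ring
      map_smul' := fun c S => by
        have : lDiag (c • S) i = c * lDiag S i := by
          simp only [lDiag, Pi.smul_apply, smul_eq_mul, Finset.mul_sum]
          exact Finset.sum_congr rfl fun k _ => by ring
        simp only [limL_apply, this, Pi.smul_apply, smul_eq_mul, RingHom.id_apply]
        split_ifs <;> ring }

theorem limLCLM_apply (K : Chain) (z : ℂ) (i j : Fin N) (S : Phase N) :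
    limLCLM K z i j S = limL K S z i j := rfl

/-- The diagonal of the first Lax matrix moves only by the difference of neighbouring interaction
terms. -/
theorem lDiag_ham (hN : 3 ≤ N) (K : Chain) (S : Phase N) (i : Fin N) :
    lDiag (ham (limH K) S) i = -(2 * Real.pi * I * N) * (bond K S i - bond K S (i + 1)) := by
  have h : ∀ k, lCoef (i - k) * ham (limH K) S k k = -N * (lCoef (i - k) * bond K S (k - 1) +
      lCoef (i - k) * bond K S (k + 1) - 2 * (lCoef (i - k) * bond K S k)) := by
    intro k
    rw [ham_limH hN, if_pos rfl]
    ring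
  rw [lDiag, Finset.sum_congr rfl fun k _ => h k, ← Finset.mul_sum]
  simp only [Finset.sum_sub_distrib, Finset.sum_add_distrib]
  have s1 : ∑ k, lCoef (i - k) * bond K S (k - 1) = ∑ k, lCoef (i - k - 1) * bond K S k := by
    rw [← sum_shift_add (fun k => lCoef (i - k) * bond K S (k - 1)) 1]
    refine Finset.sum_congr rfl fun k _ => ?_
    rw [add_sub_cancel_right, sub_add_eq_sub_sub]
  have s2 : ∑ k, lCoef (i - k) * bond K S (k + 1) = ∑ k, lCoef (i - k + 1) * bond K S k := by
    rw [← sum_shift_sub (fun k => lCoef (i - k) * bond K S (k + 1)) 1]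
    refine Finset.sum_congr rfl fun k _ => ?_
    rw [sub_add_cancel, sub_sub_eq_add_sub, sub_add_eq_add_sub]
  rw [s1, s2, ← Finset.sum_add_distrib, ← Finset.sum_sub_distrib]
  have t : ∀ k, lCoef (i - k - 1) * bond K S k + lCoef (i - k + 1) * bond K S k -
      2 * (lCoef (i - k) * bond K S k) =
      (if i = k then 2 * Real.pi * I * bond K S k else 0) -
        if i + 1 = k then 2 * Real.pi * I * bond K S k else 0 := by
    intro k
    have h1 := lCoef_sub_succ hN (i - k - 1)
    have h2 := lCoef_sub_succ hN (i - k)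
    simp only [sub_add_cancel, sub_eq_zero (a := i)] at h1
    simp only [show i - k + 1 = i + 1 - k by abel, sub_eq_zero (a := i + 1)] at h2
    rw [show i - k + 1 = i + 1 - k by abel]
    have e1 : lCoef (i - k - 1) * bond K S k + lCoef (i + 1 - k) * bond K S k -
      2 * (lCoef (i - k) * bond K S k) = ((lCoef (i - k - 1) - lCoef (i - k)) -
        (lCoef (i - k) - lCoef (i + 1 - k))) * bond K S k := by ring
    rw [e1, h1, h2]
    split_ifs <;> ring
  simp only [t, Finset.sum_sub_distrib, Finset.sum_ite_eq, Finset.mem_univ, if_true]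
  ring

/-- The Lax equation for the Hamiltonian vector field. Its diagonal uses `lDiag_ham`, its upper
diagonal uses `mDiag_succ_sub`, and its lower diagonal holds because the second Lax matrix has no
entries there. -/
theorem limL_ham (hN : 3 ≤ N) (K : Chain) (S : Phase N) (z : ℂ) : limL K (ham (limH K) S) z =
    (N : ℂ) • (limL K S z * limM S z - limM S z * limL K S z) := by
  ext i j
  have hE := e_mul_neg (z / N)
  have n1 := (add_one_ne hN (i + 1)).symm
  have n2 := (sub_one_ne hN i).symm
  have m1 := mDiag_succ_sub hN S i
  have m2 := mDiag_succ_sub hN S (i + 1)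
  have hI : (I : ℂ) ^ 2 = -1 := I_sq
  rw [Matrix.smul_apply, Matrix.sub_apply, limL_mul, limM_mul, limL_apply, lDiag_ham hN,
    ham_limH hN, ham_limH hN, if_neg n1, if_neg n2, smul_eq_mul]
  simp only [limL_apply, limM_apply, bond, sub_add_cancel, add_sub_cancel_right]
  -- the three conditions on `j` become formal variables, so that the rest is linear algebra
  obtain ⟨δ, hδ⟩ : ∃ δ : Prop → ℂ, ∀ (p : Prop) [Decidable p] (x : ℂ),
      (if p then x else 0) = x * δ p := by
    classical
    exact ⟨fun p => if p then 1 else 0, fun p _ x => by by_cases h : p <;> simp [h]⟩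
  generalize (if (i : ℕ) = 0 then K.wrap else 1) = w0 at *
  generalize (if ((i + 1 : Fin N) : ℕ) = 0 then K.wrap else 1) = w1 at *
  simp only [hδ]
  generalize e (z / N) = E at *
  generalize e (-(z / N)) = E' at *
  linear_combination 8 * (Real.pi : ℂ) ^ 3 * I * N * (w0 * (S i (i + 1) * S i (i - 1)) -
    w1 * (S (i + 1) (i + 1 + 1) * S (i + 1) i)) * δ (j = i) * hE +
    N * S (i + 1) (i + 1 + 1) * E' * δ (j = i + 1) * (2 * Real.pi * I * m2 - 2 * Real.pi * I * m1 +
      4 * (Real.pi : ℂ) ^ 2 * (lDiag S (i + 1) - lDiag S i) * hI)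

theorem limBracket_limL (hN : 3 ≤ N) (K : Chain) (S : Phase N) (z : ℂ) :
    Matrix.of (fun i j => limBracket (limH K) (fun R => limL K R z i j) S) =
      (N : ℂ) • (limL K S z * limM S z - limM S z * limL K S z) := by
  rw [← limL_ham hN]
  ext i j
  rw [Matrix.of_apply, limBracket_eq_ham, lieD]
  have h : HasFDerivAt (fun R => limL K R z i j) (limLCLM K z i j) S :=
    (limLCLM K z i j).hasFDerivAt
  rw [h.fderiv, limLCLM_apply]

theorem hasDerivAt_of_limMotionAt {K : Chain} {S : ℝ → Phase N} {t : ℝ}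
    (h : LimMotionAt K S t) : HasDerivAt S (ham (limH K) (S t)) t := by
  rw [hasDerivAt_pi]
  intro i
  rw [hasDerivAt_pi]
  intro j
  rw [← limBracket_coord]
  exact h i j

theorem hasDerivAt_limL (hN : 3 ≤ N) {K : Chain} {S : ℝ → Phase N} {t : ℝ}
    (h : LimMotionAt K S t) (z : ℂ) (i j : Fin N) :
    HasDerivAt (fun s => limL K (S s) z i j)
      (((N : ℂ) • (limL K (S t) z * limM (S t) z - limM (S t) z * limL K (S t) z)) i j) t := by
  rw [← limL_ham hN]
  exact ((limLCLM K z i j).restrictScalars ℝ).hasFDerivAt.comp_hasDerivAt t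
    (hasDerivAt_of_limMotionAt h)

theorem mCoef_eq_cos (i k : Fin N) : mCoef (i - k) = -((Real.pi : ℂ) ^ 2 / N) *
    ∑ m ∈ Finset.Ico 1 N, cos (2 * Real.pi * (m * (((i : ℕ) : ℂ) - ((k : ℕ) : ℂ)) / N)) *
      (sin (Real.pi * (m / N)) ^ 2)⁻¹ := by
  have h : mCoef (i - k) = (mCoef (i - k) + mCoef (k - i)) / 2 := by
    rw [← mCoef_neg (k - i), neg_sub]; ring
  rw [h, mCoef, mCoef, ← mul_add, ← Finset.sum_add_distrib, mul_div_assoc, Finset.sum_div]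
  congr 1
  refine Finset.sum_congr rfl fun m _ => ?_
  rw [cos_eq_e, χ_sub_eq, χ_sub_eq,
    show -((m : ℂ) * (((i : ℕ) : ℂ) - ((k : ℕ) : ℂ)) / N) =
      m * (((k : ℕ) : ℂ) - ((i : ℕ) : ℂ)) / N by ring]
  ring

theorem limBracket_coord_of_ne (hN : 3 ≤ N) (K : Chain) (S : Phase N) {i j : Fin N} (hij : i ≠ j) :
    limBracket (limH K) (coord i j) S = 4 * (Real.pi : ℂ) ^ 2 * S i j *
      ∑ m : Fin N, ∑ k ∈ Finset.Ico 1 N,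
        S m m * sin (Real.pi * (k * (((j : ℕ) : ℂ) - ((i : ℕ) : ℂ)) / N))
          * sin (Real.pi * (k * (((i : ℕ) : ℂ) + ((j : ℕ) : ℂ) - 2 * ((m : ℕ) : ℂ)) / N))
          * (1 - cos (2 * Real.pi * (k / N)))⁻¹ := by
  have hNc := N_ne_zero (N := N)
  rw [limBracket_coord, ham_limH hN, if_neg hij, sub_zero, mDiag, mDiag, ← Finset.sum_sub_distrib,
    mul_right_comm, mul_comm _ (S i j), mul_assoc, mul_comm (4 * (Real.pi : ℂ) ^ 2) (S i j),
    mul_assoc]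
  congr 1
  rw [Finset.mul_sum, Finset.mul_sum]
  refine Finset.sum_congr rfl fun m _ => ?_
  rw [← sub_mul, mCoef_eq_cos, mCoef_eq_cos, ← mul_sub, ← Finset.sum_sub_distrib, Finset.mul_sum,
    Finset.mul_sum, Finset.sum_mul, Finset.mul_sum]
  refine Finset.sum_congr rfl fun k hk => ?_
  rw [← sub_mul, cos_sub_cos, one_sub_cos, mul_inv,
    show (2 * Real.pi * (k * (((j : ℕ) : ℂ) - ((m : ℕ) : ℂ)) / N) +
      2 * Real.pi * (k * (((i : ℕ) : ℂ) - ((m : ℕ) : ℂ)) / N)) / 2 =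
      Real.pi * (k * (((i : ℕ) : ℂ) + ((j : ℕ) : ℂ) - 2 * ((m : ℕ) : ℂ)) / N) by ring,
    show (2 * Real.pi * (k * (((j : ℕ) : ℂ) - ((m : ℕ) : ℂ)) / N) -
      2 * Real.pi * (k * (((i : ℕ) : ℂ) - ((m : ℕ) : ℂ)) / N)) / 2 =
      Real.pi * (k * (((j : ℕ) : ℂ) - ((i : ℕ) : ℂ)) / N) by ring]
  generalize sin (Real.pi * (k * (((i : ℕ) : ℂ) + ((j : ℕ) : ℂ) - 2 * ((m : ℕ) : ℂ)) / N)) = x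
  generalize sin (Real.pi * (k * (((j : ℕ) : ℂ) - ((i : ℕ) : ℂ)) / N)) = y
  field_simp
  ring

end

section
variable {N : ℕ} [NeZero N]

/-! ### Differences on the cyclic group -/

theorem ofNat_zero : Fin.ofNat N 0 = 0 := by
  apply Fin.ext; simp

theorem ofNat_succ (n : ℕ) : Fin.ofNat N (n + 1) = Fin.ofNat N n + 1 := by
  apply Fin.ext
  simp [Fin.val_add]

theorem ofNat_val (i : Fin N) : Fin.ofNat N (i : ℕ) = i := by
  apply Fin.ext; simp

theorem val_ofNat {n : ℕ} (hn : n < N) : ((Fin.ofNat N n : Fin N) : ℕ) = n := by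
  simp [Nat.mod_eq_of_lt hn]

theorem sum_range_ofNat (w : Fin N → ℂ) : ∑ n ∈ Finset.range N, w (Fin.ofNat N n) = ∑ i, w i := by
  rw [Finset.sum_range]
  exact Finset.sum_congr rfl fun i _ => by rw [ofNat_val]

theorem val_add_one_of_lt' {i : Fin N} (h : (i : ℕ) + 1 < N) : ((i + 1 : Fin N) : ℕ) = i + 1 := by
  rw [Fin.val_add, Fin.val_one', Nat.add_mod_mod, Nat.mod_eq_of_lt h]

theorem val_add_one_of_eq {i : Fin N} (h : (i : ℕ) + 1 = N) : ((i + 1 : Fin N) : ℕ) = 0 := by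
  rw [Fin.val_add, Fin.val_one', Nat.add_mod_mod, h, Nat.mod_self]

theorem val_add_one_eq_zero_iff (i : Fin N) : ((i + 1 : Fin N) : ℕ) = 0 ↔ (i : ℕ) + 1 = N := by
  refine ⟨fun h => ?_, val_add_one_of_eq⟩
  by_contra h'
  rw [val_add_one_of_lt' (by omega)] at h
  omega

/-- The partial sums of a function on the cyclic group. -/
noncomputable def partialSum (w : Fin N → ℂ) (k : Fin N) : ℂ :=
  ∑ n ∈ Finset.range k, w (Fin.ofNat N n)

theorem partialSum_succ_sub {w : Fin N → ℂ} (hw : ∑ i, w i = 0) (k : Fin N) :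
    partialSum w (k + 1) - partialSum w k = w k := by
  rw [partialSum, partialSum]
  by_cases h : (k : ℕ) + 1 = N
  · have h1 := sum_range_ofNat w
    rw [hw] at h1
    have h2 : ∑ n ∈ Finset.range N, w (Fin.ofNat N n) =
        ∑ n ∈ Finset.range ((k : ℕ) + 1), w (Fin.ofNat N n) := by rw [h]
    rw [h2, Finset.sum_range_succ, ofNat_val] at h1
    rw [val_add_one_of_eq h, Finset.sum_range_zero]
    linear_combination -h1
  · rw [val_add_one_of_lt' (by omega), Finset.sum_range_succ, ofNat_val]
    ring

/-- A function with zero sum is the difference of a function with zero sum. -/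
theorem exists_primitive {w : Fin N → ℂ} (hw : ∑ i, w i = 0) :
    ∃ y : centred N, ∀ k, y.1 (k + 1) - y.1 k = w k := by
  refine ⟨⟨fun k => partialSum w k - (∑ i, partialSum w i) / N, ?_⟩, fun k => ?_⟩
  · change ∑ k, (partialSum w k - (∑ i, partialSum w i) / N) = 0
    have := N_ne_zero (N := N)
    rw [Finset.sum_sub_distrib, Finset.sum_const, Finset.card_univ, Fintype.card_fin, nsmul_eq_mul]
    field_simp
    ring
  · change partialSum w (k + 1) - _ - (partialSum w k - _) = _
    linear_combination partialSum_succ_sub hw k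

/-- A function with zero sum and zero differences vanishes. -/
theorem eq_zero_of_diff {y : Fin N → ℂ} (hy : ∑ i, y i = 0) (h : ∀ k, y (k - 1) = y k) : y = 0 := by
  have h0 : ∀ n : ℕ, y (Fin.ofNat N n) = y 0 := by
    intro n
    induction n with
    | zero => rw [ofNat_zero]
    | succ n ih =>
      rw [ofNat_succ, ← ih]
      have := h (Fin.ofNat N n + 1)
      rw [add_sub_cancel_right] at this
      exact this.symm
  have h1 : ∀ i, y i = y 0 := fun i => by rw [← h0 i, ofNat_val]
  have h2 : (N : ℂ) * y 0 = 0 := by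
    rw [← hy, Finset.sum_congr rfl fun i _ => h1 i]
    simp
  funext i
  rw [h1 i]
  exact (mul_eq_zero.1 h2).resolve_left N_ne_zero

/-! ### The bosonization map -/

/-- The logarithm of the exponential factor of an off-diagonal coordinate, divided by `2πi`. -/
noncomputable def bosonLog (i j : Fin N) (u : Fin N → ℂ) : ℂ :=
  if j = i - 1 then -(u j) else
    ∑ n ∈ Finset.range ((j - i : Fin N) : ℕ), u (i + Fin.ofNat N n)

/-- The constant factor of an off-diagonal coordinate. -/
noncomputable def bosonConst (K : Chain) (M d : ℂ) (c : Fin N → Fin N → ℂ) (i j : Fin N) : ℂ :=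
  if j = i + 1 then M * N
  else if j = i - 1 then (if (i : ℕ) = 0 then edge N K M d else M * N) else c i j

theorem bosonLog_succ (hN : 3 ≤ N) (i : Fin N) (u : Fin N → ℂ) : bosonLog i (i + 1) u = u i := by
  rw [bosonLog, if_neg (add_one_ne_sub_one hN i), add_sub_cancel_left, val_one hN,
    Finset.sum_range_one, ofNat_zero, add_zero]

theorem bosonLog_pred (i : Fin N) (u : Fin N → ℂ) : bosonLog i (i - 1) u = -(u (i - 1)) := by
  rw [bosonLog, if_pos rfl]

theorem boson_diag (K : Chain) (M d : ℂ) (c : Fin N → Fin N → ℂ) (x : Pairs N) (i : Fin N) :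
    boson K M d c x i i = N / (2 * Real.pi * I) * (x.2 (i - 1) - x.2 i) := by
  rw [boson, if_pos rfl]

theorem boson_of_ne (hN : 3 ≤ N) (K : Chain) (M d : ℂ) (c : Fin N → Fin N → ℂ) (x : Pairs N)
    {i j : Fin N} (h : i ≠ j) :
    boson K M d c x i j = bosonConst K M d c i j * e (bosonLog i j x.1) := by
  rw [boson, if_neg h.symm, bosonConst]
  by_cases h1 : j = i + 1
  · subst h1
    rw [if_pos rfl, if_pos rfl, bosonLog_succ hN]
  · rw [if_neg h1, if_neg h1]
    by_cases h2 : j = i - 1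
    · rw [if_pos h2, if_pos h2, bosonLog, if_pos h2]
    · rw [if_neg h2, if_neg h2, bosonLog, if_neg h2]

/-- The exponents telescope: they do not change around closed paths. -/
theorem bosonLog_diff (i j : Fin N) (y : Fin N → ℂ) :
    bosonLog i j (fun k => y (k + 1) - y k) = y j - y i := by
  rw [bosonLog]
  split_ifs with h
  · rw [h, sub_add_cancel]; ring
  · have := Finset.sum_range_sub (fun n => y (i + Fin.ofNat N n)) ((j - i : Fin N) : ℕ)
    simp only [ofNat_succ, ofNat_zero, add_zero, ofNat_val, add_sub_cancel, ← add_assoc] at this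
    exact this

/-- `bosonLog` as a linear functional. -/
noncomputable def bosonLogCLM (i j : Fin N) : (Fin N → ℂ) →L[ℂ] ℂ :=
  LinearMap.toContinuousLinearMap
    { toFun := bosonLog i j
      map_add' := fun u w => by
        simp only [bosonLog, Pi.add_apply, Finset.sum_add_distrib]
        split_ifs <;> ring
      map_smul' := fun a u => by
        simp only [bosonLog, Pi.smul_apply, smul_eq_mul, ← Finset.mul_sum, RingHom.id_apply]
        split_ifs <;> ring }

/-- The derivative of the bosonization map, in terms of its value `S`. -/
noncomputable def bosonDeriv (S : Phase N) : Pairs N →L[ℂ] Phase N :=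
  LinearMap.toContinuousLinearMap
    { toFun := fun w i j => if j = i then N / (2 * Real.pi * I) * (w.2 (i - 1) - w.2 i)
        else 2 * Real.pi * I * S i j * bosonLogCLM i j w.1
      map_add' := fun u w => by
        funext i j
        simp only [Prod.fst_add, Prod.snd_add, Pi.add_apply, map_add]
        split_ifs <;> ring
      map_smul' := fun a u => by
        funext i j
        simp only [Prod.smul_fst, Prod.smul_snd, Pi.smul_apply, smul_eq_mul, map_smul,
          RingHom.id_apply]
        split_ifs <;> ring }

theorem bosonDeriv_apply (S : Phase N) (w : Pairs N) (i j : Fin N) : bosonDeriv S w i j =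
    if j = i then N / (2 * Real.pi * I) * (w.2 (i - 1) - w.2 i)
    else 2 * Real.pi * I * S i j * bosonLog i j w.1 := rfl

theorem hasFDerivAt_boson (hN : 3 ≤ N) (K : Chain) (M d : ℂ) (c : Fin N → Fin N → ℂ)
    (x : Pairs N) : HasFDerivAt (boson K M d c) (bosonDeriv (boson K M d c x)) x := by
  rw [hasFDerivAt_pi']
  intro i
  rw [hasFDerivAt_pi']
  intro j
  by_cases h : j = i
  · subst h
    simp only [boson_diag]
    have hp : ∀ k : Fin N, HasFDerivAt (fun y : Pairs N => y.2 k)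
        ((ContinuousLinearMap.proj (R := ℂ) (φ := fun _ : Fin N => ℂ) k).comp
          (ContinuousLinearMap.snd ℂ (Fin N → ℂ) (Fin N → ℂ))) x := fun k =>
      ((ContinuousLinearMap.proj (R := ℂ) (φ := fun _ : Fin N => ℂ) k).comp
        (ContinuousLinearMap.snd ℂ (Fin N → ℂ) (Fin N → ℂ))).hasFDerivAt
    refine (((hp (j - 1)).sub (hp j)).const_mul (N / (2 * Real.pi * I) : ℂ)).congr_fderiv ?_
    ext w <;> simp [bosonDeriv_apply]
  · have hne : i ≠ j := fun h' => h h'.symm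
    simp only [boson_of_ne hN K M d c _ hne]
    have hl : HasFDerivAt (fun y : Pairs N => bosonLog i j y.1)
        ((bosonLogCLM i j).comp (ContinuousLinearMap.fst ℂ (Fin N → ℂ) (Fin N → ℂ))) x :=
      ((bosonLogCLM i j).comp (ContinuousLinearMap.fst ℂ (Fin N → ℂ) (Fin N → ℂ))).hasFDerivAt
    refine (((hasDerivAt_e _).comp_hasFDerivAt x hl).const_mul
      (bosonConst K M d c i j)).congr_fderiv ?_
    refine ContinuousLinearMap.ext fun w => ?_
    change bosonConst K M d c i j * (2 * Real.pi * I * e (bosonLog i j x.1) * bosonLog i j w.1) =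
      bosonDeriv (boson K M d c x) w i j
    rw [bosonDeriv_apply, if_neg h, boson_of_ne hN K M d c _ hne]
    ring

/-- The image of a position vector with primitive `y` is, up to a factor, the combination with the
coefficients `y k` of the Hamiltonian fields of the diagonal coordinates. -/
theorem weightCLM_eq_bosonDeriv (S : Phase N) (y : Fin N → ℂ) :
    bosonDeriv S (fun k => y (k + 1) - y k, 0) =
      (2 * Real.pi * I / N) • ∑ k, y k • weightCLM k S := by
  have hN := N_ne_zero (N := N)
  funext i j
  rw [bosonDeriv_apply, bosonLog_diff]
  simp only [Pi.smul_apply, Finset.sum_apply, weightCLM_apply, smul_eq_mul]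
  have h : ∀ k : Fin N, y k * ((N : ℂ) * ((if k = j then 1 else 0) - if k = i then 1 else 0) *
      S i j) = (if k = j then N * y k * S i j else 0) - if k = i then N * y k * S i j else 0 := by
    intro k; split_ifs <;> ring
  simp only [h, Finset.sum_sub_distrib, Finset.sum_ite_eq', Finset.mem_univ, if_true]
  split_ifs with hij
  · subst hij; simp
  · field_simp

/-- The image of a momentum vector is a diagonal matrix. -/
theorem bosonDeriv_snd (S : Phase N) (v : Fin N → ℂ) : bosonDeriv S (0, v) =
    (N / (2 * Real.pi * I) : ℂ) • ∑ i, (v (i - 1) - v i) • (unit i i : Phase N) := by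
  funext i j
  rw [bosonDeriv_apply]
  simp only [Pi.smul_apply, Finset.sum_apply, unit_apply, smul_eq_mul, mul_ite, mul_one, mul_zero]
  have h0 : bosonLog i j 0 = 0 := (bosonLogCLM i j).map_zero
  rw [h0, mul_zero]
  by_cases h : j = i
  · subst h; simp
  · rw [if_neg h, Finset.sum_eq_zero, mul_zero]
    intro k _
    rw [if_neg]
    rintro ⟨h1, h2⟩
    exact h (h2.trans h1.symm)

/-- The contraction of the image of the canonical Poisson tensor. It depends on the vectors `p k`
only up to a constant, so it is the same on `ℂ^{2N}` and on the centre-of-mass phase space. -/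
theorem sum_bosonDeriv (S : Phase N) (φ γ : Phase N →L[ℂ] ℂ) (a : ℂ) (p : Fin N → Fin N → ℂ)
    (hp : ∀ k i, p k i = (if i = k then 1 else 0) - a) :
    ∑ k, φ (bosonDeriv S (0, p k)) * γ (bosonDeriv S (p k, 0)) =
      ∑ i, φ (unit i i) * γ (weightCLM i S) := by
  have hpi : (2 * Real.pi * I : ℂ) ≠ 0 := two_pi_I_ne_zero
  have hNc := N_ne_zero (N := N)
  have h1 : ∀ k, φ (bosonDeriv S (0, p k)) =
      N / (2 * Real.pi * I) * (φ (unit (k + 1) (k + 1)) - φ (unit k k)) := by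
    intro k
    rw [bosonDeriv_snd, map_smul, map_sum, smul_eq_mul]
    have : ∀ i : Fin N, φ ((p k (i - 1) - p k i) • (unit i i : Phase N)) =
        (if i = k + 1 then φ (unit i i) else 0) - if i = k then φ (unit i i) else 0 := by
      intro i
      rw [map_smul, smul_eq_mul, hp, hp, sub_sub_sub_cancel_right]
      simp only [sub_eq_iff_eq_add]
      split_ifs <;> ring
    simp only [this, Finset.sum_sub_distrib, Finset.sum_ite_eq', Finset.mem_univ, if_true]
  have h2 : ∀ k, γ (bosonDeriv S (p (k - 1), 0)) - γ (bosonDeriv S (p k, 0)) =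
      2 * Real.pi * I / N * γ (weightCLM k S) := by
    intro k
    have hd : ((p (k - 1), 0) : Pairs N) - (p k, 0) =
        (fun l => (Pi.single k 1 : Fin N → ℂ) (l + 1) - (Pi.single k 1 : Fin N → ℂ) l, 0) := by
      rw [Prod.mk_sub_mk, sub_self]
      congr 1
      funext l
      simp only [Pi.sub_apply, hp, Pi.single_apply, eq_sub_iff_add_eq]
      ring
    rw [← map_sub, ← map_sub, hd, weightCLM_eq_bosonDeriv, map_smul, smul_eq_mul, map_sum]
    congr 1
    rw [Finset.sum_eq_single k (fun i _ hi => by simp [hi]) (by simp)]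
    simp
  simp only [h1]
  have h3 : ∀ k, (N / (2 * Real.pi * I) * (φ (unit (k + 1) (k + 1)) - φ (unit k k))) *
      γ (bosonDeriv S (p k, 0)) =
      N / (2 * Real.pi * I) * (φ (unit (k + 1) (k + 1)) * γ (bosonDeriv S (p (k + 1 - 1), 0))) -
      N / (2 * Real.pi * I) * (φ (unit k k) * γ (bosonDeriv S (p k, 0))) := by
    intro k
    rw [add_sub_cancel_right]
    ring
  simp only [h3, Finset.sum_sub_distrib]
  rw [sum_shift_add (fun k => (N / (2 * Real.pi * I) : ℂ) *
    (φ (unit k k) * γ (bosonDeriv S (p (k - 1), 0)))) 1, ← Finset.sum_sub_distrib]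
  refine Finset.sum_congr rfl fun k _ => ?_
  rw [← mul_sub, ← mul_sub, h2]
  field_simp

/-- The limiting bracket is the image of the canonical one, and also of the reduced one. -/
theorem limBracket_eq_sum_bosonDeriv (F G : Phase N → ℂ) (S : Phase N) (a : ℂ)
    (p : Fin N → Fin N → ℂ) (hp : ∀ k i, p k i = (if i = k then 1 else 0) - a) :
    ∑ k, (fderiv ℂ F S (bosonDeriv S (0, p k)) * fderiv ℂ G S (bosonDeriv S (p k, 0)) -
      fderiv ℂ F S (bosonDeriv S (p k, 0)) * fderiv ℂ G S (bosonDeriv S (0, p k))) =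
      limBracket F G S := by
  have h := sum_bosonDeriv S (fderiv ℂ G S) (fderiv ℂ F S) a p hp
  simp only [mul_comm (fderiv ℂ G S _)] at h
  rw [Finset.sum_sub_distrib, sum_bosonDeriv S _ _ a p hp, h, ← Finset.sum_sub_distrib,
    limBracket_eq]
  rfl

/-- Bosonization is a Poisson map. -/
theorem canBracket_boson (hN : 3 ≤ N) (K : Chain) (M d : ℂ) (c : Fin N → Fin N → ℂ)
    (F G : Phase N → ℂ) (x : Pairs N) (hF : DifferentiableAt ℂ F (boson K M d c x))
    (hG : DifferentiableAt ℂ G (boson K M d c x)) :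
    canBracket (F ∘ boson K M d c) (G ∘ boson K M d c) x =
      limBracket F G (boson K M d c x) := by
  have hB := hasFDerivAt_boson hN K M d c x
  rw [← limBracket_eq_sum_bosonDeriv F G _ 0 (fun k => Pi.single k 1)
    (fun k i => by rw [Pi.single_apply, sub_zero]), canBracket]
  rw [(hF.hasFDerivAt.comp x hB).fderiv, (hG.hasFDerivAt.comp x hB).fderiv]
  rfl

/-- The inclusion of the centre-of-mass phase space as a continuous linear map. -/
noncomputable def inclCLM : TodaPhase N →L[ℂ] Pairs N :=
  (centred N).subtypeL.prodMap (centred N).subtypeL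

theorem hasFDerivAt_bosonT (hN : 3 ≤ N) (K : Chain) (M d : ℂ) (c : Fin N → Fin N → ℂ)
    (x : TodaPhase N) :
    HasFDerivAt (bosonT K M d c) ((bosonDeriv (bosonT K M d c x)).comp inclCLM) x :=
  (hasFDerivAt_boson hN K M d c (incl x)).comp x inclCLM.hasFDerivAt

theorem todaBracket_eq (F G : TodaPhase N → ℂ) (x : TodaPhase N) : todaBracket F G x =
    ∑ k : Fin N, (fderiv ℂ F x (0, proj k) * fderiv ℂ G x (proj k, 0) -
      fderiv ℂ F x (proj k, 0) * fderiv ℂ G x (0, proj k)) := by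
  have h : hamField F x = ∑ k : Fin N, (fderiv ℂ F x (0, proj k) • ((proj k, 0) : TodaPhase N) -
      fderiv ℂ F x (proj k, 0) • ((0, proj k) : TodaPhase N)) := by
    rw [hamField]
    refine Prod.ext ?_ ?_
    · simp [Prod.fst_sum]
    · simp [Prod.snd_sum]
  rw [todaBracket, h, map_sum]
  refine Finset.sum_congr rfl fun k _ => ?_
  rw [map_sub, map_smul, map_smul, smul_eq_mul, smul_eq_mul]

/-- Bosonization is a Poisson map on the centre-of-mass phase space. The projected basis vectors
`proj k` take the place of the standard ones. -/
theorem todaBracket_bosonT (hN : 3 ≤ N) (K : Chain) (M d : ℂ) (c : Fin N → Fin N → ℂ)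
    (F G : Phase N → ℂ) (x : TodaPhase N) (hF : DifferentiableAt ℂ F (bosonT K M d c x))
    (hG : DifferentiableAt ℂ G (bosonT K M d c x)) :
    todaBracket (F ∘ bosonT K M d c) (G ∘ bosonT K M d c) x =
      limBracket F G (bosonT K M d c x) := by
  have hB := hasFDerivAt_bosonT hN K M d c x
  rw [← limBracket_eq_sum_bosonDeriv F G _ (1 / N) (fun k => (proj k).1) (fun k i => rfl),
    todaBracket_eq]
  rw [(hF.hasFDerivAt.comp x hB).fderiv, (hG.hasFDerivAt.comp x hB).fderiv]
  rfl

end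

section
variable {N : ℕ} [NeZero N]

/-! ### The symplectic leaf -/

theorem mul_N_ne_zero {M : ℂ} (hM : M ≠ 0) : M * N ≠ 0 := mul_ne_zero hM N_ne_zero

theorem boson_succ (hN : 3 ≤ N) (K : Chain) (M d : ℂ) (c : Fin N → Fin N → ℂ) (x : Pairs N)
    (i : Fin N) : boson K M d c x i (i + 1) = M * N * e (x.1 i) := by
  rw [boson_of_ne hN _ _ _ _ _ (add_one_ne hN i).symm, bosonConst, if_pos rfl, bosonLog_succ hN]

theorem boson_pred (hN : 3 ≤ N) (K : Chain) (M d : ℂ) (c : Fin N → Fin N → ℂ) (x : Pairs N)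
    (i : Fin N) : boson K M d c x (i + 1) i =
      (if (i : ℕ) + 1 = N then edge N K M d else M * N) * e (-(x.1 i)) := by
  have h := add_one_ne_sub_one hN (i + 1)
  rw [add_sub_cancel_right] at h
  have h2 := bosonLog_pred (i + 1) x.1
  rw [add_sub_cancel_right] at h2
  rw [boson_of_ne hN _ _ _ _ _ (add_one_ne hN i), bosonConst, if_neg h.symm,
    add_sub_cancel_right, if_pos rfl, h2]
  simp only [val_add_one_eq_zero_iff]

theorem bosonT_diag (K : Chain) (M d : ℂ) (c : Fin N → Fin N → ℂ) (x : TodaPhase N)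
    (i : Fin N) : bosonT K M d c x i i = N / (2 * Real.pi * I) * (x.2.1 (i - 1) - x.2.1 i) :=
  boson_diag K M d c (incl x) i

theorem bosonT_succ (hN : 3 ≤ N) (K : Chain) (M d : ℂ) (c : Fin N → Fin N → ℂ)
    (x : TodaPhase N) (i : Fin N) : bosonT K M d c x i (i + 1) = M * N * e (x.1.1 i) :=
  boson_succ hN K M d c (incl x) i

theorem bosonT_pred (hN : 3 ≤ N) (K : Chain) (M d : ℂ) (c : Fin N → Fin N → ℂ)
    (x : TodaPhase N) (i : Fin N) : bosonT K M d c x (i + 1) i =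
      (if (i : ℕ) + 1 = N then edge N K M d else M * N) * e (-(x.1.1 i)) :=
  boson_pred hN K M d c (incl x) i

theorem bosonT_succ_ne_zero (hN : 3 ≤ N) (K : Chain) {M : ℂ} (hM : M ≠ 0) (d : ℂ)
    (c : Fin N → Fin N → ℂ) (x : TodaPhase N) (i : Fin N) : bosonT K M d c x i (i + 1) ≠ 0 := by
  rw [bosonT_succ hN]
  exact mul_ne_zero (mul_N_ne_zero hM) (e_ne_zero _)

theorem sum_bosonT_diag (K : Chain) (M d : ℂ) (c : Fin N → Fin N → ℂ) (x : TodaPhase N) :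
    ∑ i, bosonT K M d c x i i = 0 := by
  simp only [bosonT_diag, ← Finset.mul_sum, Finset.sum_sub_distrib]
  rw [sum_shift_sub, sub_self, mul_zero]

theorem ofNat_add_ne {i : Fin N} {k : ℕ} (hk : 0 < k) (hk' : k < N) : i + Fin.ofNat N k ≠ i := by
  intro h
  have h1 : Fin.ofNat N k = 0 := by simpa using h
  have h2 := congrArg Fin.val h1
  rw [val_ofNat hk'] at h2
  simp at h2
  omega

theorem bosonT_mem_leaf (hN : 3 ≤ N) (K : Chain) (M d : ℂ) (c : Fin N → Fin N → ℂ)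
    (x : TodaPhase N) : bosonT K M d c x ∈ leaf K M d c := by
  refine ⟨sum_bosonT_diag K M d c x, ?_, fun i => ?_, fun i k hk hk' => ?_⟩
  · have hu : ∑ i, x.1.1 i = 0 := x.1.2
    simp only [bosonT_succ hN]
    rw [Finset.prod_mul_distrib, ← e_sum, hu, e_zero, mul_one, Finset.prod_const,
      Finset.card_univ, Fintype.card_fin]
  · rw [bosonT_succ hN, bosonT_pred hN]
    linear_combination M * N * (if (i : ℕ) + 1 = N then edge N K M d else M * N) *
      e_mul_neg (x.1.1 i)
  · -- the exponents cancel because they are differences of a primitive `y` of `u`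
    obtain ⟨y, hy⟩ := exists_primitive x.1.2
    have hy' : (fun k => y.1 (k + 1) - y.1 k) = x.1.1 := funext hy
    have hsum : ∑ j ∈ Finset.range k, x.1.1 (i + Fin.ofNat N j) =
        y.1 (i + Fin.ofNat N k) - y.1 i := by
      have := Finset.sum_range_sub (fun n => y.1 (i + Fin.ofNat N n)) k
      simp only [ofNat_succ, ofNat_zero, add_zero, ← add_assoc, hy] at this
      exact this
    have hval : ((Fin.ofNat N k : Fin N) : ℕ) = k := val_ofNat (by omega)
    have hc : bosonConst K M d c (i + Fin.ofNat N k) i = c (i + Fin.ofNat N k) i := by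
      rw [bosonConst, if_neg, if_neg]
      · intro h
        have h1 : Fin.ofNat N k = 1 := by
          have : i + (Fin.ofNat N k - 1) = i + 0 := by rw [add_zero, ← add_sub_assoc, ← h]
          exact sub_eq_zero.1 (add_left_cancel this)
        have h2 := congrArg Fin.val h1
        rw [hval, val_one hN] at h2
        omega
      · intro h
        have h1 : Fin.ofNat N (k + 1) = 0 := by
          rw [ofNat_succ]
          have := congrArg (fun a => a - i) h
          simpa [add_assoc] using this.symm
        have h2 := congrArg Fin.val h1
        rw [val_ofNat (by omega)] at h2
        simp at h2
    have hb : bosonT K M d c x (i + Fin.ofNat N k) i =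
        c (i + Fin.ofNat N k) i * e (y.1 i - y.1 (i + Fin.ofNat N k)) := by
      rw [← bosonLog_diff, hy', ← hc]
      exact boson_of_ne hN K M d c (incl x) (ofNat_add_ne (by omega) (by omega))
    simp only [bosonT_succ hN]
    rw [Finset.prod_mul_distrib, ← e_sum, hsum, hb, Finset.prod_const, Finset.card_range]
    have := e_mul_neg (y.1 (i + Fin.ofNat N k) - y.1 i)
    rw [neg_sub] at this
    linear_combination (M * N) ^ k * c (i + Fin.ofNat N k) i * this

theorem ne_zero_of_mem_leaf {K : Chain} {M d : ℂ} {c : Fin N → Fin N → ℂ} (hM : M ≠ 0)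
    {S : Phase N} (hS : S ∈ leaf K M d c) (i : Fin N) : S i (i + 1) ≠ 0 := by
  intro h
  have h1 := hS.2.1
  rw [Finset.prod_eq_zero (Finset.mem_univ i) h] at h1
  exact pow_ne_zero _ (mul_N_ne_zero hM) h1.symm

/-- A point of the level set is determined by the entries on the diagonal and next to it. -/
theorem leaf_ext {K : Chain} {M d : ℂ} {c : Fin N → Fin N → ℂ} (hM : M ≠ 0)
    {R S : Phase N} (hR : R ∈ leaf K M d c) (hS : S ∈ leaf K M d c)
    (hd : ∀ i, R i i = S i i) (hs : ∀ i, R i (i + 1) = S i (i + 1)) : R = S := by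
  have h0 := ne_zero_of_mem_leaf hM hR
  funext i j
  by_cases h1 : i = j
  · rw [h1, hd]
  by_cases h2 : i = j + 1
  · have := (hR.2.2.1 j).trans (hS.2.2.1 j).symm
    rw [← hs] at this
    rw [h2]
    exact mul_left_cancel₀ (h0 j) this
  by_cases h3 : i + 1 = j
  · rw [← h3, hs]
  have hk : i = j + Fin.ofNat N ((i - j : Fin N) : ℕ) := by rw [ofNat_val]; abel
  have k0 : ((i - j : Fin N) : ℕ) ≠ 0 := by
    rw [Ne, val_eq_zero_iff, sub_eq_zero]; exact h1
  have k1 : ((i - j : Fin N) : ℕ) ≠ 1 := by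
    intro h
    rw [h, ofNat_succ, ofNat_zero, zero_add] at hk
    exact h2 hk
  have k2 : ((i - j : Fin N) : ℕ) + 1 ≠ N := by
    intro h
    have := val_add_one_of_eq h
    rw [val_eq_zero_iff] at this
    exact h3 (by rw [← sub_eq_zero, ← this]; abel)
  have k3 := (i - j : Fin N).2
  have := (hR.2.2.2 j _ (by omega) (show ((i - j : Fin N) : ℕ) + 2 ≤ N by omega)).trans
    (hS.2.2.2 j _ (by omega) (by omega)).symm
  rw [← hk] at this
  simp only [← hs] at this
  exact mul_left_cancel₀ (Finset.prod_ne_zero_iff.2 fun a _ => h0 _) this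

theorem exists_e_eq {w : ℂ} (hw : w ≠ 0) : ∃ a, e a = w := by
  have h0 : (2 * Real.pi * I : ℂ) ≠ 0 := two_pi_I_ne_zero
  refine ⟨log w / (2 * Real.pi * I), ?_⟩
  rw [e, mul_div_cancel₀ _ h0, exp_log hw]

/-- Nonzero numbers with product one have logarithms with zero sum. -/
theorem exists_log_centred {w : Fin N → ℂ} (hw : ∏ i, w i = 1) :
    ∃ u : centred N, ∀ i, e (u.1 i) = w i := by
  have hne : ∀ i, w i ≠ 0 := fun i h => by
    rw [Finset.prod_eq_zero (Finset.mem_univ i) h] at hw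
    exact zero_ne_one hw
  choose a ha using fun i => exists_e_eq (hne i)
  have h1 : e (∑ i, a i) = 1 := by
    rw [e_sum, ← hw]
    exact Finset.prod_congr rfl fun i _ => ha i
  obtain ⟨n, hn⟩ := (e_eq_one_iff _).1 h1
  refine ⟨⟨fun i => a i - if i = 0 then (n : ℂ) else 0, ?_⟩, fun i => ?_⟩
  · change ∑ i, (a i - if i = 0 then (n : ℂ) else 0) = 0
    rw [Finset.sum_sub_distrib, Finset.sum_ite_eq', if_pos (Finset.mem_univ _), hn, sub_self]
  · change e (a i - if i = 0 then (n : ℂ) else 0) = w i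
    rw [e_sub, ha]
    split_ifs
    · rw [e_int, inv_one, mul_one]
    · rw [e_zero, inv_one, mul_one]

/-- Bosonization parametrizes the level set of the Casimir functions: the logarithms of the entries
`(i, i + 1)` give the positions, the diagonal gives the differences of the momenta, and `leaf_ext`
takes care of the other entries. -/
theorem range_bosonT (hN : 3 ≤ N) (K : Chain) {M : ℂ} (hM : M ≠ 0) (d : ℂ)
    (c : Fin N → Fin N → ℂ) : Set.range (bosonT K M d c) = leaf K M d c := by
  have hMN : M * N ≠ 0 := mul_N_ne_zero hM
  have hpi : (2 * Real.pi * I : ℂ) ≠ 0 := two_pi_I_ne_zero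
  have hNc := N_ne_zero (N := N)
  refine Set.Subset.antisymm ?_ fun S hS => ?_
  · rintro _ ⟨x, rfl⟩
    exact bosonT_mem_leaf hN K M d c x
  · have h1 : ∏ i, S i (i + 1) / (M * N) = 1 := by
      rw [Finset.prod_div_distrib, hS.2.1, Finset.prod_const, Finset.card_univ, Fintype.card_fin,
        div_self (pow_ne_zero _ hMN)]
    obtain ⟨u, hu⟩ := exists_log_centred h1
    have h2 : ∑ k : Fin N, -(2 * Real.pi * I / N * S (k + 1) (k + 1)) = 0 := by
      rw [Finset.sum_neg_distrib, ← Finset.mul_sum, sum_shift_add (fun k => S k k), hS.1, mul_zero,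
        neg_zero]
    obtain ⟨v, hv⟩ := exists_primitive h2
    refine ⟨(u, v), leaf_ext hM (bosonT_mem_leaf hN K M d c _) hS (fun i => ?_) fun i => ?_⟩
    · rw [bosonT_diag]
      have := hv (i - 1)
      rw [sub_add_cancel] at this
      rw [← neg_sub, this]
      field_simp
    · rw [bosonT_succ hN, hu, mul_div_cancel₀ _ hMN]

theorem bosonT_eq_iff (hN : 3 ≤ N) (K : Chain) {M : ℂ} (hM : M ≠ 0) (d : ℂ)
    (c : Fin N → Fin N → ℂ) (x y : TodaPhase N) : bosonT K M d c x = bosonT K M d c y ↔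
      x.2 = y.2 ∧ ∀ i, ∃ n : ℤ, x.1.1 i - y.1.1 i = n := by
  have hMN : M * N ≠ 0 := mul_N_ne_zero hM
  have hpi : (2 * Real.pi * I : ℂ) ≠ 0 := two_pi_I_ne_zero
  refine ⟨fun h => ⟨?_, fun i => ?_⟩, fun h => ?_⟩
  · have h1 : x.2.1 - y.2.1 = 0 := by
      refine eq_zero_of_diff (x.2 - y.2).2 fun k => ?_
      have h2 := congrFun (congrFun h k) k
      rw [bosonT_diag, bosonT_diag] at h2
      have h3 := mul_left_cancel₀ (div_ne_zero N_ne_zero hpi) h2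
      simp only [Pi.sub_apply]
      linear_combination h3
    exact Subtype.ext (sub_eq_zero.1 h1)
  · have h2 := congrFun (congrFun h i) (i + 1)
    rw [bosonT_succ hN, bosonT_succ hN] at h2
    have h3 := mul_left_cancel₀ hMN h2
    rw [← e_eq_one_iff, e_sub, h3, mul_inv_cancel₀ (e_ne_zero _)]
  · obtain ⟨hv, hu⟩ := h
    choose n hn using hu
    funext i j
    by_cases hij : i = j
    · rw [← hij, bosonT_diag, bosonT_diag, hv]
    have h1 : ∃ m : ℤ, bosonLog i j x.1.1 - bosonLog i j y.1.1 = m := by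
      simp only [bosonLog]
      split_ifs
      · exact ⟨-n j, by push_cast; rw [← hn]; ring⟩
      · refine ⟨∑ a ∈ Finset.range ((j - i : Fin N) : ℕ), n (i + Fin.ofNat N a), ?_⟩
        push_cast
        rw [← Finset.sum_sub_distrib]
        exact Finset.sum_congr rfl fun a _ => hn _
    obtain ⟨m, hm⟩ := h1
    refine (boson_of_ne hN K M d c (incl x) hij).trans
      (Eq.trans ?_ (boson_of_ne hN K M d c (incl y) hij).symm)
    change _ * e (bosonLog i j x.1.1) = _ * e (bosonLog i j y.1.1)
    rw [sub_eq_iff_eq_add.1 hm, e_add, e_int, one_mul]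

/-- The entries `(i, i + 1)` detect the positions, and the diagonal detects the differences of the
momenta. -/
theorem bosonDeriv_injective (hN : 3 ≤ N) {S : Phase N} (hS : ∀ i, S i (i + 1) ≠ 0) :
    Function.Injective ((bosonDeriv S).comp inclCLM) := by
  have hpi : (2 * Real.pi * I : ℂ) ≠ 0 := two_pi_I_ne_zero
  rw [injective_iff_map_eq_zero]
  intro w hw
  have h : ∀ i j, bosonDeriv S (incl w) i j = 0 := fun i j => congrFun (congrFun hw i) j
  refine Prod.ext (Subtype.ext ?_) (Subtype.ext ?_)
  · funext i
    have := h i (i + 1)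
    rw [bosonDeriv_apply, if_neg (add_one_ne hN i), bosonLog_succ hN] at this
    exact (mul_eq_zero.1 this).resolve_left (mul_ne_zero hpi (hS i))
  · refine eq_zero_of_diff w.2.2 fun k => ?_
    have := h k k
    rw [bosonDeriv_apply, if_pos rfl] at this
    exact sub_eq_zero.1 ((mul_eq_zero.1 this).resolve_left (div_ne_zero N_ne_zero hpi))

omit [NeZero N] in
theorem limTensor_self (S : Phase N) (k : Fin N) :
    (fun i j => limTensor S k k i j : Phase N) = weightCLM k S := by
  funext i j
  rw [limTensor_eq', if_pos rfl]
  simp [weightCLM_apply]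

omit [NeZero N] in
theorem limTensor_of_ne (S : Phase N) {k l : Fin N} (h : k ≠ l) :
    (fun i j => limTensor S k l i j : Phase N) = (-(N * S k l)) • (unit l l - unit k k) := by
  funext i j
  rw [limTensor_eq', if_neg h]
  simp only [Pi.smul_apply, Pi.sub_apply, unit_apply, weightCLM_apply, smul_eq_mul]
  by_cases hij : i = j
  · subst hij; simp; ring
  · have h1 : ∀ m : Fin N, ¬ (i = m ∧ j = m) := fun m hm => hij (hm.1.trans hm.2.symm)
    simp [hij, h1]

/-- The image of the derivative is spanned by the Hamiltonian vectors: the positions give the fields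
of the diagonal coordinates, and the momenta those of the off-diagonal ones. -/
theorem range_bosonDeriv (hN : 3 ≤ N) {S : Phase N} (hS : ∀ i, S i (i + 1) ≠ 0) :
    ((bosonDeriv S).comp inclCLM).range = hamSpan S := by
  have hpi : (2 * Real.pi * I : ℂ) ≠ 0 := two_pi_I_ne_zero
  have hNc := N_ne_zero (N := N)
  refine le_antisymm ?_ (Submodule.span_le.2 ?_)
  · rintro _ ⟨w, rfl⟩
    have hw : ((bosonDeriv S).comp inclCLM) w =
        bosonDeriv S (w.1.1, 0) + bosonDeriv S (0, w.2.1) := by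
      rw [← map_add, Prod.mk_add_mk, add_zero, zero_add]
      rfl
    have hmem : ∀ k l, (fun i j => limTensor S k l i j : Phase N) ∈ hamSpan S := fun k l =>
      Submodule.subset_span ⟨(k, l), rfl⟩
    change ((bosonDeriv S).comp inclCLM) w ∈ hamSpan S
    rw [hw]
    refine add_mem ?_ ?_
    · obtain ⟨y, hy⟩ := exists_primitive w.1.2
      have hy' : w.1.1 = fun k => y.1 (k + 1) - y.1 k := (funext hy).symm
      rw [hy', weightCLM_eq_bosonDeriv]
      refine Submodule.smul_mem _ _ (Submodule.sum_mem _ fun k _ => Submodule.smul_mem _ _ ?_)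
      rw [← limTensor_self]
      exact hmem k k
    · have h1 : ∑ i, (w.2.1 (i - 1) - w.2.1 i) • (unit i i : Phase N) =
          ∑ i, w.2.1 i • (unit (i + 1) (i + 1) - unit i i : Phase N) := by
        simp only [sub_smul, smul_sub, Finset.sum_sub_distrib]
        rw [← sum_shift_add (fun i => w.2.1 (i - 1) • (unit i i : Phase N)) 1]
        simp only [add_sub_cancel_right]
      rw [bosonDeriv_snd, h1]
      refine Submodule.smul_mem _ _ (Submodule.sum_mem _ fun i _ => Submodule.smul_mem _ _ ?_)
      have h2 := hmem i (i + 1)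
      rw [limTensor_of_ne S (add_one_ne hN i).symm] at h2
      exact (Submodule.smul_mem_iff _ (neg_ne_zero.2 (mul_ne_zero hNc (hS i)))).1 h2
  · rintro _ ⟨⟨k, l⟩, rfl⟩
    change (fun i j => limTensor S k l i j : Phase N) ∈ ((bosonDeriv S).comp inclCLM).range
    by_cases hkl : k = l
    · subst hkl
      have h0 : ∑ i, ((Pi.single k 1 : Fin N → ℂ) (i + 1) - (Pi.single k 1 : Fin N → ℂ) i) = 0 := by
        rw [Finset.sum_sub_distrib, sum_shift_add, sub_self]
      have h1 : bosonDeriv S (fun i => (Pi.single k 1 : Fin N → ℂ) (i + 1) -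
          (Pi.single k 1 : Fin N → ℂ) i, 0) = (2 * Real.pi * I / N : ℂ) • weightCLM k S := by
        rw [weightCLM_eq_bosonDeriv, Finset.sum_eq_single k (fun i _ hi => by simp [hi]) (by simp)]
        simp
      rw [limTensor_self]
      refine (Submodule.smul_mem_iff _ (div_ne_zero hpi hNc)).1 ?_
      rw [← h1]
      exact ⟨((⟨_, h0⟩ : centred N), 0), rfl⟩
    · rw [limTensor_of_ne S hkl]
      refine Submodule.smul_mem _ _ ?_
      have h0 : ∑ i : Fin N,
          ((if i = k - 1 then (1 : ℂ) else 0) - if i = l - 1 then 1 else 0) = 0 := by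
        simp
      obtain ⟨v, hv⟩ := exists_primitive h0
      have h1 : bosonDeriv S (0, v.1) = (N / (2 * Real.pi * I) : ℂ) •
          (unit l l - unit k k : Phase N) := by
        have h2 : ∀ i, v.1 (i - 1) - v.1 i =
            (if i = l then (1 : ℂ) else 0) - if i = k then 1 else 0 := by
          intro i
          have := hv (i - 1)
          simp only [sub_add_cancel, sub_left_inj] at this
          rw [← neg_sub, this, neg_sub]
        rw [bosonDeriv_snd]
        simp only [h2, sub_smul, ite_smul, one_smul, zero_smul, Finset.sum_sub_distrib,
          Finset.sum_ite_eq', Finset.mem_univ, if_true]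
      refine (Submodule.smul_mem_iff _ (div_ne_zero hNc hpi)).1 ?_
      rw [← h1]
      exact ⟨(0, v), rfl⟩

end

section
variable {N : ℕ} [NeZero N]

/-! ### Reduction to the Toda chain -/

/-- Both sides have zero sum and, by `lDiag_sub_succ`, the same differences. -/
theorem lDiag_bosonT (hN : 3 ≤ N) (K : Chain) (M d : ℂ) (c : Fin N → Fin N → ℂ)
    (x : TodaPhase N) (i : Fin N) : lDiag (bosonT K M d c x) i = N * x.2.1 i := by
  have hpi : (2 * Real.pi * I : ℂ) ≠ 0 := two_pi_I_ne_zero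
  have hv : ∑ i, x.2.1 i = 0 := x.2.2
  have h : (fun i => lDiag (bosonT K M d c x) i - N * x.2.1 i) = 0 := by
    refine eq_zero_of_diff ?_ fun k => ?_
    · rw [Finset.sum_sub_distrib, sum_lDiag, ← Finset.mul_sum, hv, mul_zero, sub_zero]
    · have h1 := lDiag_sub_succ hN (bosonT K M d c x) (k - 1)
      rw [sub_add_cancel, sum_bosonT_diag, bosonT_diag, zero_div, sub_zero, ← mul_assoc,
        mul_div_cancel₀ _ hpi] at h1
      change lDiag (bosonT K M d c x) (k - 1) - _ = lDiag (bosonT K M d c x) k - _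
      linear_combination h1
  exact sub_eq_zero.1 (congrFun h i)

theorem limH_bosonT (hN : 3 ≤ N) (K : Chain) (M d : ℂ) (c : Fin N → Fin N → ℂ)
    (x : TodaPhase N) : limH K (bosonT K M d c x) = (N : ℂ) ^ 2 * todaH K M (incl x) := by
  have h : ∀ i, bond K (bosonT K M d c x) (i + 1) = (N : ℂ) ^ 2 * (4 * (Real.pi : ℂ) ^ 2 * M ^ 2 *
      ((if (i : ℕ) + 1 = N then K.wrap else 1) * e (x.1.1 (i + 1) - x.1.1 i))) := by
    intro i
    rw [bond, add_sub_cancel_right, bosonT_succ hN, bosonT_pred hN, sub_eq_add_neg (x.1.1 (i + 1)),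
      e_add]
    simp only [val_add_one_eq_zero_iff]
    split_ifs
    · cases K <;> simp only [Chain.wrap, edge] <;> ring
    · ring
  have h1 : todaH K M (incl x) = 1 / 2 * ∑ i, x.2.1 i ^ 2 + 4 * (Real.pi : ℂ) ^ 2 * M ^ 2 *
      ∑ i : Fin N, (if (i : ℕ) + 1 = N then K.wrap else 1) * e (x.1.1 (i + 1) - x.1.1 i) := rfl
  rw [limH_eq_lDiag hN, ← sum_shift_add (bond K (bosonT K M d c x)) 1, h1]
  simp only [h, lDiag_bosonT hN, mul_pow, ← Finset.mul_sum]
  ring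

theorem differentiable_limH (K : Chain) : Differentiable ℂ (limH (N := N) K) := by
  unfold limH
  fun_prop

/-- The derivative of the bosonization map carries the Hamiltonian vector field of the Toda chain
into that of the limiting top. -/
theorem bosonDeriv_hamField (hN : 3 ≤ N) (K : Chain) (M d : ℂ) (c : Fin N → Fin N → ℂ)
    (x : TodaPhase N) :
    bosonDeriv (bosonT K M d c x)
        (incl (hamField (fun y => (N : ℂ) ^ 2 * todaH K M (incl y)) x)) =
      ham (limH K) (bosonT K M d c x) := by
  have hH : (fun y => (N : ℂ) ^ 2 * todaH K M (incl y)) = limH K ∘ bosonT K M d c :=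
    funext fun y => (limH_bosonT hN K M d c y).symm
  funext i j
  have hc : HasFDerivAt (coord i j) (coordCLM i j) (bosonT K M d c x) := hasFDerivAt_coord i j _
  rw [← limBracket_coord, ← todaBracket_bosonT hN K M d c _ _ x
    (differentiable_limH K _) hc.differentiableAt, todaBracket,
    (hc.comp x (hasFDerivAt_bosonT hN K M d c x)).fderiv, hH]
  rfl

/-- The velocities of the particles along the Toda flow. -/
theorem hamField_toda_fst (hN : 3 ≤ N) (K : Chain) {M : ℂ} (hM : M ≠ 0) (x : TodaPhase N)
    (i : Fin N) :
    (hamField (fun y => (N : ℂ) ^ 2 * todaH K M (incl y)) x).1.1 i = (N : ℂ) ^ 2 * x.2.1 i := by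
  have hpi : (2 * Real.pi * I : ℂ) ≠ 0 := two_pi_I_ne_zero
  -- compare the components at `(i, i + 1)`, where the values of the constants do not matter
  have h := congrFun (congrFun (bosonDeriv_hamField hN K M 0 0 x) i) (i + 1)
  rw [bosonDeriv_apply, if_neg (add_one_ne hN i), bosonLog_succ hN, ham_limH hN,
    if_neg (add_one_ne hN i).symm, sub_zero, mDiag_succ_sub hN, lDiag_bosonT hN] at h
  refine mul_left_cancel₀ (mul_ne_zero hpi (bosonT_succ_ne_zero hN K hM 0 0 x i)) ?_
  refine h.trans ?_
  ring

theorem todaBracket_fst (H : TodaPhase N → ℂ) (i : Fin N) (x : TodaPhase N) :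
    todaBracket H (fun y => (incl y).1 i) x = (hamField H x).1.1 i := by
  have h : HasFDerivAt (fun y : TodaPhase N => (incl y).1 i)
      (((ContinuousLinearMap.proj (R := ℂ) (φ := fun _ : Fin N => ℂ) i).comp
        (ContinuousLinearMap.fst ℂ (Fin N → ℂ) (Fin N → ℂ))).comp inclCLM) x :=
    ContinuousLinearMap.hasFDerivAt
      (((ContinuousLinearMap.proj (R := ℂ) (φ := fun _ : Fin N => ℂ) i).comp
        (ContinuousLinearMap.fst ℂ (Fin N → ℂ) (Fin N → ℂ))).comp inclCLM)
  rw [todaBracket, h.fderiv]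
  rfl

theorem todaBracket_snd (H : TodaPhase N → ℂ) (i : Fin N) (x : TodaPhase N) :
    todaBracket H (fun y => (incl y).2 i) x = (hamField H x).2.1 i := by
  have h : HasFDerivAt (fun y : TodaPhase N => (incl y).2 i)
      (((ContinuousLinearMap.proj (R := ℂ) (φ := fun _ : Fin N => ℂ) i).comp
        (ContinuousLinearMap.snd ℂ (Fin N → ℂ) (Fin N → ℂ))).comp inclCLM) x :=
    ContinuousLinearMap.hasFDerivAt
      (((ContinuousLinearMap.proj (R := ℂ) (φ := fun _ : Fin N => ℂ) i).comp
        (ContinuousLinearMap.snd ℂ (Fin N → ℂ) (Fin N → ℂ))).comp inclCLM)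
  rw [todaBracket, h.fderiv]
  rfl

omit [NeZero N] in
theorem sum_deriv_centred (y : ℝ → centred N) (t : ℝ)
    (hy : ∀ i, DifferentiableAt ℝ (fun s => (y s).1 i) t) :
    ∑ i, deriv (fun s => (y s).1 i) t = 0 := by
  have h1 := HasDerivAt.fun_sum (u := Finset.univ) fun i _ => (hy i).hasDerivAt
  have h2 : (fun s => ∑ i, (y s).1 i) = fun _ => 0 := funext fun s => (y s).2
  rw [h2] at h1
  exact h1.unique (hasDerivAt_const t 0)

/-- The equations of motion correspond to each other because the derivative of the bosonization map
is injective and carries one Hamiltonian vector field into the other. -/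
theorem limMotionAt_bosonT_iff (hN : 3 ≤ N) (K : Chain) {M : ℂ} (hM : M ≠ 0) (d : ℂ)
    (c : Fin N → Fin N → ℂ) (x : ℝ → TodaPhase N) (t : ℝ)
    (hx : ∀ i, DifferentiableAt ℝ (fun s => (x s).1.1 i) t ∧
      DifferentiableAt ℝ (fun s => (x s).2.1 i) t) :
    LimMotionAt K (fun s => bosonT K M d c (x s)) t ↔
      TodaMotionAt (fun y => (N : ℂ) ^ 2 * todaH K M (incl y)) x t := by
  let H : TodaPhase N → ℂ := fun y => (N : ℂ) ^ 2 * todaH K M (incl y)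
  let ξ : TodaPhase N :=
    (⟨fun i => deriv (fun s => (x s).1.1 i) t, sum_deriv_centred _ t fun i => (hx i).1⟩,
      ⟨fun i => deriv (fun s => (x s).2.1 i) t, sum_deriv_centred _ t fun i => (hx i).2⟩)
  have h1 : ∀ i, HasDerivAt (fun s => (x s).1.1 i) (ξ.1.1 i) t := fun i => (hx i).1.hasDerivAt
  have h2 : ∀ i, HasDerivAt (fun s => (x s).2.1 i) (ξ.2.1 i) t := fun i => (hx i).2.hasDerivAt
  have hincl : HasDerivAt (fun s => incl (x s)) (incl ξ) t :=
    (hasDerivAt_pi.2 h1).prodMk (hasDerivAt_pi.2 h2)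
  have hB : HasDerivAt (fun s => bosonT K M d c (x s))
      (bosonDeriv (bosonT K M d c (x t)) (incl ξ)) t := by
    have hr := (hasFDerivAt_boson hN K M d c (incl (x t))).restrictScalars ℝ
    exact hr.comp_hasDerivAt t hincl
  have hBij := fun i j => hasDerivAt_pi.1 (hasDerivAt_pi.1 hB i) j
  have e1 : LimMotionAt K (fun s => bosonT K M d c (x s)) t ↔
      bosonDeriv (bosonT K M d c (x t)) (incl ξ) = ham (limH K) (bosonT K M d c (x t)) := by
    simp only [LimMotionAt, limBracket_coord]
    refine ⟨fun h => funext fun i => funext fun j => (hBij i j).unique (h i j), fun h i j => ?_⟩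
    rw [← h]
    exact hBij i j
  have e2 : TodaMotionAt H x t ↔ ξ = hamField H (x t) := by
    simp only [TodaMotionAt, todaBracket_fst, todaBracket_snd]
    refine ⟨fun h => Prod.ext (Subtype.ext (funext fun i => (h1 i).unique (h i).1))
      (Subtype.ext (funext fun i => (h2 i).unique (h i).2)), fun h i => ?_⟩
    rw [← h]
    exact ⟨h1 i, h2 i⟩
  rw [e1, e2, ← bosonDeriv_hamField hN]
  exact (bosonDeriv_injective hN (bosonT_succ_ne_zero hN K hM d c (x t))).eq_iff (a := ξ)
    (b := hamField H (x t))

/-! ### The gauge transformation -/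

/-- The sum of the values at the indices smaller than `i`. -/
noncomputable def sumLt (w : Fin N → ℂ) (i : Fin N) : ℂ :=
  ∑ k ∈ Finset.univ.filter (fun k => k < i), w k

/-- For a vector with zero sum the recursion also holds at the last index, where the left side is an
empty sum. -/
theorem sumLt_succ {w : Fin N → ℂ} (hw : ∑ i, w i = 0) (i : Fin N) :
    sumLt w (i + 1) = sumLt w i + w i := by
  have h1 : sumLt w i + w i = ∑ k ∈ Finset.univ.filter (fun k => k ≤ i), w k := by
    have : Finset.univ.filter (fun k => k ≤ i) =
        insert i (Finset.univ.filter (fun k : Fin N => k < i)) := by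
      ext k
      simp [le_iff_eq_or_lt]
    rw [this, Finset.sum_insert (by simp), add_comm, sumLt]
  rw [h1, sumLt]
  by_cases h : (i : ℕ) + 1 = N
  · rw [Finset.filter_true_of_mem (p := fun k => k ≤ i) fun k _ => by
      rw [Fin.le_def]; omega, hw]
    refine Finset.sum_eq_zero fun k hk => ?_
    rw [Finset.mem_filter, Fin.lt_def, val_add_one_of_eq h] at hk
    omega
  · refine Finset.sum_congr (Finset.filter_congr fun k _ => ?_) fun _ _ => rfl
    rw [Fin.lt_def, Fin.le_def, val_add_one_of_lt' (by omega), Nat.lt_succ_iff]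

omit [NeZero N] in
theorem sum_sumLt {w : Fin N → ℂ} (hw : ∑ i, w i = 0) :
    ∑ i, sumLt w i = -∑ i : Fin N, (((i : ℕ) : ℂ) + 1) * w i := by
  have h : ∀ k : Fin N, ∑ i, (if k < i then w k else 0) = N * w k - (((k : ℕ) : ℂ) + 1) * w k := by
    intro k
    have hk : (k : ℕ) + 1 ≤ N := k.2
    rw [← Finset.sum_filter, Finset.sum_const, Finset.filter_lt_eq_Ioi, Fin.card_Ioi, nsmul_eq_mul,
      Nat.sub_sub, add_comm 1, Nat.cast_sub hk]
    push_cast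
    ring
  simp only [sumLt, Finset.sum_filter]
  rw [Finset.sum_comm]
  simp only [h, Finset.sum_sub_distrib, ← Finset.mul_sum, hw]
  ring

omit [NeZero N] in
theorem gauge_eq (z : ℂ) (x : Pairs N) (i : Fin N) :
    gauge z x i = e ((((i : ℕ) : ℂ) + 1) * z / N - sumLt x.1 i) := by
  rw [gauge, sub_eq_add_neg, e_add, sumLt, ← Finset.sum_neg_distrib, e_sum]

omit [NeZero N] in
theorem gauge_ne_zero (z : ℂ) (x : Pairs N) (i : Fin N) : gauge z x i ≠ 0 := by
  rw [gauge_eq]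
  exact e_ne_zero _

/-- The quotient of neighbouring gauge factors. The last one carries the spectral parameter, since
`e(N z / N) = e(z)`. -/
theorem gauge_succ (z : ℂ) (x : TodaPhase N) (i : Fin N) : gauge z (incl x) (i + 1) =
    gauge z (incl x) i * (e (z / N) * e (-(x.1.1 i)) * if (i : ℕ) + 1 = N then e (-z) else 1) := by
  have hN := N_ne_zero (N := N)
  have hs : sumLt (incl x).1 (i + 1) = sumLt (incl x).1 i + x.1.1 i := sumLt_succ x.1.2 i
  rw [gauge_eq, gauge_eq, hs]
  by_cases h : (i : ℕ) + 1 = N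
  · have h' : ((i : ℕ) : ℂ) + 1 = N := by exact_mod_cast h
    rw [if_pos h, val_add_one_of_eq h, h', ← e_add, ← e_add, ← e_add]
    congr 1
    field_simp
    push_cast
    ring
  · rw [if_neg h, val_add_one_of_lt' (by omega), mul_one, ← e_add, ← e_add]
    congr 1
    push_cast
    ring

omit [NeZero N] in
theorem inv_diagonal_gauge (z : ℂ) (x : Pairs N) :
    (Matrix.diagonal (gauge z x))⁻¹ = Matrix.diagonal fun i => (gauge z x i)⁻¹ := by
  refine Matrix.inv_eq_left_inv ?_
  rw [Matrix.diagonal_mul_diagonal, ← Matrix.diagonal_one]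
  congr 1
  funext i
  exact inv_mul_cancel₀ (gauge_ne_zero z x i)

omit [NeZero N] in
theorem gauge_conj_apply (z : ℂ) (x : Pairs N) (A : Matrix (Fin N) (Fin N) ℂ) (i j : Fin N) :
    ((Matrix.diagonal (gauge z x))⁻¹ * A * Matrix.diagonal (gauge z x)) i j =
      (gauge z x i)⁻¹ * A i j * gauge z x j := by
  rw [inv_diagonal_gauge, Matrix.mul_diagonal, Matrix.diagonal_mul]

/-- The gauge transformation of an entry above the diagonal. -/
theorem gauge_hop (hN : 3 ≤ N) (K : Chain) (M d : ℂ) (c : Fin N → Fin N → ℂ) (x : TodaPhase N)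
    (z : ℂ) (i : Fin N) :
    (gauge z (incl x) i)⁻¹ * (bosonT K M d c x (i + 1) (i + 1 + 1) * e (-(z / N))) *
      gauge z (incl x) (i + 1) = M * N * hop z (incl x) i := by
  have hg := gauge_ne_zero z (incl x) i
  have he := e_mul_neg (z / N)
  have h : hop z (incl x) i =
      e (x.1.1 (i + 1)) * e (-(x.1.1 i)) * if (i : ℕ) + 1 = N then e (-z) else 1 := by
    simp only [hop, sub_eq_add_neg, e_add, incl]
    split_ifs
    · rfl
    · rw [mul_one]
  rw [gauge_succ, bosonT_succ hN, h]
  field_simp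
  linear_combination M * N * e (x.1.1 (i + 1)) * e (-(x.1.1 i)) *
    (if (i : ℕ) + 1 = N then e (-z) else 1) * he

theorem gauge_limL (hN : 3 ≤ N) (K : Chain) (M d : ℂ) (c : Fin N → Fin N → ℂ)
    (x : TodaPhase N) (z : ℂ) :
    (Matrix.diagonal (gauge z (incl x)))⁻¹ * limL K (bosonT K M d c x) z *
      Matrix.diagonal (gauge z (incl x)) = todaL K M z (incl x) := by
  ext i j
  rw [gauge_conj_apply, limL_apply, todaL, Matrix.of_apply]
  have hg := gauge_ne_zero z (incl x) i
  by_cases h1 : j = i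
  · subst h1
    rw [if_pos rfl, if_pos rfl, if_neg (add_one_ne hN j).symm, if_neg (sub_one_ne hN j).symm,
      lDiag_bosonT hN, add_zero, sub_zero, mul_right_comm, inv_mul_cancel₀ hg, one_mul]
    rfl
  rw [if_neg h1, if_neg h1]
  by_cases h2 : j = i + 1
  · subst h2
    rw [if_pos rfl, if_pos rfl, if_neg (add_one_ne_sub_one hN i)]
    linear_combination 2 * Real.pi * I * gauge_hop hN K M d c x z i
  rw [if_neg h2, if_neg h2]
  by_cases h3 : j = i - 1
  · obtain rfl : i = j + 1 := by rw [h3, sub_add_cancel]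
    rw [if_pos h3, if_pos h3, ← h3, bosonT_pred hN]
    have hj := gauge_ne_zero z (incl x) j
    have he := e_ne_zero (z / N)
    have hu := e_ne_zero (-(x.1.1 j))
    have hz := e_ne_zero (-z)
    have hzz := e_mul_neg z
    simp only [val_add_one_eq_zero_iff, gauge_succ]
    split_ifs
    · have hK : K.wrap * edge N K M d = K.wrap * (M * N) := by
        -- the corner constant matters only for the periodic chain, where it is `M N`
        cases K
        · rfl
        · simp only [Chain.wrap, zero_mul]
      field_simp
      linear_combination -(2 * Real.pi * I * e (z / N) * e (-(x.1.1 j))) * hK +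
        2 * Real.pi * I * e (z / N) * e (-(x.1.1 j)) * K.wrap * M * N * hzz
    · field_simp
      ring
  · rw [if_neg h3, if_neg h3]
    ring

/-- Both sides have zero sum and, by `mDiag_succ_sub`, the same differences. -/
theorem mDiag_bosonT (hN : 3 ≤ N) (K : Chain) (M d : ℂ) (c : Fin N → Fin N → ℂ)
    (x : TodaPhase N) (i : Fin N) : mDiag (bosonT K M d c x) i =
      2 * Real.pi * I * (N * sumLt x.2.1 i + ∑ k : Fin N, (((k : ℕ) : ℂ) + 1) * x.2.1 k) := by
  have h : (fun i => mDiag (bosonT K M d c x) i - 2 * Real.pi * I *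
      (N * sumLt x.2.1 i + ∑ k : Fin N, (((k : ℕ) : ℂ) + 1) * x.2.1 k)) = 0 := by
    refine eq_zero_of_diff ?_ fun k => ?_
    · rw [Finset.sum_sub_distrib, sum_mDiag, ← Finset.mul_sum, Finset.sum_add_distrib,
        ← Finset.mul_sum, sum_sumLt x.2.2, Finset.sum_const, Finset.card_univ, Fintype.card_fin,
        nsmul_eq_mul]
      ring
    · have h1 := mDiag_succ_sub hN (bosonT K M d c x) (k - 1)
      have h2 := sumLt_succ x.2.2 (k - 1)
      rw [sub_add_cancel] at h1 h2
      rw [lDiag_bosonT hN] at h1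
      rw [h2]
      linear_combination -h1
  exact sub_eq_zero.1 (congrFun h i)

omit [NeZero N] in
theorem hasDerivAt_gauge (z : ℂ) {x : ℝ → TodaPhase N} {t : ℝ} {w : Fin N → ℂ}
    (h : ∀ k, HasDerivAt (fun s => (incl (x s)).1 k) (w k) t) (i : Fin N) :
    HasDerivAt (fun s => gauge z (incl (x s)) i)
      (-(2 * Real.pi * I * sumLt w i) * gauge z (incl (x t)) i) t := by
  simp only [gauge_eq]
  have h1 : HasDerivAt (fun s => (((i : ℕ) : ℂ) + 1) * z / N - sumLt (incl (x s)).1 i)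
      (-(sumLt w i)) t :=
    (HasDerivAt.fun_sum fun k _ => h k).const_sub _
  refine ((hasDerivAt_e _).comp t h1).congr_deriv ?_
  ring

theorem gauge_limM (hN : 3 ≤ N) (K : Chain) {M : ℂ} (hM : M ≠ 0) (d : ℂ)
    (c : Fin N → Fin N → ℂ) {x : ℝ → TodaPhase N} {t : ℝ}
    (hx : TodaMotionAt (fun y => (N : ℂ) ^ 2 * todaH K M (incl y)) x t) (z : ℂ) :
    (Matrix.diagonal (gauge z (incl (x t))))⁻¹ * limM (bosonT K M d c (x t)) z *
        Matrix.diagonal (gauge z (incl (x t))) +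
      (1 / (N : ℂ)) • ((Matrix.diagonal (gauge z (incl (x t))))⁻¹ *
        Matrix.diagonal (fun i => deriv (fun s => gauge z (incl (x s)) i) t)) =
    todaM M z (incl (x t)) + (2 * Real.pi * I * ∑ i : Fin N, (((i : ℕ) : ℂ) + 1) * (x t).2.1 i) •
      (1 : Matrix (Fin N) (Fin N) ℂ) := by
  have hNc := N_ne_zero (N := N)
  have hu : ∀ k, HasDerivAt (fun s => (incl (x s)).1 k) ((N : ℂ) ^ 2 * (x t).2.1 k) t := by
    intro k
    have := (hx k).1
    rwa [todaBracket_fst, hamField_toda_fst hN K hM] at this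
  have hg : ∀ i, deriv (fun s => gauge z (incl (x s)) i) t =
      -(2 * Real.pi * I * ((N : ℂ) ^ 2 * sumLt (x t).2.1 i)) * gauge z (incl (x t)) i := by
    intro i
    rw [(hasDerivAt_gauge z hu i).deriv, sumLt, sumLt, ← Finset.mul_sum]
  ext i j
  have h0 := gauge_ne_zero z (incl (x t)) i
  rw [Matrix.add_apply, Matrix.add_apply, gauge_conj_apply, Matrix.smul_apply, Matrix.smul_apply,
    inv_diagonal_gauge, Matrix.diagonal_mul_diagonal, limM_apply, todaM, Matrix.of_apply]
  by_cases h1 : j = i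
  · subst h1
    rw [Matrix.diagonal_apply_eq, Matrix.one_apply_eq, if_pos rfl,
      if_neg (add_one_ne hN j).symm, if_neg (add_one_ne hN j).symm, hg, mDiag_bosonT hN,
      smul_eq_mul, smul_eq_mul]
    field_simp
    ring
  rw [Matrix.diagonal_apply_ne' _ h1, Matrix.one_apply_ne' h1, smul_zero, smul_zero, add_zero,
    add_zero, if_neg h1, zero_add]
  by_cases h2 : j = i + 1
  · subst h2
    rw [if_pos rfl, if_pos rfl]
    linear_combination 4 * (Real.pi : ℂ) ^ 2 * gauge_hop hN K M d c (x t) z i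
  · rw [if_neg h2, if_neg h2]
    ring

end

end EllipticTop

theorem mainTheorem5 {N : ℕ} [NeZero N] (hN : 3 ≤ N) (K : EllipticTop.Chain) :
    -- Inozemtsev limit of the Lax pair, of the Hamiltonian and of the Poisson brackets
    (∀ (S : EllipticTop.Phase N) (z : ℂ),
      Tendsto (fun τ => EllipticTop.topL (EllipticTop.unscale K τ S) (z + τ / 2) τ)
        (comap Complex.im atTop) (𝓝 (EllipticTop.limL K S z)) ∧
      Tendsto (fun τ => EllipticTop.topM (EllipticTop.unscale K τ S) (z + τ / 2) τ)
        (comap Complex.im atTop) (𝓝 (EllipticTop.limM S z)) ∧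
      Tendsto (fun τ => EllipticTop.topH (EllipticTop.unscale K τ S) τ)
        (comap Complex.im atTop) (𝓝 (EllipticTop.limH K S))) ∧
    (∀ (F G : EllipticTop.Phase N → ℂ) (S : EllipticTop.Phase N),
      DifferentiableAt ℂ F S → DifferentiableAt ℂ G S →
      Tendsto (fun τ => EllipticTop.scaledBracket K τ F G S)
        (comap Complex.im atTop) (𝓝 (EllipticTop.limBracket F G S))) ∧
    -- the limiting brackets form a Poisson algebra, with the following Casimir functions
    EllipticTop.IsPoisson (EllipticTop.limBracket (N := N)) ∧
    (∀ (G : EllipticTop.Phase N → ℂ) (S : EllipticTop.Phase N), DifferentiableAt ℂ G S →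
      EllipticTop.limBracket (fun R => ∑ i, R i i) G S = 0 ∧
      ∀ (k : ℕ) (σ : Fin k → Fin N), 2 ≤ k → Function.Injective σ →
        EllipticTop.limBracket (fun R => ∏ a, R (σ a) (σ (finRotate k a))) G S = 0) ∧
    -- Lax equation of the limiting system, and the dynamics of the off-diagonal coordinates
    (∀ (S : EllipticTop.Phase N) (z : ℂ),
      EllipticTop.limH K S
        = 1 / 2 * (EllipticTop.limL K S z * EllipticTop.limL K S z).trace ∧
      Matrix.of (fun i j => EllipticTop.limBracket (EllipticTop.limH K)
          (fun R => EllipticTop.limL K R z i j) S)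
        = (N : ℂ) • (EllipticTop.limL K S z * EllipticTop.limM S z
            - EllipticTop.limM S z * EllipticTop.limL K S z)) ∧
    (∀ (S : ℝ → EllipticTop.Phase N) (t : ℝ), EllipticTop.LimMotionAt K S t → ∀ (z : ℂ) (i j),
      HasDerivAt (fun s => EllipticTop.limL K (S s) z i j)
        (((N : ℂ) • (EllipticTop.limL K (S t) z * EllipticTop.limM (S t) z
            - EllipticTop.limM (S t) z * EllipticTop.limL K (S t) z)) i j) t) ∧
    (∀ (S : EllipticTop.Phase N) (i j : Fin N), i ≠ j →
      EllipticTop.limBracket (EllipticTop.limH K) (EllipticTop.coord i j) S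
        = 4 * (Real.pi : ℂ) ^ 2 * S i j * ∑ m : Fin N, ∑ k ∈ Finset.Ico 1 N,
            S m m * Complex.sin (Real.pi * (k * (((j : ℕ) : ℂ) - ((i : ℕ) : ℂ)) / N))
              * Complex.sin
                  (Real.pi * (k * (((i : ℕ) : ℂ) + ((j : ℕ) : ℂ) - 2 * ((m : ℕ) : ℂ)) / N))
              * (1 - Complex.cos (2 * Real.pi * (k / N)))⁻¹) ∧
    -- bosonization
    (∀ (M d : ℂ) (c : Fin N → Fin N → ℂ), M ≠ 0 →
      -- it is a Poisson map for the canonical brackets, before and after the reduction to the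
      -- centre-of-mass frame
      (∀ (F G : EllipticTop.Phase N → ℂ) (x : EllipticTop.Pairs N),
        DifferentiableAt ℂ F (EllipticTop.boson K M d c x) →
        DifferentiableAt ℂ G (EllipticTop.boson K M d c x) →
        EllipticTop.canBracket (F ∘ EllipticTop.boson K M d c) (G ∘ EllipticTop.boson K M d c) x
          = EllipticTop.limBracket F G (EllipticTop.boson K M d c x)) ∧
      (∀ (F G : EllipticTop.Phase N → ℂ) (x : EllipticTop.TodaPhase N),
        DifferentiableAt ℂ F (EllipticTop.bosonT K M d c x) →
        DifferentiableAt ℂ G (EllipticTop.bosonT K M d c x) →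
        EllipticTop.todaBracket (F ∘ EllipticTop.bosonT K M d c)
            (G ∘ EllipticTop.bosonT K M d c) x
          = EllipticTop.limBracket F G (EllipticTop.bosonT K M d c x)) ∧
      -- it is an immersion onto the level set of the Casimir functions, which is a symplectic
      -- leaf, and it is injective up to integer shifts of the positions
      Differentiable ℂ (EllipticTop.bosonT K M d c) ∧
      Set.range (EllipticTop.bosonT K M d c) = EllipticTop.leaf K M d c ∧
      (∀ x y : EllipticTop.TodaPhase N,
        EllipticTop.bosonT K M d c x = EllipticTop.bosonT K M d c y ↔
          x.2 = y.2 ∧ ∀ i, ∃ n : ℤ, x.1.1 i - y.1.1 i = n) ∧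
      (∀ x : EllipticTop.TodaPhase N,
        Function.Injective (fderiv ℂ (EllipticTop.bosonT K M d c) x) ∧
        (fderiv ℂ (EllipticTop.bosonT K M d c) x).range
          = EllipticTop.hamSpan (EllipticTop.bosonT K M d c x)) ∧
      -- the Hamiltonian and the equations of motion are those of the Toda chain
      (∀ x : EllipticTop.TodaPhase N,
        EllipticTop.limH K (EllipticTop.bosonT K M d c x)
          = (N : ℂ) ^ 2 * EllipticTop.todaH K M (EllipticTop.incl x)) ∧
      (∀ (x : ℝ → EllipticTop.TodaPhase N) (t : ℝ),
        (∀ i, DifferentiableAt ℝ (fun s => (x s).1.1 i) t ∧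
          DifferentiableAt ℝ (fun s => (x s).2.1 i) t) →
        (EllipticTop.LimMotionAt K (fun s => EllipticTop.bosonT K M d c (x s)) t ↔
          EllipticTop.TodaMotionAt
            (fun y => (N : ℂ) ^ 2 * EllipticTop.todaH K M (EllipticTop.incl y)) x t)) ∧
      -- after a gauge transformation the Lax pair takes the standard form
      (∀ (x : EllipticTop.TodaPhase N) (z : ℂ),
        (Matrix.diagonal (EllipticTop.gauge z (EllipticTop.incl x)))⁻¹
            * EllipticTop.limL K (EllipticTop.bosonT K M d c x) z
            * Matrix.diagonal (EllipticTop.gauge z (EllipticTop.incl x))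
          = EllipticTop.todaL K M z (EllipticTop.incl x)) ∧
      (∀ (x : ℝ → EllipticTop.TodaPhase N) (t : ℝ),
        EllipticTop.TodaMotionAt
          (fun y => (N : ℂ) ^ 2 * EllipticTop.todaH K M (EllipticTop.incl y)) x t →
        ∀ z : ℂ,
        (Matrix.diagonal (EllipticTop.gauge z (EllipticTop.incl (x t))))⁻¹
            * EllipticTop.limM (EllipticTop.bosonT K M d c (x t)) z
            * Matrix.diagonal (EllipticTop.gauge z (EllipticTop.incl (x t)))
          + (1 / (N : ℂ)) • ((Matrix.diagonal (EllipticTop.gauge z (EllipticTop.incl (x t))))⁻¹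
            * Matrix.diagonal
                (fun i => deriv (fun s => EllipticTop.gauge z (EllipticTop.incl (x s)) i) t))
          = EllipticTop.todaM M z (EllipticTop.incl (x t))
            + (2 * Real.pi * Complex.I * ∑ i : Fin N, (((i : ℕ) : ℂ) + 1) * (x t).2.1 i)
                • (1 : Matrix (Fin N) (Fin N) ℂ))) := by
  open EllipticTop in
  refine ⟨fun S z => ⟨tendsto_topL hN K S z, tendsto_topM hN K S z, tendsto_topH hN K S⟩,
    fun F G S hF hG => tendsto_scaledBracket hN K hF hG, isPoisson_limBracket,
    fun G S _ => ⟨limBracket_trace G S, fun k σ hk hσ => limBracket_cycle G S hk hσ⟩,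
    fun S z => ⟨limH_eq_trace hN K S z, limBracket_limL hN K S z⟩,
    fun S t h z i j => hasDerivAt_limL hN h z i j,
    fun S i j hij => limBracket_coord_of_ne hN K S hij, fun M d c hM => ?_⟩
  open EllipticTop in
  exact ⟨fun F G x hF hG => canBracket_boson hN K M d c F G x hF hG,
    fun F G x hF hG => todaBracket_bosonT hN K M d c F G x hF hG,
    fun x => (hasFDerivAt_bosonT hN K M d c x).differentiableAt,
    range_bosonT hN K hM d c, bosonT_eq_iff hN K hM d c,
    fun x => by
      rw [(hasFDerivAt_bosonT hN K M d c x).fderiv]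
      exact ⟨bosonDeriv_injective hN (bosonT_succ_ne_zero hN K hM d c x),
        range_bosonDeriv hN (bosonT_succ_ne_zero hN K hM d c x)⟩,
    limH_bosonT hN K M d c, limMotionAt_bosonT_iff hN K hM d c, gauge_limL hN K M d c,
    fun x t hx z => gauge_limM hN K hM d c hx z⟩
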